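/- All graphs are finite and simple, and $\mathbb Z^+$ denotes the positive integers. A \emph{temporal graph} $\mathcal G=(G,\mathcal T)$ consists of an underlying graph $G=(V,E)$ and a map $\mathcal T$ that assigns to every $e\in E$ a nonempty finite set $\mathcal T(e)\subset\mathbb Z^+$; its \emph{time-edges} are the pairs $(e,t)$ with $e\in E$, $t\in\mathcal T(e)$, and its lifetime $T(\mathcal G)$ is the largest label. An edge $e$ is \emph{$\Delta_1$-dense} in $[a,b]$ if for all $\tau\in[a,\max\{a,b-\Delta_1+1\}]$ there is $t\in\mathcal T(e)\cap[\tau,\tau+\Delta_1-1]$. A \emph{template} is a pair $(X,[a,b])$ with $X\subseteq V$ and $a\le b$; two templates $(X,[a,b])$, $(Y,[c,d])$ are \emph{$\Delta_2$-independent} if $X\cap Y=\emptyset$ or $|s-t|\ge\Delta_2$ for all $s\in[a,b]$, $t\in[c,d]$. $\mathcal G$ is a \emph{$(\Delta_1,\Delta_2)$-cluster temporal graph} if there is a collection of pairwise $\Delta_2$-independent templates, with intervals contained in $[1,T(\mathcal G)]$, such that for each time-edge $(xy,t)$ some template $(X,[a,b])$ of the collection has $x,y\in X$, $t\in[a,b]$,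 and such that for each template $(X,[a,b])$ of the collection and all distinct $x,y\in X$ the pair $xy$ is an edge that is $\Delta_1$-dense in $[a,b]$. \textsc{Cluster Editing}: given a graph $G$ and $k\in\mathbb Z^+$, can $G$ be turned into a disjoint union of cliques by at most $k$ additions and deletions of edges? \textsc{Editing to Temporal Cliques} (\textsc{ETC}): given a temporal graph $\mathcal G$ and $k,\Delta_1,\Delta_2\in\mathbb Z^+$, can $\mathcal G$ be turned into a $(\Delta_1,\Delta_2)$-cluster temporal graph by at most $k$ additions and deletions of time-edges? Static graphs are given by their vertices and list of edges, temporal graphs by their vertices and list of edges together with the list of times of each edge; numbers are written in binary. A problem \emph{on} a class has as its instances only those whose (temporal) graph lies in the class. Such a problem is in $\mathsf{NP}$ if it has a polynomial-time verifier with polynomially bounded certificates that is correct on all its instances, and it is $\mathsf{NP}$-complete if moreover every language in $\mathsf{NP}$ has a polynomial-time many-one reduction to it (mapping every string to an instance of the problem). \textbf{Proposition.} Let $\mathcal C$ be a class of graphs. The map $(G,k)\mapsto((G,\mathcal T),k,\Delta_1,\Delta_2)$ with $\mathcal T(e)=\{1\}$ for all $e\in E(G)$ and $\Delta_1=\Delta_2=1$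 is a polynomial-time many-one reduction from \textsc{Cluster Editing} on $\mathcal C$ to \textsc{ETC} on $\{(G,\mathcal T):G\in\mathcal C\}$. Consequently, if \textsc{Cluster Editing} is $\mathsf{NP}$-complete on $\mathcal C$, then \textsc{ETC} is $\mathsf{NP}$-complete on the class of temporal graphs $\{(G,\mathcal T):G\in\mathcal C\}$. -/

import Mathlib

/-! ## Decision problems, `NP` and `NP`-completeness

Polynomial time is Mathlib's `Turing.TM2ComputableInPolyTime`: computation by a multi-stack Turing
machine, with the number of steps bounded by a polynomial in the length of the input string. -/

/-- A decision problem: a set of instances, each written as a string over a finite alphabet, and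
the predicate singling out the yes-instances. -/
structure DecisionProblem where
  Instance : Type
  Symbol : Type
  [symbolFintype : Fintype Symbol]
  encode : Instance → List Symbol
  encode_injective : Function.Injective encode
  yes : Instance → Prop

namespace DecisionProblem

/-- The problem with fewer instances: only those that satisfy `p`. -/
def restrict (P : DecisionProblem) (p : P.Instance → Prop) : DecisionProblem where
  Instance := {x : P.Instance // p x}
  Symbol := P.Symbol
  symbolFintype := P.symbolFintype
  encode x := P.encode x.1
  encode_injective := P.encode_injective.comp Subtype.val_injective
  yes x := P.yes x.1

/-- The membership problem of a language over the binary alphabet. -/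
def ofLanguage (L : Language Bool) : DecisionProblem where
  Instance := List Bool
  Symbol := Bool
  encode := id
  encode_injective := Function.injective_id
  yes x := x ∈ L

/-- An instance together with a certificate, as one string. -/
def encodeWithCertificate (P : DecisionProblem) (x : P.Instance × List Bool) :
    List (P.Symbol ⊕ Bool) :=
  (P.encode x.1).map Sum.inl ++ x.2.map Sum.inr

/-- `P` is in `NP`: there is a verifier running in polynomial time such that the yes-instances are
exactly the instances with an accepted certificate of polynomially bounded length. -/
def InNP (P : DecisionProblem) : Prop :=
  ∃ (bound : Polynomial ℕ) (verify : P.Instance × List Bool → Bool),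
    Nonempty (Turing.TM2ComputableInPolyTime P.encodeWithCertificate Computability.encodeBool
      verify) ∧
    ∀ x : P.Instance, P.yes x ↔
      ∃ w : List Bool, w.length ≤ bound.eval (P.encode x).length ∧ verify (x, w) = true

/-- `f` is a polynomial-time many-one (Karp) reduction from `P` to `Q`. -/
def IsPolyTimeReduction (P Q : DecisionProblem) (f : P.Instance → Q.Instance) : Prop :=
  Nonempty (Turing.TM2ComputableInPolyTime P.encode Q.encode f) ∧ ∀ x, P.yes x ↔ Q.yes (f x)

/-- Every language in `NP` has a polynomial-time many-one reduction to `P`. -/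
def NPHard (P : DecisionProblem) : Prop :=
  ∀ L : Language Bool, (ofLanguage L).InNP → ∃ f, IsPolyTimeReduction (ofLanguage L) P f

def NPComplete (P : DecisionProblem) : Prop :=
  P.InNP ∧ P.NPHard

end DecisionProblem

/-! ## Strings -/

section Encoding

open Computability

/-- A natural number in binary, followed by a comma. -/
def encodeNumber (m : ℕ) : List Γ' :=
  (encodeNat m).map Γ'.bit ++ [Γ'.comma]

/-- A natural number in unary, followed by a comma. -/
def encodeUnary (m : ℕ) : List Γ' :=
  List.replicate m Γ'.blank ++ [Γ'.comma]

/-- A finite sequence of numbers in binary, between brackets. -/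
def encodeBlock (l : List ℕ) : List Γ' :=
  Γ'.bra :: (l.flatMap encodeNumber ++ [Γ'.ket])

theorem encodeNumber_append_inj {a b : ℕ} {x y : List Γ'}
    (h : encodeNumber a ++ x = encodeNumber b ++ y) : a = b ∧ x = y := by
  have key : ∀ (l m : List Bool), l.map Γ'.bit ++ Γ'.comma :: x = m.map Γ'.bit ++ Γ'.comma :: y →
      l = m ∧ x = y := by
    intro l
    induction l with
    | nil => intro m; cases m <;> simp
    | cons c l ih =>
      intro m
      cases m with
      | nil => simp
      | cons d m =>
        intro h
        simp only [List.map_cons, List.cons_append, List.cons.injEq, Γ'.bit.injEq] at h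
        obtain ⟨h1, h2⟩ := ih m h.2
        exact ⟨by rw [h.1, h1], h2⟩
  simp only [encodeNumber, List.append_assoc, List.singleton_append] at h
  obtain ⟨h1, h2⟩ := key _ _ h
  refine ⟨?_, h2⟩
  rw [← decode_encodeNat a, h1, decode_encodeNat]

theorem encodeUnary_append_inj {a b : ℕ} {x y : List Γ'}
    (h : encodeUnary a ++ x = encodeUnary b ++ y) : a = b ∧ x = y := by
  simp only [encodeUnary, List.append_assoc, List.singleton_append] at h
  induction a generalizing b with
  | zero => cases b <;> simp_all [List.replicate_succ]
  | succ a ih =>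
    cases b with
    | zero => simp [List.replicate_succ] at h
    | succ b =>
      simp only [List.replicate_succ, List.cons_append, List.cons.injEq, true_and] at h
      obtain ⟨h1, h2⟩ := ih h
      exact ⟨by rw [h1], h2⟩

theorem encodeNumber_ne_ket {m : ℕ} {x y : List Γ'} : encodeNumber m ++ x ≠ Γ'.ket :: y := by
  unfold encodeNumber
  cases encodeNat m <;> simp

theorem encodeBlock_append_inj {l m : List ℕ} {x y : List Γ'}
    (h : encodeBlock l ++ x = encodeBlock m ++ y) : l = m ∧ x = y := by
  simp only [encodeBlock, List.cons_append, List.cons.injEq, true_and,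
    List.append_assoc] at h
  induction l generalizing m with
  | nil =>
    cases m with
    | nil => simpa using h
    | cons b m =>
      simp only [List.flatMap_nil, List.nil_append, List.flatMap_cons, List.append_assoc] at h
      exact absurd h.symm encodeNumber_ne_ket
  | cons a l ih =>
    cases m with
    | nil =>
      simp only [List.flatMap_nil, List.nil_append, List.flatMap_cons, List.append_assoc] at h
      exact absurd h encodeNumber_ne_ket
    | cons b m =>
      simp only [List.flatMap_cons, List.append_assoc] at h
      obtain ⟨h1, h2⟩ := encodeNumber_append_inj h
      obtain ⟨h3, h4⟩ := ih h2
      exact ⟨by rw [h1, h3], h4⟩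

theorem encodeBlocks_injective :
    Function.Injective fun l : List (List ℕ) => l.flatMap encodeBlock := by
  intro l
  induction l with
  | nil => intro m h; cases m <;> simp_all [encodeBlock]
  | cons a l ih =>
    intro m h
    cases m with
    | nil => simp [encodeBlock] at h
    | cons b m =>
      simp only [List.flatMap_cons] at h
      obtain ⟨h1, h2⟩ := encodeBlock_append_inj h
      rw [h1, ih h2]

end Encoding

/-! ## Cluster Editing -/

/-- A disjoint union of cliques: any two distinct vertices of a connected component are adjacent. -/
def SimpleGraph.IsClusterGraph {V : Type*} (H : SimpleGraph V) : Prop :=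
  ∀ u v : V, H.Reachable u v → u ≠ v → H.Adj u v

open Classical in
/-- The edges `uv`, `u < v`, of a graph on `{0, …, n - 1}`, in lexicographic order. -/
noncomputable def edgeList {n : ℕ} (G : SimpleGraph (Fin n)) : List (Fin n × Fin n) :=
  ((List.finRange n).product (List.finRange n)).filter fun p => p.1 < p.2 ∧ G.Adj p.1 p.2

theorem mem_edgeList {n : ℕ} {G : SimpleGraph (Fin n)} {p : Fin n × Fin n} :
    p ∈ edgeList G ↔ p.1 < p.2 ∧ G.Adj p.1 p.2 := by
  simp [edgeList, List.mem_filter, List.product]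

/-- An instance `(G, k)` of Cluster Editing. -/
structure ClusterEditingInstance where
  n : ℕ
  graph : SimpleGraph (Fin n)
  k : ℕ+

namespace ClusterEditingInstance

/-- The vertex set (in unary), the budget, and the list of edges. -/
noncomputable def encode (I : ClusterEditingInstance) : List Computability.Γ' :=
  encodeUnary I.n ++ (encodeNumber I.k ++
    ((edgeList I.graph).map fun p => [(p.1 : ℕ), (p.2 : ℕ)]).flatMap encodeBlock)

/-- Some set of at most `k` edge additions and deletions turns `G` into a cluster graph. -/
def IsYes (I : ClusterEditingInstance) : Prop :=
  ∃ edits : Finset (Sym2 (Fin I.n)), edits.card ≤ I.k ∧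
    ∃ H : SimpleGraph (Fin I.n),
      H.edgeSet = symmDiff I.graph.edgeSet (edits : Set (Sym2 (Fin I.n))) ∧ H.IsClusterGraph

theorem encode_injective : Function.Injective encode := by
  rintro ⟨n, G, k⟩ ⟨n', G', k'⟩ h
  obtain ⟨h1, h⟩ := encodeUnary_append_inj h
  obtain ⟨h2, h⟩ := encodeNumber_append_inj h
  have h3 := encodeBlocks_injective h
  dsimp only at h1 h2 h3
  subst h1
  have h4 : edgeList G = edgeList G' := by
    refine List.map_injective_iff.2 ?_ h3
    rintro ⟨a, b⟩ ⟨c, d⟩ hab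
    simpa [Fin.val_inj] using hab
  have h5 : G = G' := by
    have key : ∀ a b : Fin n, a < b → (G.Adj a b ↔ G'.Adj a b) := by
      intro a b hab
      have := mem_edgeList (G := G) (p := (a, b))
      rw [h4, mem_edgeList] at this
      simpa [hab] using this.symm
    ext a b
    rcases lt_trichotomy a b with hab | hab | hab
    · exact key a b hab
    · simp [hab]
    · rw [G.adj_comm, G'.adj_comm]; exact key b a hab
  rw [h5, PNat.coe_inj.1 h2]

end ClusterEditingInstance

noncomputable def ClusterEditing : DecisionProblem where
  Instance := ClusterEditingInstance
  Symbol := Computability.Γ'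
  encode := ClusterEditingInstance.encode
  encode_injective := ClusterEditingInstance.encode_injective
  yes := ClusterEditingInstance.IsYes

/-! ## Temporal graphs -/

/-- A temporal graph on `V`: an underlying graph and, for each of its edges, a nonempty finite set
of positive times at which the edge appears. Pairs that are not edges carry no label. -/
structure TemporalGraph (V : Type*) where
  underlying : SimpleGraph V
  label : Sym2 V → Finset ℕ
  label_pos : ∀ e, ∀ t ∈ label e, 0 < t
  label_nonempty_iff : ∀ e, (label e).Nonempty ↔ e ∈ underlying.edgeSet

/-- A template `(X, [first, last])`. -/
structure Template (V : Type*) where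
  verts : Finset V
  first : ℕ
  last : ℕ
  first_le_last : first ≤ last

/-- Two templates have disjoint vertex sets, or any two of their times differ by at least `Δ₂`. -/
def Template.Independent {V : Type*} (Δ₂ : ℕ) (C D : Template V) : Prop :=
  Disjoint C.verts D.verts ∨
    ∀ s ∈ Set.Icc C.first C.last, ∀ t ∈ Set.Icc D.first D.last, (Δ₂ : ℤ) ≤ |(s : ℤ) - (t : ℤ)|

namespace TemporalGraph

variable {V : Type*}

/-- The time-edges `(e, t)`: edge `e` appears at time `t`. -/
def timeEdges (𝒢 : TemporalGraph V) : Set (Sym2 V × ℕ) :=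
  {p | p.2 ∈ 𝒢.label p.1}

/-- The largest label (the set is finite if `V` is); `0` if there are no edges. -/
noncomputable def lifetime (𝒢 : TemporalGraph V) : ℕ :=
  sSup {t | ∃ e, t ∈ 𝒢.label e}

/-- `e` is `Δ₁`-dense in `[a, b]`: for every `τ ∈ [a, max {a, b - Δ₁ + 1}]` it appears at some
time in `[τ, τ + Δ₁ - 1]`. -/
def IsDense (𝒢 : TemporalGraph V) (Δ₁ : ℕ) (e : Sym2 V) (a b : ℕ) : Prop :=
  ∀ τ ∈ Set.Icc a (max a (b + 1 - Δ₁)), ∃ t ∈ 𝒢.label e, τ ≤ t ∧ t < τ + Δ₁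

/-- `𝒢` realises the collection `𝒞` of templates. -/
def Realises (𝒢 : TemporalGraph V) (Δ₁ : ℕ) (𝒞 : Set (Template V)) : Prop :=
  (∀ p ∈ 𝒢.timeEdges, ∃ C ∈ 𝒞, (∀ x ∈ p.1, x ∈ C.verts) ∧ p.2 ∈ Set.Icc C.first C.last) ∧
  ∀ C ∈ 𝒞, ∀ x ∈ C.verts, ∀ y ∈ C.verts, x ≠ y → 𝒢.IsDense Δ₁ s(x, y) C.first C.last

/-- `𝒢` is a `(Δ₁, Δ₂)`-cluster temporal graph: it realises some collection of pairwise
`Δ₂`-independent templates with lifetimes within `[1, T(𝒢)]`. -/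
def IsClusterTemporalGraph (𝒢 : TemporalGraph V) (Δ₁ Δ₂ : ℕ) : Prop :=
  ∃ 𝒞 : Set (Template V), 𝒞.Pairwise (Template.Independent Δ₂) ∧
    (∀ C ∈ 𝒞, 1 ≤ C.first ∧ C.last ≤ 𝒢.lifetime) ∧ 𝒢.Realises Δ₁ 𝒞

open Classical in
/-- The temporal graph `(G, 𝒯)` with `𝒯(e) = {1}` for every edge `e` of `G`. -/
noncomputable def ofStatic (G : SimpleGraph V) : TemporalGraph V where
  underlying := G
  label e := if e ∈ G.edgeSet then {1} else ∅
  label_pos e t ht := by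
    split_ifs at ht
    · rw [Finset.mem_singleton.1 ht]; exact Nat.one_pos
    · simp at ht
  label_nonempty_iff e := by split_ifs with h <;> simp [h]

end TemporalGraph

/-! ## Editing to Temporal Cliques -/

/-- An instance `(𝒢, k, Δ₁, Δ₂)` of Editing to Temporal Cliques. -/
structure ETCInstance where
  n : ℕ
  temporalGraph : TemporalGraph (Fin n)
  k : ℕ+
  Δ₁ : ℕ+
  Δ₂ : ℕ+

namespace ETCInstance

/-- The vertex set (in unary), the numbers `k, Δ₁, Δ₂`, and the list of edges of the underlying
graph, each one with the list of its times in increasing order. -/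
noncomputable def encode (I : ETCInstance) : List Computability.Γ' :=
  encodeUnary I.n ++ (encodeNumber I.k ++ (encodeNumber I.Δ₁ ++ (encodeNumber I.Δ₂ ++
    ((edgeList I.temporalGraph.underlying).map fun p =>
      (p.1 : ℕ) :: (p.2 : ℕ) ::
        (I.temporalGraph.label s(p.1, p.2)).sort (· ≤ ·)).flatMap encodeBlock)))

/-- Some set of at most `k` additions and deletions of time-edges turns `𝒢` into a
`(Δ₁, Δ₂)`-cluster temporal graph. -/
def IsYes (I : ETCInstance) : Prop :=
  ∃ edits : Finset (Sym2 (Fin I.n) × ℕ), edits.card ≤ I.k ∧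
    ∃ ℋ : TemporalGraph (Fin I.n),
      ℋ.timeEdges =
        symmDiff I.temporalGraph.timeEdges (edits : Set (Sym2 (Fin I.n) × ℕ)) ∧
      ℋ.IsClusterTemporalGraph I.Δ₁ I.Δ₂

theorem encode_injective : Function.Injective encode := by
  rintro ⟨n, 𝒢, k, d, D⟩ ⟨n', 𝒢', k', d', D'⟩ h
  obtain ⟨h1, h⟩ := encodeUnary_append_inj h
  obtain ⟨h2, h⟩ := encodeNumber_append_inj h
  obtain ⟨h3, h⟩ := encodeNumber_append_inj h
  obtain ⟨h4, h⟩ := encodeNumber_append_inj h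
  have h5 := encodeBlocks_injective h
  dsimp only at h1 h2 h3 h4 h5
  subst h1
  have mem : ∀ (ℋ : TemporalGraph (Fin n)) (a b : Fin n) (t : ℕ), a < b →
      (t ∈ ℋ.label s(a, b) ↔ ∃ l : List ℕ, (a : ℕ) :: (b : ℕ) :: l ∈
        ((edgeList ℋ.underlying).map fun p => (p.1 : ℕ) :: (p.2 : ℕ) ::
          (ℋ.label s(p.1, p.2)).sort (· ≤ ·)) ∧ t ∈ l) := by
    intro ℋ a b t hab
    constructor
    · intro ht
      refine ⟨_, List.mem_map.2 ⟨(a, b), mem_edgeList.2 ⟨hab, ?_⟩, rfl⟩, by simpa using ht⟩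
      exact (SimpleGraph.mem_edgeSet _).1 ((ℋ.label_nonempty_iff _).1 ⟨t, ht⟩)
    · rintro ⟨l, hl, ht⟩
      obtain ⟨⟨c, e⟩, -, hp⟩ := List.mem_map.1 hl
      simp only [List.cons.injEq, Fin.val_inj] at hp
      obtain ⟨rfl, rfl, rfl⟩ := hp
      simpa using ht
  have loop : ∀ (ℋ : TemporalGraph (Fin n)) (a : Fin n), ℋ.label s(a, a) = ∅ := by
    intro ℋ a
    rw [← Finset.not_nonempty_iff_eq_empty, ℋ.label_nonempty_iff]
    simp
  have lab : 𝒢.label = 𝒢'.label := by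
    have key : ∀ a b : Fin n, a < b → 𝒢.label s(a, b) = 𝒢'.label s(a, b) := by
      intro a b hab
      ext t
      rw [mem 𝒢 a b t hab, mem 𝒢' a b t hab, h5]
    funext e
    induction e with
    | _ a b =>
      rcases lt_trichotomy a b with hab | rfl | hab
      · exact key a b hab
      · rw [loop, loop]
      · rw [Sym2.eq_swap]; exact key b a hab
  have gr : 𝒢.underlying = 𝒢'.underlying := by
    rw [← SimpleGraph.edgeSet_inj]
    ext e
    rw [← 𝒢.label_nonempty_iff, ← 𝒢'.label_nonempty_iff, lab]
  have h6 : 𝒢 = 𝒢' := by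
    cases 𝒢; cases 𝒢'; cases gr; cases lab; rfl
  rw [h6, PNat.coe_inj.1 h2, PNat.coe_inj.1 h3, PNat.coe_inj.1 h4]

end ETCInstance

noncomputable def EditingToTemporalCliques : DecisionProblem where
  Instance := ETCInstance
  Symbol := Computability.Γ'
  encode := ETCInstance.encode
  encode_injective := ETCInstance.encode_injective
  yes := ETCInstance.IsYes

/-! ## Restriction to a class of graphs -/

/-- A class of finite graphs, given by its members on the vertex sets `{0, …, n - 1}`. -/
abbrev GraphClass : Type :=
  (n : ℕ) → Set (SimpleGraph (Fin n))

/-- Cluster Editing on the graph class `𝒞`. -/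
noncomputable def ClusterEditingOn (𝒞 : GraphClass) : DecisionProblem :=
  ClusterEditing.restrict fun I : ClusterEditingInstance => I.graph ∈ 𝒞 I.n

/-- Editing to Temporal Cliques on the temporal graphs with underlying graph in `𝒞`. -/
noncomputable def EditingToTemporalCliquesOn (𝒞 : GraphClass) : DecisionProblem :=
  EditingToTemporalCliques.restrict fun I : ETCInstance => I.temporalGraph.underlying ∈ 𝒞 I.n

/-- The map `(G, k) ↦ ((G, 𝒯), k, 1, 1)`, where `𝒯(e) = {1}` for every edge `e` of `G`. -/
noncomputable def singleLabelMap (𝒞 : GraphClass) :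
    (ClusterEditingOn 𝒞).Instance → (EditingToTemporalCliquesOn 𝒞).Instance :=
  fun I : {I : ClusterEditingInstance // I.graph ∈ 𝒞 I.n} =>
    (⟨⟨I.1.n, TemporalGraph.ofStatic I.1.graph, I.1.k, 1, 1⟩, I.2⟩ :
      {J : ETCInstance // J.temporalGraph.underlying ∈ 𝒞 J.n})

/-! The equivalence behind the reduction is short. If a static graph is a cluster graph, then with
label 1 on every edge it is a (1,1)-cluster temporal graph: the components that have an edge, each
with interval [1,1], serve as templates (`isClusterTemporalGraph_ofStatic`). Conversely, in a
(1,1)-cluster temporal graph two templates that share a vertex and the time 1 coincide, and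
1-density makes every pair inside such a template appear at time 1; so the edges present at time 1
form a cluster graph (`isClusterGraph_firstSnapshot`). Edits at time 1 thus amount to static edits,
and edits at other times can be forgotten (`isYes_iff_isYes_ofStatic`). Hardness is inherited
because polynomial-time functions compose (`comp_nonempty`).

Membership in NP needs an argument, since the budget k is binary and a solution may use arbitrarily
late times. If k is at least the number of time-edges, everything is deleted. Otherwise k is below
the input length ℓ, and a solution has at most 2ℓ time-edges. By pigeonhole (`exists_gap`) some
moment s, later than every original time but still below 2^(2ℓ+2), is followed by Δ₁ moments without
time-edges. The time-edges after s are all additions, so dropping them saves edits. One template is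
kept for each remaining time-edge and is clipped at the last remaining time. Density survives: a
first window that starts by s cannot have its witness beyond the gap, and all other windows end by
the clipped end. This gives certificates of polynomial length (`exists_certificate`). Conversely
`Certifies.isYes` shows that a certificate proves a yes-instance; in it, quantification over times
is replaced by quantification over listed time-edges. Membership in the graph class is never tested,
as only instances in the class count.

Polynomial time is established without programming Turing machines directly. Structured programs
compile to machines (`Prog.computable`); programs on three stacks that manipulate binary trees in
prefix notation yield the class `PTime`, closed under pairing, projections, conditionals, and
iterations and folds of bounded growth. Strings are turned into trees and back
(`computable_strings`), reversed, which suits right folds. The reduction is then a transducer that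
scans the instance from its end (`foldr_singleLabelStep_encode`), and the verifier is a parser
(`foldr_parseStep_encode`) followed by the decision of a formula with bounded quantifiers
(`PPred.certifies`). -/

/-! ## Composition of polynomial-time machines -/

namespace Turing.PolyTime

open TM2 StateTransition

/-- `f` leads from `a` to `b` in exactly `n` steps. -/
inductive StepsTo {α : Type*} (f : α → Option α) : ℕ → α → α → Prop
  | refl (a : α) : StepsTo f 0 a a
  | head {n : ℕ} {a b c : α} : f a = some b → StepsTo f n b c → StepsTo f (n + 1) a c

namespace StepsTo

variable {α : Type*} {f : α → Option α} {m n : ℕ} {a b c : α}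

theorem trans (h : StepsTo f m a b) (h' : StepsTo f n b c) : StepsTo f (m + n) a c := by
  induction h with
  | refl a => simpa using h'
  | head h _ ih => rw [Nat.add_right_comm]; exact .head h (ih h')

theorem single (h : f a = some b) : StepsTo f 1 a b := .head h (.refl b)

theorem iff_iterate : StepsTo f n a b ↔ (flip bind f)^[n] (some a) = some b := by
  constructor
  · intro h
    induction h with
    | refl a => rfl
    | head h _ ih => rw [Function.iterate_succ_apply, ← ih]; congr 1
  · intro h
    induction n generalizing a with
    | zero => cases h; exact .refl _
    | succ n ih =>
      rw [Function.iterate_succ_apply] at h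
      cases hb : f a with
      | none =>
        have h0 : ∀ n, (flip bind f)^[n] none = none := by
          intro n
          induction n with
          | zero => rfl
          | succ n ih => rw [Function.iterate_succ_apply]; exact ih
        change (flip bind f)^[n] (f a) = _ at h
        rw [hb, h0] at h
        exact absurd h (by simp)
      | some d =>
        refine .head hb (ih ?_)
        rw [← h, ← hb]
        rfl

theorem toEvalsToInTime (h : StepsTo f n a b) (hm : n ≤ m) :
    Nonempty (EvalsToInTime f a (some b) m) :=
  ⟨⟨⟨n, iff_iterate.1 h⟩, hm⟩⟩

end StepsTo

theorem _root_.StateTransition.EvalsToInTime.stepsTo {α : Type*} {f : α → Option α} {m : ℕ}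
    {a b : α} (h : EvalsToInTime f a (some b) m) : ∃ n ≤ m, StepsTo f n a b :=
  ⟨h.steps, h.steps_le_m, StepsTo.iff_iterate.2 h.evals_in_steps⟩

theorem initList_eq (tm : FinTM2) (s : List (tm.Γ tm.k₀)) :
    initList tm s = ⟨some tm.main, tm.initialState, Function.update (fun _ => []) tm.k₀ s⟩ := by
  unfold initList
  congr 1
  funext k
  by_cases h : k = tm.k₀
  · subst h; simp
  · simp [h]

theorem haltList_eq (tm : FinTM2) (s : List (tm.Γ tm.k₁)) :
    haltList tm s = ⟨none, tm.initialState, Function.update (fun _ => []) tm.k₁ s⟩ := by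
  unfold haltList
  congr 1
  funext k
  by_cases h : k = tm.k₁
  · subst h; simp
  · simp [h]

/-! ### Simulation of a machine inside a larger one. -/

section Embedding

variable {K K' : Type*} {Γ : K → Type*} {Λ Λ' σ σ' : Type*}

/-- The statements of a machine that uses the stacks `i k` only, accesses its internal state by
`get` and `put`, and has its labels, and the halting state, translated by `tr`. -/
def embedStmt (i : K' → K) (get : σ → σ') (put : σ' → σ → σ) (tr : Option Λ' → Λ) :
    Stmt (fun k => Γ (i k)) Λ' σ' → Stmt Γ Λ σ
  | .push k f q => .push (i k) (fun s => f (get s)) (embedStmt i get put tr q)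
  | .peek k f q => .peek (i k) (fun s o => put (f (get s) o) s) (embedStmt i get put tr q)
  | .pop k f q => .pop (i k) (fun s o => put (f (get s) o) s) (embedStmt i get put tr q)
  | .load f q => .load (fun s => put (f (get s)) s) (embedStmt i get put tr q)
  | .branch f q r =>
    .branch (fun s => f (get s)) (embedStmt i get put tr q) (embedStmt i get put tr r)
  | .goto f => .goto fun s => tr (some (f (get s)))
  | .halt => .goto fun _ => tr none

variable [DecidableEq K] [DecidableEq K'] {i : K' → K} (hi : Function.Injective i)
  {get : σ → σ'} {put : σ' → σ → σ} (gp : ∀ a s, get (put a s) = a)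
  (pp : ∀ a b s, put a (put b s) = put a s) (pg : ∀ s, put (get s) s = s)
  (tr : Option Λ' → Λ)

-- The laws of `get` and `put` make the small machine's state an independent component of the large
-- one, and injectivity of `i` keeps distinct stacks distinct; so induction on the statement
-- preserves agreement and leaves all other stacks alone.
include hi gp pp pg in
theorem stepAux_embedStmt (q : Stmt (fun k => Γ (i k)) Λ' σ') :
    ∀ (v : σ) (S : ∀ k, List (Γ k)),
      ∃ D : ∀ k, List (Γ k),
        stepAux (embedStmt i get put tr q) v S =
          ⟨some (tr (stepAux q (get v) fun k => S (i k)).l),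
            put (stepAux q (get v) fun k => S (i k)).var v, D⟩ ∧
        (fun k => D (i k)) = (stepAux q (get v) fun k => S (i k)).stk ∧
        ∀ k, k ∉ Set.range i → D k = S k := by
  have frame : ∀ (S : ∀ k, List (Γ k)) (k' : K') (l : List (Γ (i k'))) (k : K),
      k ∉ Set.range i → Function.update S (i k') l k = S k := by
    intro S k' l k hk
    refine Function.update_of_ne ?_ _ _
    rintro rfl
    exact hk ⟨k', rfl⟩
  induction q with
  | push k f q ih =>
    intro v S
    obtain ⟨D, h1, h2, h3⟩ := ih v (Function.update S (i k) (f (get v) :: S (i k)))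
    rw [Function.update_comp_eq_of_injective' S hi] at h1 h2
    exact ⟨D, h1, h2, fun k' hk' => (h3 k' hk').trans (frame _ _ _ _ hk')⟩
  | peek k f q ih =>
    intro v S
    obtain ⟨D, h1, h2, h3⟩ := ih (put (f (get v) (S (i k)).head?) v) S
    rw [gp, pp] at h1
    rw [gp] at h2
    exact ⟨D, h1, h2, h3⟩
  | pop k f q ih =>
    intro v S
    obtain ⟨D, h1, h2, h3⟩ := ih (put (f (get v) (S (i k)).head?) v)
      (Function.update S (i k) (S (i k)).tail)
    rw [Function.update_comp_eq_of_injective' S hi] at h1 h2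
    rw [gp, pp] at h1
    rw [gp] at h2
    exact ⟨D, h1, h2, fun k' hk' => (h3 k' hk').trans (frame _ _ _ _ hk')⟩
  | load f q ih =>
    intro v S
    obtain ⟨D, h1, h2, h3⟩ := ih (put (f (get v)) v) S
    rw [gp, pp] at h1
    rw [gp] at h2
    exact ⟨D, h1, h2, h3⟩
  | branch f q r ihq ihr =>
    intro v S
    cases h : f (get v)
    · simpa [embedStmt, h] using ihr v S
    · simpa [embedStmt, h] using ihq v S
  | goto f => intro v S; exact ⟨S, by simp [embedStmt, pg], rfl, fun _ _ => rfl⟩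
  | halt => intro v S; exact ⟨S, by simp [embedStmt, pg], rfl, fun _ _ => rfl⟩

-- The simulation keeps pace step by step. Where the small machine halts the large one is at the
-- label `tr none`, still running, so that another computation can be attached.
include hi gp pp pg in
theorem stepsTo_embedStmt {m : Λ' → Stmt (fun k => Γ (i k)) Λ' σ'} {M : Λ → Stmt Γ Λ σ}
    (hM : ∀ l, M (tr (some l)) = embedStmt i get put tr (m l)) {n : ℕ}
    {a b : Cfg (fun k => Γ (i k)) Λ' σ'} (h : StepsTo (step m) n a b) :
    ∀ (v : σ) (S : ∀ k, List (Γ k)), get v = a.var → (fun k => S (i k)) = a.stk →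
      ∃ D : ∀ k, List (Γ k),
        StepsTo (step M) n ⟨some (tr a.l), v, S⟩ ⟨some (tr b.l), put b.var v, D⟩ ∧
        (fun k => D (i k)) = b.stk ∧ ∀ k, k ∉ Set.range i → D k = S k := by
  induction h with
  | refl a =>
    intro v S hv hS
    refine ⟨S, ?_, hS, fun _ _ => rfl⟩
    rw [← hv, pg]
    exact .refl _
  | @head n a b c hab _ ih =>
    intro v S hv hS
    obtain ⟨l, w, T⟩ := a
    dsimp only at hv hS
    subst hv hS
    cases l with
    | none => simp at hab
    | some l =>
      simp only [step, Option.some.injEq] at hab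
      obtain ⟨D, h1, h2, h3⟩ := stepAux_embedStmt hi gp pp pg tr (m l) v S
      rw [hab] at h1 h2
      obtain ⟨E, h4, h5, h6⟩ := ih (put b.var v) D (gp _ _) h2
      rw [pp] at h4
      refine ⟨E, .head ?_ h4, h5, fun k hk => (h6 k hk).trans (h3 k hk)⟩
      simp only [step, hM, h1]

end Embedding

/-! ### Bounds on the growth of stacks. -/

section Growth

variable {K : Type*} {Γ : K → Type*} {Λ σ : Type*}

/-- The largest number of symbols that a statement can push. -/
def pushes : Stmt Γ Λ σ → ℕ
  | .push _ _ q => pushes q + 1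
  | .peek _ _ q => pushes q
  | .pop _ _ q => pushes q
  | .load _ q => pushes q
  | .branch _ q r => pushes q + pushes r
  | .goto _ => 0
  | .halt => 0

variable [DecidableEq K]

theorem length_stepAux_le (q : Stmt Γ Λ σ) (k : K) :
    ∀ (v : σ) (S : ∀ k, List (Γ k)),
      ((stepAux q v S).stk k).length ≤ (S k).length + pushes q := by
  induction q with
  | push k' f q ih =>
    intro v S
    refine (ih _ _).trans ?_
    simp only [pushes]
    by_cases h : k = k'
    · subst h; simp; omega
    · rw [Function.update_of_ne h]; omega
  | peek k' f q ih => intro v S; exact ih _ _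
  | pop k' f q ih =>
    intro v S
    refine (ih _ _).trans ?_
    simp only [pushes]
    by_cases h : k = k'
    · subst h; simp
    · rw [Function.update_of_ne h]
  | load f q ih => intro v S; exact ih _ _
  | branch f q r ihq ihr =>
    intro v S
    simp only [stepAux, pushes]
    cases f v
    · exact (ihr v S).trans (by omega)
    · exact (ihq v S).trans (by omega)
  | goto f => intro v S; simp [pushes]
  | halt => intro v S; simp [pushes]

/-- A machine has finitely many statements, so one constant bounds what any step can push. In a
composition this bounds the length of the intermediate result by the running time of the first
machine. -/
theorem length_stk_le [Fintype Λ] {m : Λ → Stmt Γ Λ σ} {n : ℕ} {a b : Cfg Γ Λ σ}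
    (h : StepsTo (step m) n a b) (k : K) :
    (b.stk k).length ≤ (a.stk k).length + n * ∑ l, pushes (m l) := by
  induction h with
  | refl a => simp
  | @head n a b c hab _ ih =>
    obtain ⟨l, v, S⟩ := a
    cases l with
    | none => simp at hab
    | some l =>
      simp only [step, Option.some.injEq] at hab
      have h1 := length_stepAux_le (m l) k v S
      rw [hab] at h1
      have h2 : pushes (m l) ≤ ∑ l, pushes (m l) :=
        Finset.single_le_sum (f := fun l => pushes (m l)) (fun _ _ => Nat.zero_le _)
          (Finset.mem_univ l)
      dsimp only at h1 ⊢
      rw [add_mul, one_mul]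
      omega

end Growth

/-! ### Composition by way of a spare stack. -/

section Composition

open Classical in
/-- Push the symbol given by `g`, if there is one. -/
noncomputable def pushOption {K : Type*} {Γ : K → Type*} {Λ σ : Type*} (k : K)
    (g : σ → Option (Γ k)) (q : Stmt Γ Λ σ) : Stmt Γ Λ σ :=
  if h : Nonempty (Γ k) then .push k (fun s => (g s).getD h.some) q else q

theorem stepAux_pushOption {K : Type*} [DecidableEq K] {Γ : K → Type*} {Λ σ : Type*} {k : K}
    {g : σ → Option (Γ k)} {q : Stmt Γ Λ σ} {v : σ} {x : Γ k} (h : g v = some x)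
    (S : ∀ k, List (Γ k)) :
    stepAux (pushOption k g q) v S = stepAux q v (Function.update S k (x :: S k)) := by
  have : Nonempty (Γ k) := ⟨x⟩
  simp [pushOption, this, h]

variable (M N : FinTM2)

/-- The stacks of the composition of `M` and `N`: those of `M`, those of `N` and one more. -/
abbrev CompΓ : M.K ⊕ N.K ⊕ Unit → Type
  | .inl k => M.Γ k
  | .inr (.inl k) => N.Γ k
  | .inr (.inr _) => N.Γ N.k₀

/-- The internal state of the composition also holds a symbol in transit. -/
abbrev Compσ : Type := M.σ × N.σ × Option (N.Γ N.k₀)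

/-- Labels: those of `M` and of `N`, two for the transfer of the intermediate result, and one to
halt. -/
abbrev CompΛ : Type := M.Λ ⊕ N.Λ ⊕ Fin 3

variable {M N}

/-- The statements of the composition of `M` and `N`. -/
noncomputable def compStmt (e : M.Γ M.k₁ ≃ N.Γ N.k₀) :
    CompΛ M N → Stmt (CompΓ M N) (CompΛ M N) (Compσ M N)
  | .inl l => embedStmt (Γ := CompΓ M N) (i := Sum.inl) (fun s => s.1) (fun a s => (a, s.2))
      (fun o => o.elim (.inr (.inr 0)) .inl) (M.m l)
  | .inr (.inl l) => embedStmt (Γ := CompΓ M N) (i := fun k => Sum.inr (Sum.inl k))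
      (fun s => s.2.1) (fun a s => (s.1, a, s.2.2))
      (fun o => o.elim (.inr (.inr 2)) fun l => .inr (.inl l)) (N.m l)
  | .inr (.inr 0) => .pop (.inl M.k₁) (fun s o => (s.1, s.2.1, o.map e)) <|
      .branch (fun s => s.2.2.isSome)
        (pushOption (.inr (.inr ())) (fun s => s.2.2) <| .goto fun _ => .inr (.inr 0))
        (.goto fun _ => .inr (.inr 1))
  | .inr (.inr 1) => .pop (.inr (.inr ())) (fun s o => (s.1, s.2.1, o)) <|
      .branch (fun s => s.2.2.isSome)
        (pushOption (.inr (.inl N.k₀)) (fun s => s.2.2) <| .goto fun _ => .inr (.inr 1))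
        (.goto fun _ => .inr (.inl N.main))
  | .inr (.inr 2) => .halt

/-- The composition of `M` and `N`. -/
noncomputable def compMachine (e : M.Γ M.k₁ ≃ N.Γ N.k₀) : FinTM2 :=
  letI := M.kFin
  letI := N.kFin
  letI := M.ΛFin
  letI := N.ΛFin
  letI := M.σFin
  letI := N.σFin
  letI := N.Γk₀Fin
  { K := M.K ⊕ N.K ⊕ Unit
    k₀ := .inl M.k₀
    k₁ := .inr (.inl N.k₁)
    Γ := CompΓ M N
    Λ := CompΛ M N
    main := .inl M.main
    σ := Compσ M N
    initialState := (M.initialState, N.initialState, none)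
    Γk₀Fin := M.Γk₀Fin
    m := compStmt e }

/-- The stacks of the composition, from the contents of those of `M`, those of `N`, and the last. -/
def compStk (S : ∀ k, List (M.Γ k)) (T : ∀ k, List (N.Γ k)) (t : List (N.Γ N.k₀)) :
    ∀ k, List (CompΓ M N k)
  | .inl k => S k
  | .inr (.inl k) => T k
  | .inr (.inr _) => t

theorem compStk_update_inl (S : ∀ k, List (M.Γ k)) (T : ∀ k, List (N.Γ k)) (t : List (N.Γ N.k₀))
    (k : M.K) (l : List (M.Γ k)) :
    Function.update (compStk S T t) (.inl k) l = compStk (Function.update S k l) T t := by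
  funext j
  rcases j with j | j | j
  · by_cases h : j = k
    · subst h; simp [compStk]
    · rw [Function.update_of_ne (by simpa using h)]; simp [compStk, h]
  · simp [compStk]
  · simp [compStk]

theorem compStk_update_inr (S : ∀ k, List (M.Γ k)) (T : ∀ k, List (N.Γ k)) (t : List (N.Γ N.k₀))
    (k : N.K) (l : List (N.Γ k)) :
    Function.update (compStk S T t) (.inr (.inl k)) l = compStk S (Function.update T k l) t := by
  funext j
  rcases j with j | j | j
  · simp [compStk]
  · by_cases h : j = k
    · subst h; simp [compStk]
    · rw [Function.update_of_ne (by simpa using h)]; simp [compStk, h]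
  · simp [compStk]

theorem compStk_update_last (S : ∀ k, List (M.Γ k)) (T : ∀ k, List (N.Γ k))
    (t t' : List (N.Γ N.k₀)) :
    Function.update (compStk S T t) (.inr (.inr ())) t' = compStk S T t' := by
  funext j
  rcases j with j | j | j
  · simp [compStk]
  · simp [compStk]
  · simp [compStk]

variable (e : M.Γ M.k₁ ≃ N.Γ N.k₀)

/-- Popping one stack onto another reverses the string. The intermediate result therefore passes
through the spare stack, and the second transfer, `stepsTo_load`, restores its order. -/
theorem stepsTo_unload (l : List (M.Γ M.k₁)) : ∀ (t : List (N.Γ N.k₀)) (s : M.σ) (s' : N.σ)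
    (o : Option (N.Γ N.k₀)) (S : ∀ k, List (M.Γ k)) (T : ∀ k, List (N.Γ k)),
    StepsTo (step (compStmt e)) (l.length + 1)
      ⟨some (.inr (.inr 0)), (s, s', o), compStk (Function.update S M.k₁ l) T t⟩
      ⟨some (.inr (.inr 1)), (s, s', none),
        compStk (Function.update S M.k₁ []) T ((l.map e).reverse ++ t)⟩ := by
  induction l with
  | nil =>
    intro t s s' o S T
    refine .single ?_
    simp [compStmt, compStk_update_inl]
    simp [compStk]
  | cons x l ih =>
    intro t s s' o S T
    have h := ih (e x :: t) s s' (some (e x)) S T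
    simp only [List.length_cons, List.map_cons, List.reverse_cons, List.append_assoc,
      List.cons_append, List.nil_append]
    refine .head ?_ h
    rw [step, compStmt, stepAux, stepAux,
      stepAux_pushOption (Γ := CompΓ M N) (k := .inr (.inr ())) (x := e x) (by simp [compStk])]
    simp [compStk_update_inl, compStk_update_last, compStk]

theorem stepsTo_load (l : List (N.Γ N.k₀)) : ∀ (t : List (N.Γ N.k₀)) (s : M.σ) (s' : N.σ)
    (o : Option (N.Γ N.k₀)) (S : ∀ k, List (M.Γ k)) (T : ∀ k, List (N.Γ k)),
    StepsTo (step (compStmt e)) (l.length + 1)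
      ⟨some (.inr (.inr 1)), (s, s', o), compStk S (Function.update T N.k₀ t) l⟩
      ⟨some (.inr (.inl N.main)), (s, s', none),
        compStk S (Function.update T N.k₀ (l.reverse ++ t)) []⟩ := by
  induction l with
  | nil =>
    intro t s s' o S T
    refine .single ?_
    simp [compStmt, compStk_update_last]
    simp [compStk]
  | cons x l ih =>
    intro t s s' o S T
    have h := ih (x :: t) s s' (some x) S T
    simp only [List.length_cons, List.reverse_cons, List.append_assoc,
      List.cons_append, List.nil_append]
    refine .head ?_ h
    rw [step, compStmt, stepAux, stepAux,
      stepAux_pushOption (Γ := CompΓ M N) (k := .inr (.inl N.k₀)) (x := x) (by simp [compStk])]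
    simp [compStk_update_inr, compStk_update_last, compStk]

/-- Halting configurations have the initial internal state and only the output stack nonempty.
Hence, after the transfer, `N` finds precisely its own initial configuration, and the stacks of `M`
are clean at the end. -/
theorem stepsTo_compMachine {n n' : ℕ} {l : List (M.Γ M.k₀)} {l' : List (M.Γ M.k₁)}
    {l'' : List (N.Γ N.k₁)} (h : StepsTo M.step n (initList M l) (haltList M l'))
    (h' : StepsTo N.step n' (initList N (l'.map e)) (haltList N l'')) :
    StepsTo (compMachine e).step (n + (l'.length + 1) + (l'.length + 1) + n' + 1)
      (initList (compMachine e) l) (haltList (compMachine e) l'') := by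
  rw [initList_eq, haltList_eq] at h h'
  have hi : initList (compMachine e) l = ⟨some (.inl M.main), (M.initialState, N.initialState, none),
      compStk (Function.update (fun _ => []) M.k₀ l) (fun _ => []) []⟩ := by
    rw [← compStk_update_inl]
    refine (initList_eq _ _).trans ?_
    congr 2
    funext k
    rcases k with k | k | k <;> rfl
  have ho : haltList (compMachine e) l'' = ⟨none, (M.initialState, N.initialState, none),
      compStk (fun _ => []) (Function.update (fun _ => []) N.k₁ l'') []⟩ := by
    rw [← compStk_update_inr]
    refine (haltList_eq _ _).trans ?_
    congr 2
    funext k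
    rcases k with k | k | k <;> rfl
  rw [hi, ho]
  obtain ⟨D, h1, h2, h3⟩ := stepsTo_embedStmt (Γ := CompΓ M N) (i := Sum.inl) Sum.inl_injective
    (get := fun s : Compσ M N => s.1) (put := fun a s => (a, s.2)) (fun _ _ => rfl)
    (fun _ _ _ => rfl) (fun _ => rfl) (fun o => o.elim (.inr (.inr 0)) .inl)
    (M := compStmt e) (fun l => rfl) h (M.initialState, N.initialState, none)
    (compStk (Function.update (fun _ => []) M.k₀ l) (fun _ => []) []) rfl rfl
  have hD : D = compStk (Function.update (fun _ => []) M.k₁ l') (fun _ => []) [] := by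
    funext k
    rcases k with k | k | k
    · exact congr_fun h2 k
    · exact h3 _ (by simp)
    · exact h3 _ (by simp)
  subst hD
  have h4 := stepsTo_unload e l' [] M.initialState N.initialState none (fun _ => []) fun _ => []
  have h5 := stepsTo_load e (l'.map e).reverse [] M.initialState N.initialState none
    (Function.update (fun _ => []) M.k₁ []) fun _ => []
  obtain ⟨E, h6, h7, h8⟩ := stepsTo_embedStmt (Γ := CompΓ M N) (i := fun k => Sum.inr (Sum.inl k))
    (Sum.inr_injective.comp Sum.inl_injective)
    (get := fun s : Compσ M N => s.2.1) (put := fun a s => (s.1, a, s.2.2)) (fun _ _ => rfl)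
    (fun _ _ _ => rfl) (fun _ => rfl) (fun o => o.elim (.inr (.inr 2)) fun l => .inr (.inl l))
    (M := compStmt e) (fun l => rfl) h' (M.initialState, N.initialState, none)
    (compStk (fun _ => []) (Function.update (fun _ => []) N.k₀ (l'.map e)) []) rfl rfl
  have hE : E = compStk (fun _ => []) (Function.update (fun _ => []) N.k₁ l'') [] := by
    funext k
    rcases k with k | k | k
    · exact h8 _ (by simp)
    · exact congr_fun h7 k
    · exact h8 _ (by simp)
  subst hE
  simp only [Function.update_eq_self, List.append_nil, List.reverse_reverse, List.length_reverse,
    List.length_map] at h4 h5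
  -- The last step executes the halt at label 2, to which the halting of `N` was redirected.
  have h9 := (((h1.trans h4).trans h5).trans h6).trans (.single (b := ⟨none, _, _⟩) rfl)
  exact h9

end Composition

theorem _root_.Polynomial.eval_nat_mono (p : Polynomial ℕ) : Monotone fun n => p.eval n := by
  intro a b h
  simp only [Polynomial.eval_eq_sum, Polynomial.sum]
  gcongr

/-- The composition of functions computable in polynomial time. -/
theorem _root_.Turing.TM2ComputableInPolyTime.comp_nonempty {α β γ αΓ βΓ γΓ : Type}
    {ea : α → List αΓ} {eb : β → List βΓ} {ec : γ → List γΓ} {f : α → β} {g : β → γ}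
    (hf : TM2ComputableInPolyTime ea eb f) (hg : TM2ComputableInPolyTime eb ec g) :
    Nonempty (TM2ComputableInPolyTime ea ec fun x => g (f x)) := by
  let := hf.tm.ΛFin
  let c : ℕ := ∑ l, pushes (hf.tm.m l)
  let e : hf.tm.Γ hf.tm.k₁ ≃ hg.tm.Γ hg.tm.k₀ := hf.outputAlphabet.trans hg.inputAlphabet.symm
  -- The bound for the intermediate result. The summand `.X` covers a machine whose input and output
  -- stacks are the same.
  let size : Polynomial ℕ := .X + hf.time * .C c
  let time : Polynomial ℕ := hf.time + (size + 1) + (size + 1) + hg.time.comp size + 1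
  have key : ∀ a, Nonempty (TM2OutputsInTime (compMachine e)
      (List.map hf.inputAlphabet.invFun (ea a))
      (some (List.map hg.outputAlphabet.invFun (ec (g (f a))))) (time.eval (ea a).length)) := by
    intro a
    obtain ⟨n, hn, h1⟩ := (hf.outputsFun a).stepsTo
    obtain ⟨n', hn', h2⟩ := (hg.outputsFun (f a)).stepsTo
    have h3 : List.map hg.inputAlphabet.invFun (eb (f a)) =
        (List.map hf.outputAlphabet.invFun (eb (f a))).map e := by
      simp [e, Function.comp_def]
    have h2' := h2
    rw [h3] at h2'
    refine (stepsTo_compMachine e h1 h2').toEvalsToInTime ?_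
    have h4 := length_stk_le h1 hf.tm.k₁
    have h5 : (eb (f a)).length ≤ size.eval (ea a).length := by
      have h6 : (((initList hf.tm (List.map hf.inputAlphabet.invFun (ea a))).stk
          hf.tm.k₁)).length ≤ (ea a).length := by
        rw [initList_eq]
        by_cases h : hf.tm.k₁ = hf.tm.k₀
        · rw [h]; simp
        · simp [h]
      rw [haltList_eq] at h4
      simp only [Function.update_self, List.length_map] at h4
      change _ ≤ _ + n * c at h4
      have h7 : n * c ≤ hf.time.eval (ea a).length * c := Nat.mul_le_mul_right _ hn
      simp only [size, Polynomial.eval_add, Polynomial.eval_X, Polynomial.eval_mul,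
        Polynomial.eval_C]
      omega
    have h8 : hg.time.eval (eb (f a)).length ≤ hg.time.eval (size.eval (ea a).length) :=
      hg.time.eval_nat_mono h5
    simp only [time, Polynomial.eval_add, Polynomial.eval_comp, Polynomial.eval_one,
      List.length_map]
    omega
  exact ⟨{
    tm := compMachine e
    inputAlphabet := hf.inputAlphabet
    outputAlphabet := hg.outputAlphabet
    time := time
    outputsFun := fun a => (key a).some }⟩

end Turing.PolyTime

/-! ## Structured programs -/

namespace Turing.PolyTime

open TM2

/-- Structured programs working on stacks with alphabets `Γ k` and on an internal state in `σ`. -/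
inductive Prog {K : Type} (Γ : K → Type) (σ : Type) : Type
  | push (k : K) (f : σ → Γ k)
  | pop (k : K) (f : σ → Option (Γ k) → σ)
  | load (f : σ → σ)
  | seq (p q : Prog Γ σ)
  | switch (f : σ → Prog Γ σ)
  | loop (c : σ → Bool) (p : Prog Γ σ)

namespace Prog

variable {K : Type} {Γ : K → Type} {σ : Type}

/-- `Runs p v S v' S' n`: started in internal state `v` with stacks `S`, the program `p` ends after
`n` steps in internal state `v'` with stacks `S'`. -/
inductive Runs [DecidableEq K] : Prog Γ σ → σ → (∀ k, List (Γ k)) → σ → (∀ k, List (Γ k)) → ℕ → Prop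
  | push (k f v S) : Runs (push k f) v S v (Function.update S k (f v :: S k)) 1
  | pop (k f v S) : Runs (pop k f) v S (f v (S k).head?) (Function.update S k (S k).tail) 1
  | load (f v S) : Runs (load f) v S (f v) S 1
  | seq {p q v S v' S' v'' S'' m n} : Runs p v S v' S' m → Runs q v' S' v'' S'' n →
      Runs (seq p q) v S v'' S'' (m + n)
  | switch {f v S v' S' n} : Runs (f v) v S v' S' n → Runs (switch f) v S v' S' (n + 1)
  | loop_exit {c p v S} : c v = false → Runs (loop c p) v S v S 1
  | loop_next {c p v S v' S' v'' S'' m n} : c v = true → Runs p v S v' S' m →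
      Runs (loop c p) v' S' v'' S'' n → Runs (loop c p) v S v'' S'' (m + n + 1)

/-- The program positions. -/
def Label : Prog Γ σ → Type
  | push _ _ => Unit
  | pop _ _ => Unit
  | load _ => Unit
  | seq p q => Label p ⊕ Label q
  | switch f => Option (Σ v, Label (f v))
  | loop _ p => Option (Label p)

/-- There are finitely many program positions. -/
@[reducible]
def fintypeLabel [Fintype σ] : ∀ p : Prog Γ σ, Fintype (Label p)
  | push _ _ => inferInstanceAs (Fintype Unit)
  | pop _ _ => inferInstanceAs (Fintype Unit)
  | load _ => inferInstanceAs (Fintype Unit)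
  | seq p q =>
    letI := fintypeLabel p
    letI := fintypeLabel q
    inferInstanceAs (Fintype (Label p ⊕ Label q))
  | switch f =>
    letI := fun v => fintypeLabel (f v)
    inferInstanceAs (Fintype (Option (Σ v, Label (f v))))
  | loop _ p =>
    letI := fintypeLabel p
    inferInstanceAs (Fintype (Option (Label p)))

/-- Where a program starts. -/
def entry : ∀ p : Prog Γ σ, Label p
  | push _ _ => ()
  | pop _ _ => ()
  | load _ => ()
  | seq p _ => .inl (entry p)
  | switch _ => none
  | loop _ _ => none

/-- The machine code of a program, with labels embedded by `e`, that goes to `x` at its end. -/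
def code {Λ : Type} : ∀ p : Prog Γ σ, (Label p → Λ) → Λ → Label p → Stmt Γ Λ σ
  | push k f, _, x, _ => .push k f (.goto fun _ => x)
  | pop k f, _, x, _ => .pop k f (.goto fun _ => x)
  | load f, _, x, _ => .load f (.goto fun _ => x)
  | seq p q, e, _, .inl l => code p (fun l => e (.inl l)) (e (.inr (entry q))) l
  | seq _ q, e, x, .inr l => code q (fun l => e (.inr l)) x l
  | switch f, e, _, none => .goto fun v => e (some ⟨v, entry (f v)⟩)
  | switch f, e, x, some ⟨v, l⟩ => code (f v) (fun l => e (some ⟨v, l⟩)) x l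
  | loop c p, e, x, none => .goto fun v => if c v then e (some (entry p)) else x
  | loop _ p, e, _, some l => code p (fun l => e (some l)) (e none) l

variable [DecidableEq K]

section RunsIn

variable {p q : Prog Γ σ} {v v' v'' : σ} {S S' S'' : ∀ k, List (Γ k)} {m n : ℕ}

/-- The program ends in at most `n` steps. -/
def RunsIn (p : Prog Γ σ) (v : σ) (S : ∀ k, List (Γ k)) (v' : σ) (S' : ∀ k, List (Γ k)) (n : ℕ) :
    Prop :=
  ∃ m ≤ n, Runs p v S v' S' m

theorem RunsIn.mono (h : RunsIn p v S v' S' m) (hmn : m ≤ n) : RunsIn p v S v' S' n :=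
  let ⟨k, hk, hr⟩ := h
  ⟨k, hk.trans hmn, hr⟩

theorem RunsIn.seq (h : RunsIn p v S v' S' m) (h' : RunsIn q v' S' v'' S'' n) :
    RunsIn (.seq p q) v S v'' S'' (m + n) :=
  let ⟨_, hk, hr⟩ := h
  let ⟨_, hk', hr'⟩ := h'
  ⟨_, add_le_add hk hk', hr.seq hr'⟩

theorem RunsIn.switch {f : σ → Prog Γ σ} (h : RunsIn (f v) v S v' S' n) :
    RunsIn (.switch f) v S v' S' (n + 1) :=
  let ⟨_, hk, hr⟩ := h
  ⟨_, Nat.succ_le_succ hk, hr.switch⟩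

theorem RunsIn.loop_next {c : σ → Bool} (hc : c v = true) (h : RunsIn p v S v' S' m)
    (h' : RunsIn (.loop c p) v' S' v'' S'' n) : RunsIn (.loop c p) v S v'' S'' (m + n + 1) :=
  let ⟨_, hk, hr⟩ := h
  let ⟨_, hk', hr'⟩ := h'
  ⟨_, Nat.succ_le_succ (add_le_add hk hk'), hr.loop_next hc hr'⟩

theorem RunsIn.loop_exit {c : σ → Bool} (hc : c v = false) :
    RunsIn (.loop c p) v S v S 1 :=
  ⟨1, le_rfl, .loop_exit hc⟩

end RunsIn

/-- The embedding `e` and the exit `x` are arbitrary because the induction needs the statement for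
subprograms, placed in the code of the whole and continuing to the next part. Sequencing costs no
step; each test of a loop and each switch costs one. -/
theorem Runs.stepsTo {p : Prog Γ σ} {v v' : σ} {S S' : ∀ k, List (Γ k)} {n : ℕ}
    (h : Runs p v S v' S' n) {Λ : Type} (M : Λ → Stmt Γ Λ σ) :
    ∀ (e : Label p → Λ) (x : Λ), (∀ l, M (e l) = code p e x l) →
      StepsTo (step M) n ⟨some (e (entry p)), v, S⟩ ⟨some x, v', S'⟩ := by
  induction h with
  | push k f v S => intro e x hM; exact .single (by rw [step, hM]; rfl)
  | pop k f v S => intro e x hM; exact .single (by rw [step, hM]; rfl)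
  | load f v S => intro e x hM; exact .single (by rw [step, hM]; rfl)
  | @seq p q _ _ _ _ _ _ _ _ _ _ ih1 ih2 =>
    intro e x hM
    exact (ih1 (fun l => e (.inl l)) _ fun l => hM _).trans (ih2 (fun l => e (.inr l)) x fun l => hM _)
  | @switch f v _ _ _ _ _ ih =>
    intro e x hM
    exact .head (by rw [step, hM]; rfl) (ih (fun l => e (some ⟨v, l⟩)) x fun l => hM _)
  | loop_exit hc =>
    intro e x hM
    refine .single ?_
    rw [step, hM]
    simp [entry, code, hc]
  | @loop_next c p _ _ _ _ _ _ _ _ hc _ _ ih1 ih2 =>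
    intro e x hM
    refine .head ?_ ((ih1 (fun l => e (some l)) (e none) fun l => hM _).trans (ih2 e x hM))
    rw [step, hM]
    simp [entry, code, hc]

/-- The machine that runs a program. -/
def machine [Fintype K] [Fintype σ] (p : Prog Γ σ) (k₀ k₁ : K) [Fintype (Γ k₀)] (v : σ) : FinTM2 :=
  letI := fintypeLabel p
  { K := K
    k₀ := k₀
    k₁ := k₁
    Γ := Γ
    Λ := Option (Label p)
    main := some (entry p)
    σ := σ
    initialState := v
    m := fun l => l.elim .halt (code p some none) }

/-- A function computed by a program in polynomial time is computable in polynomial time. -/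
theorem computable [Fintype K] [Fintype σ] {α β αΓ βΓ : Type} {ea : α → List αΓ} {eb : β → List βΓ}
    {f : α → β} (p : Prog Γ σ) (k₀ k₁ : K) [Fintype (Γ k₀)] (v : σ) (i : Γ k₀ ≃ αΓ) (o : Γ k₁ ≃ βΓ)
    (time : Polynomial ℕ)
    (h : ∀ a, ∃ n ≤ time.eval (ea a).length,
      Runs p v (Function.update (fun _ => []) k₀ ((ea a).map i.symm)) v
        (Function.update (fun _ => []) k₁ ((eb (f a)).map o.symm)) n) :
    Nonempty (TM2ComputableInPolyTime ea eb f) := by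
  have key : ∀ a, Nonempty (TM2OutputsInTime (p.machine k₀ k₁ v) (List.map i.invFun (ea a))
      (some (List.map o.invFun (eb (f a)))) ((time + 1).eval (ea a).length)) := by
    intro a
    obtain ⟨n, hn, hr⟩ := h a
    have h1 := hr.stepsTo (p.machine k₀ k₁ v).m some none fun l => rfl
    -- The exit label `none` carries the halt statement, hence the extra step and the bound `time +
    -- 1`.
    have h2 := h1.trans (.single (b := ⟨none, v, _⟩) rfl)
    refine StepsTo.toEvalsToInTime (n := n + 1) ?_ ?_
    · have hi := initList_eq (p.machine k₀ k₁ v) (List.map i.invFun (ea a))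
      have ho := haltList_eq (p.machine k₀ k₁ v) (List.map o.invFun (eb (f a)))
      rw [hi, ho]
      exact h2
    · simpa using hn
  exact ⟨{
    tm := p.machine k₀ k₁ v
    inputAlphabet := i
    outputAlphabet := o
    time := time + 1
    outputsFun := fun a => (key a).some }⟩

end Prog

end Turing.PolyTime

/-! ## Polynomial-time functions on binary trees -/

namespace Turing.PolyTime

open TM2

/-- Binary trees, the data of polynomial-time computations. -/
inductive BTree : Type
  | leaf
  | node (l r : BTree)

namespace BTree

/-- A tree as a string, in prefix notation. -/
def bits : BTree → List Bool
  | leaf => [false]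
  | node l r => true :: (bits l ++ bits r)

def size (x : BTree) : ℕ := x.bits.length

theorem length_bits (x : BTree) : x.bits.length = x.size := rfl

/-- The string of a tree as part of a stack. -/
def word (x : BTree) : List (Option Bool) := x.bits.map some

def fst : BTree → BTree
  | leaf => leaf
  | node l _ => l

def snd : BTree → BTree
  | leaf => leaf
  | node _ r => r

@[simp] theorem fst_node (l r : BTree) : (node l r).fst = l := rfl
@[simp] theorem snd_node (l r : BTree) : (node l r).snd = r := rfl
@[simp] theorem fst_leaf : leaf.fst = leaf := rfl
@[simp] theorem snd_leaf : leaf.snd = leaf := rfl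

@[simp] theorem size_leaf : leaf.size = 1 := rfl

@[simp] theorem size_node (l r : BTree) : (node l r).size = l.size + r.size + 1 := by
  simp [size, bits]

@[simp] theorem length_word (x : BTree) : x.word.length = x.size := by simp [word, size]

@[simp] theorem word_leaf : leaf.word = [some false] := rfl

@[simp] theorem word_node (l r : BTree) : (node l r).word = some true :: (l.word ++ r.word) := by
  simp [word, bits]

theorem size_pos (x : BTree) : 0 < x.size := by cases x <;> simp

theorem size_fst_le (x : BTree) : x.fst.size ≤ x.size := by
  cases x
  · rfl
  · simp only [fst_node, size_node]; omega

theorem size_snd_le (x : BTree) : x.snd.size ≤ x.size := by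
  cases x
  · rfl
  · simp only [snd_node, size_node]; omega

end BTree

open BTree Prog

/-- Programs on three stacks of bits and marks `none`; the internal state is the last symbol that
was popped. -/
abbrev TreeProg : Type := Prog (K := Fin 3) (fun _ => Option Bool) (Option Bool)

/-! ### Programs that rearrange trees on stacks. -/

namespace TreeProg

variable {p q : TreeProg} {v v' v'' : Option Bool} {S S' S'' : Fin 3 → List (Option Bool)}
  {m n : ℕ}

/-- Pop a symbol into the internal state. -/
def read (k : Fin 3) : TreeProg := .pop k fun _ o => o.join

/-- Push a given symbol. -/
def put (k : Fin 3) (s : Option Bool) : TreeProg := .push k fun _ => s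

/-- Push the symbol in the internal state. -/
def write (k : Fin 3) : TreeProg := .push k id

theorem runsIn_read (k : Fin 3) (h : S k = v' :: S' k)
    (h' : ∀ j, j ≠ k → S j = S' j) : RunsIn (read k) v S v' S' 1 := by
  have h1 : Function.update S k (S k).tail = S' := by
    funext j
    by_cases hj : j = k
    · subst hj; simp [h]
    · simp [hj, h' j hj]
  have h2 := Runs.pop (Γ := fun _ : Fin 3 => Option Bool) k
    (fun (_ : Option Bool) o => o.join) v S
  rw [h1, h] at h2
  exact ⟨1, le_rfl, h2⟩

theorem runsIn_put (k : Fin 3) (s : Option Bool) :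
    RunsIn (put k s) v S v (Function.update S k (s :: S k)) 1 :=
  ⟨1, le_rfl, .push k _ v S⟩

theorem runsIn_write (k : Fin 3) :
    RunsIn (write k) v S v (Function.update S k (v :: S k)) 1 :=
  ⟨1, le_rfl, .push k _ v S⟩

/-- Whatever the internal state, the program changes the stacks as given, in at most `n` steps. -/
def Transforms (p : TreeProg) (S S' : Fin 3 → List (Option Bool)) (n : ℕ) : Prop :=
  ∀ v, ∃ v', RunsIn p v S v' S' n

theorem Transforms.mono (h : Transforms p S S' m) (hmn : m ≤ n) : Transforms p S S' n := fun v =>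
  let ⟨v', hr⟩ := h v
  ⟨v', hr.mono hmn⟩

theorem Transforms.seq (h : Transforms p S S' m) (h' : Transforms q S' S'' n) :
    Transforms (.seq p q) S S'' (m + n) := fun v =>
  let ⟨v', hr⟩ := h v
  let ⟨v'', hr'⟩ := h' v'
  ⟨v'', hr.seq hr'⟩

section

variable (a b c x : List (Option Bool))

@[simp] theorem update_zero : Function.update ![a, b, c] 0 x = ![x, b, c] := by
  funext i; fin_cases i <;> rfl

@[simp] theorem update_one : Function.update ![a, b, c] 1 x = ![a, x, c] := by
  funext i; fin_cases i <;> rfl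

@[simp] theorem update_two : Function.update ![a, b, c] 2 x = ![a, b, x] := by
  funext i; fin_cases i <;> rfl

theorem transforms_put_zero (s : Option Bool) :
    Transforms (put 0 s) ![a, b, c] ![s :: a, b, c] 1 := fun v =>
  ⟨v, by simpa using runsIn_put (v := v) (S := ![a, b, c]) 0 s⟩

theorem transforms_put_one (s : Option Bool) :
    Transforms (put 1 s) ![a, b, c] ![a, s :: b, c] 1 := fun v =>
  ⟨v, by simpa using runsIn_put (v := v) (S := ![a, b, c]) 1 s⟩

theorem transforms_put_two (s : Option Bool) :
    Transforms (put 2 s) ![a, b, c] ![a, b, s :: c] 1 := fun v =>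
  ⟨v, by simpa using runsIn_put (v := v) (S := ![a, b, c]) 2 s⟩

end

/-- Repeat `p` once for each symbol on stack `k` above the first mark. -/
def forEach (k : Fin 3) (p : TreeProg) : TreeProg :=
  .seq (read k) (.loop Option.isSome (.seq p (read k)))

/-- Move the symbols above the first mark of stack `i` to stack `j`. -/
def move (i j : Fin 3) : TreeProg := forEach i (write j)

theorem runsIn_move {i j : Fin 3} (hij : i ≠ j) (w : List Bool) :
    ∀ (v : Option Bool) (S : Fin 3 → List (Option Bool)) (rest : List (Option Bool)),
      S i = w.map some ++ none :: rest →
      RunsIn (move i j) v S none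
        (Function.update (Function.update S i rest) j (w.reverse.map some ++ S j))
        (3 * w.length + 2) := by
  induction w with
  | nil =>
    intro v S rest h
    refine (runsIn_read i (S' := Function.update S i rest) (v' := none) (by simpa using h)
      fun k hk => by simp [hk]).seq (n := 1) ?_
    have h1 : Function.update (Function.update S i rest) j (([] : List Bool).reverse.map some ++ S j) =
        Function.update S i rest := by
      simp [Function.update_of_ne hij.symm]
    rw [h1]
    exact RunsIn.loop_exit rfl
  | cons s w ih =>
    intro v S rest h
    obtain ⟨m, hm, hr⟩ := ih (some s) (Function.update (Function.update S i (w.map some ++ none :: rest)) j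
      (some s :: S j)) rest (by rw [Function.update_of_ne hij]; simp)
    -- The run for `w` is a read followed by the loop. Its read becomes the end of the loop body for
    -- `s`, and its loop the remaining iterations. The same regrouping is used for all later loops
    -- that begin with a read.
    cases hr with
    | @seq _ _ _ _ v1 S1 _ _ m1 m2 hr1 hr2 =>
    refine ((runsIn_read i (S' := Function.update S i (w.map some ++ none :: rest)) (v' := some s)
      (by simpa using h) fun k hk => by simp [hk]).seq (n := 1 + m1 + m2 + 1) (RunsIn.loop_next rfl
        ((runsIn_write j).seq ⟨_, le_rfl, by
          simpa [Function.update_of_ne hij.symm] using hr1⟩) ⟨m2, le_rfl, ?_⟩)).mono ?_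
    · convert hr2 using 1
      funext k
      by_cases hk : k = j
      · subst hk; simp
      · by_cases hk' : k = i
        · subst hk'; simp [hk]
        · simp [hk, hk']
    · simp only [List.length_cons]; omega

section

variable (w : List Bool) (a b c : List (Option Bool))

theorem transforms_move_one_zero : Transforms (move 1 0) ![a, w.map some ++ none :: b, c]
    ![w.reverse.map some ++ a, b, c] (3 * w.length + 2) := fun v =>
  ⟨none, by
    simpa using runsIn_move (i := 1) (j := 0) (by decide) w v
      ![a, w.map some ++ none :: b, c] b rfl⟩

theorem transforms_move_one_two : Transforms (move 1 2) ![a, w.map some ++ none :: b, c]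
    ![a, b, w.reverse.map some ++ c] (3 * w.length + 2) := fun v =>
  ⟨none, by
    simpa using runsIn_move (i := 1) (j := 2) (by decide) w v
      ![a, w.map some ++ none :: b, c] b rfl⟩

theorem transforms_move_two_one : Transforms (move 2 1) ![a, b, w.map some ++ none :: c]
    ![a, w.reverse.map some ++ b, c] (3 * w.length + 2) := fun v =>
  ⟨none, by
    simpa using runsIn_move (i := 2) (j := 1) (by decide) w v
      ![a, b, w.map some ++ none :: c] c rfl⟩

end

/-- Run `p` once for each symbol: the effect on the data stack. -/
theorem transforms_forEach {p : TreeProg} {t : ℕ} {b c : List (Option Bool)}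
    (F : ℕ → List (Option Bool)) (w : List Bool)
    (h : ∀ i < w.length, ∀ b', Transforms p ![F i, b', c] ![F (i + 1), b', c] t) :
    Transforms (forEach 1 p) ![F 0, w.map some ++ none :: b, c] ![F w.length, b, c]
      ((t + 2) * w.length + 2) := by
  induction w generalizing F with
  | nil =>
    intro v
    refine ⟨none, ?_⟩
    refine (runsIn_read 1 (S' := ![F 0, b, c]) (v' := none) (by simp) fun k hk => ?_).seq
      (n := 1) (RunsIn.loop_exit rfl)
    fin_cases k <;> simp_all
  | cons s w ih =>
    intro v
    obtain ⟨v1, h1⟩ := h 0 (by simp) (w.map some ++ none :: b) (some s)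
    obtain ⟨v2, m, hm, hr⟩ := ih (fun i => F (i + 1)) (fun i hi b' => h (i + 1) (by simpa using hi) b')
      v1
    cases hr with
    | @seq _ _ _ _ v3 S1 _ _ m1 m2 hr1 hr2 =>
    refine ⟨v2, ((runsIn_read 1 (S' := ![F 0, w.map some ++ none :: b, c]) (v' := some s) (by simp)
      fun k hk => ?_).seq (RunsIn.loop_next rfl
        (h1.seq ⟨_, le_rfl, hr1⟩) ⟨m2, le_rfl, hr2⟩)).mono ?_⟩
    · fin_cases k <;> simp_all
    · simp only [List.length_cons, mul_add]; omega

/-- Discard the symbols above the first mark of stack 1. -/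
def clear : TreeProg := forEach 1 (.load id)

theorem transforms_clear (w : List Bool) (a b c : List (Option Bool)) :
    Transforms clear ![a, w.map some ++ none :: b, c] ![a, b, c] (3 * w.length + 2) :=
  transforms_forEach (fun _ => a) w fun _ _ _ v => ⟨v, 1, le_rfl, .load _ _ _⟩

/-- Copy the symbols above the first mark of stack 1 to stacks 0 and 2. -/
def copy : TreeProg := forEach 1 (.seq (write 0) (write 2))

theorem runsIn_copy (w : List Bool) : ∀ (v : Option Bool) (a b c : List (Option Bool)),
    RunsIn copy v ![a, w.map some ++ none :: b, c] none
      ![w.reverse.map some ++ a, b, w.reverse.map some ++ c] (4 * w.length + 2) := by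
  induction w with
  | nil =>
    intro v a b c
    refine (runsIn_read 1 (S' := ![a, b, c]) (v' := none) (by simp) fun k hk => ?_).seq
      (n := 1) (RunsIn.loop_exit rfl)
    fin_cases k <;> simp_all
  | cons s w ih =>
    intro v a b c
    obtain ⟨m, hm, hr⟩ := ih (some s) (some s :: a) b (some s :: c)
    cases hr with
    | @seq _ _ _ _ v3 S1 _ _ m1 m2 hr1 hr2 =>
    refine ((runsIn_read 1 (S' := ![a, w.map some ++ none :: b, c]) (v' := some s) (by simp)
      fun k hk => ?_).seq (RunsIn.loop_next (v' := v3) (S' := S1) (m := 1 + 1 + m1) rfl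
        (((runsIn_write 0).seq (runsIn_write 2)).seq ⟨_, le_rfl, ?_⟩)
        ⟨m2, le_rfl, ?_⟩)).mono ?_
    · fin_cases k <;> simp_all
    · simpa using hr1
    · simpa using hr2
    · simp only [List.length_cons]; omega

/-- Move one tree from stack 0 to stack 1, reversing its string; stack 2 holds in unary the number
of trees to come. -/
def parse : TreeProg :=
  .seq (put 2 none) <| .seq (.load fun _ => some true) <| .loop Option.isSome <|
    .seq (read 0) <| .seq (write 1) <|
      .switch fun v => if v = some true then put 2 (some true) else read 2

/-- In prefix notation a tree ends when no subtree is outstanding. A bit `true` opens two subtrees,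
one of them current and one recorded on stack 2; a bit `false` completes the current one and takes
the next from stack 2. Popping the mark there puts `none` in the state and ends the loop. -/
theorem transforms_parse (x : BTree) (a b c : List (Option Bool)) :
    Transforms parse ![x.word ++ a, b, c] ![a, x.bits.reverse.map some ++ b, c]
      (5 * x.size + 3) := by
  -- Stated with an arbitrary continuation of the loop: once `x` is consumed, the top `s` of stack 2
  -- has become the state. For a node the continuation after the left subtree is the loop on the
  -- right one.
  have key : ∀ (x : BTree) (a b c : List (Option Bool)) (s : Option Bool) (v v' S' n),
      v.isSome = true →
      RunsIn (.loop Option.isSome <| .seq (read 0) <| .seq (write 1) <|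
        .switch fun v => if v = some true then put 2 (some true) else read 2) s
        ![a, x.bits.reverse.map some ++ b, c] v' S' n →
      RunsIn (.loop Option.isSome <| .seq (read 0) <| .seq (write 1) <|
        .switch fun v => if v = some true then put 2 (some true) else read 2) v
        ![x.word ++ a, b, s :: c] v' S' (5 * x.size + n) := by
    intro x
    induction x with
    | leaf =>
      intro a b c s v v' S' n hv h
      refine (RunsIn.loop_next hv (m := 4) ((runsIn_read 0 (S' := ![a, b, s :: c])
        (v' := some false) (by simp) fun k hk => ?_).seq (n := 3)
          ((runsIn_write 1).seq (n := 2) (RunsIn.switch (n := 1) ?_))) h).mono ?_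
      · fin_cases k <;> simp_all
      · simp only [Option.some.injEq, Bool.false_eq_true, if_false]
        refine runsIn_read 2 ?_ fun k hk => ?_
        · simp [bits]
        · fin_cases k <;> simp_all [bits]
      · simp only [size_leaf]; omega
    | node l r ihl ihr =>
      intro a b c s v v' S' n hv h
      have h1 := ihr a (l.bits.reverse.map some ++ some true :: b) c s (some true) v' S' n rfl
        (by simpa [bits] using h)
      have h2 := ihl (r.word ++ a) (some true :: b) (s :: c) (some true) (some true) v' S' _ rfl h1
      refine (RunsIn.loop_next hv (m := 4) ((runsIn_read 0 (S' := ![l.word ++ (r.word ++ a), b, s :: c])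
        (v' := some true) (by simp) fun k hk => ?_).seq (n := 3)
          ((runsIn_write 1).seq (n := 2) (RunsIn.switch (n := 1) ?_))) h2).mono ?_
      · fin_cases k <;> simp_all
      · simpa using runsIn_put (v := some true)
          (S := ![l.word ++ (r.word ++ a), some true :: b, s :: c]) 2 (some true)
      · simp only [size_node]; omega
  intro v
  have h1 : RunsIn (.load fun _ => some true) v ![x.word ++ a, b, none :: c] (some true)
      ![x.word ++ a, b, none :: c] 1 := ⟨1, le_rfl, .load _ _ _⟩
  have h2 := h1.seq (key x a b c none (some true) none _ 1 rfl (RunsIn.loop_exit rfl))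
  have h3 := runsIn_put (v := v) (S := ![x.word ++ a, b, c]) 2 none
  rw [update_two] at h3
  exact ⟨none, (h3.seq h2).mono (by omega)⟩

/-- Duplicate the topmost tree. -/
def dup : TreeProg :=
  .seq (put 1 none) <| .seq parse <| .seq (put 2 none) <| .seq copy <| .seq (put 1 none) <|
    .seq (move 2 1) (move 1 0)

/-- `parse` leaves the reversed string on stack 1, and `copy` reverses it back onto stacks 0 and 2.
The copy on stack 2 takes the detour over stack 1 to arrive on stack 0 in the right order. -/
theorem transforms_dup (x : BTree) (a b c : List (Option Bool)) :
    Transforms dup ![x.word ++ a, b, c] ![x.word ++ (x.word ++ a), b, c] (15 * x.size + 12) := by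
  have h1 := (transforms_put_one (x.word ++ a) b c none).seq <|
    (transforms_parse x a (none :: b) c).seq <|
    (transforms_put_two a (x.bits.reverse.map some ++ none :: b) c none).seq <|
    Transforms.seq (S' := ![x.word ++ a, b, x.word ++ none :: c]) (m := 4 * x.size + 2)
      (fun v => ⟨none, by
        simpa [word, size] using runsIn_copy x.bits.reverse v a b (none :: c)⟩) <|
    (transforms_put_one (x.word ++ a) b (x.word ++ none :: c) none).seq <|
    (transforms_move_two_one x.bits (x.word ++ a) (none :: b) c).seq <|
    (transforms_move_one_zero x.bits.reverse (x.word ++ a) b c)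
  rw [List.reverse_reverse] at h1
  refine Transforms.mono h1 ?_
  simp only [List.length_reverse, length_bits]
  omega

/-- Exchange the two topmost trees. -/
def swap : TreeProg :=
  .seq (put 1 none) <| .seq parse <| .seq (put 2 none) <| .seq (move 1 2) <| .seq (put 1 none) <|
    .seq parse <| .seq (put 1 none) <| .seq (move 2 1) <| .seq (move 1 0) (move 1 0)

/-- Stack 2 keeps `x` while `y` is parsed. Then `x` is put above `y` on stack 1, with marks
separating them, so it returns to stack 0 first and ends up below. -/
theorem transforms_swap (x y : BTree) (a b c : List (Option Bool)) :
    Transforms swap ![x.word ++ (y.word ++ a), b, c] ![y.word ++ (x.word ++ a), b, c]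
      (14 * (x.size + y.size) + 20) := by
  have h1 := (transforms_put_one (x.word ++ (y.word ++ a)) b c none).seq <|
    (transforms_parse x (y.word ++ a) (none :: b) c).seq <|
    (transforms_put_two (y.word ++ a) (x.bits.reverse.map some ++ none :: b) c none).seq <|
    (transforms_move_one_two x.bits.reverse (y.word ++ a) b (none :: c)).seq <|
    (transforms_put_one (y.word ++ a) b (x.bits.reverse.reverse.map some ++ none :: c) none).seq <|
    (transforms_parse y a (none :: b) (x.bits.reverse.reverse.map some ++ none :: c)).seq <|
    (transforms_put_one a (y.bits.reverse.map some ++ none :: b)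
      (x.bits.reverse.reverse.map some ++ none :: c) none).seq <|
    (transforms_move_two_one x.bits.reverse.reverse a
      (none :: (y.bits.reverse.map some ++ none :: b)) c).seq <|
    (transforms_move_one_zero x.bits.reverse.reverse.reverse a
      (y.bits.reverse.map some ++ none :: b) c).seq <|
    (transforms_move_one_zero y.bits.reverse _ b c)
  simp only [List.reverse_reverse] at h1
  refine Transforms.mono h1 ?_
  simp only [List.length_reverse, length_bits]
  omega

/-- Discard the topmost tree. -/
def drop : TreeProg := .seq (put 1 none) <| .seq parse clear

theorem transforms_drop (x : BTree) (a b c : List (Option Bool)) :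
    Transforms drop ![x.word ++ a, b, c] ![a, b, c] (8 * x.size + 6) := by
  have h1 := (transforms_put_one (x.word ++ a) b c none).seq <|
    (transforms_parse x a (none :: b) c).seq <|
    (transforms_clear x.bits.reverse a b c)
  refine Transforms.mono h1 ?_
  simp only [List.length_reverse, length_bits]
  omega

end TreeProg
end Turing.PolyTime

/-! ### Polynomial-time functions on trees and their closure properties. -/

namespace Turing.PolyTime

open TM2 BTree Prog TreeProg

/-- The functions on trees that are computed by a program, in place on top of stack 0, in a number
of steps that is polynomial in the size of the argument. -/
def PTime (f : BTree → BTree) : Prop :=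
  ∃ (p : TreeProg) (P : Polynomial ℕ), ∀ x : BTree, (f x).size ≤ P.eval x.size ∧
    ∀ a b c, Transforms p ![x.word ++ a, b, c] ![(f x).word ++ a, b, c] (P.eval x.size)

namespace PTime

variable {f g h : BTree → BTree}

/-- It suffices to bound size and time separately. -/
theorem of_bounds (p : TreeProg) (P Q : Polynomial ℕ) (h1 : ∀ x, (f x).size ≤ P.eval x.size)
    (h2 : ∀ x a b c, Transforms p ![x.word ++ a, b, c] ![(f x).word ++ a, b, c] (Q.eval x.size)) :
    PTime f :=
  ⟨p, P + Q, fun x => ⟨(h1 x).trans (by simp), fun a b c => (h2 x a b c).mono (by simp)⟩⟩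

theorem congr (hf : PTime f) (h : ∀ x, f x = g x) : PTime g := funext h ▸ hf

theorem id : PTime fun x => x :=
  of_bounds (.load fun v => v) .X 1 (by simp) fun x a b c v => ⟨v, 1, by simp, .load _ _ _⟩

theorem comp (hg : PTime g) (hf : PTime f) : PTime fun x => g (f x) := by
  obtain ⟨p, P, hp⟩ := hf
  obtain ⟨q, Q, hq⟩ := hg
  have h1 : ∀ x, Q.eval (f x).size ≤ Q.eval (P.eval x.size) := fun x =>
    Q.eval_nat_mono (hp x).1
  refine of_bounds (.seq p q) (Q.comp P) (P + Q.comp P) (fun x => ?_) fun x a b c => ?_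
  · simpa using ((hq (f x)).1.trans (h1 x))
  · refine (((hp x).2 a b c).seq ((hq (f x)).2 a b c)).mono ?_
    simpa using h1 x

theorem leaf : PTime fun _ => leaf := by
  refine of_bounds (.seq drop (put 0 (some false))) 1 (.C 8 * .X + .C 7) (by simp)
    fun x a b c => ?_
  refine ((transforms_drop x a b c).seq (transforms_put_zero a b c (some false))).mono ?_
  simp

/-- The right component is computed first, on a duplicate of the argument. After the exchange the
left one is computed above it, and a single `true` on top completes the prefix notation. -/
theorem node (hf : PTime f) (hg : PTime g) : PTime fun x => node (f x) (g x) := by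
  obtain ⟨p, P, hp⟩ := hf
  obtain ⟨q, Q, hq⟩ := hg
  refine of_bounds (.seq dup <| .seq q <| .seq swap <| .seq p <| put 0 (some true)) (P + Q + 1)
    (.C 15 * .X + .C 12 + Q + .C 14 * (Q + .X) + .C 20 + P + 1) (fun x => ?_) fun x a b c => ?_
  · have h1 := (hp x).1
    have h2 := (hq x).1
    simp
    omega
  · have h2 := (hq x).1
    have := (transforms_dup x a b c).seq <| ((hq x).2 (x.word ++ a) b c).seq <|
      (transforms_swap (g x) x a b c).seq <| ((hp x).2 ((g x).word ++ a) b c).seq <|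
      transforms_put_zero _ b c (some true)
    refine Transforms.mono (by simpa using this) ?_
    simp only [Polynomial.eval_add, Polynomial.eval_mul, Polynomial.eval_C, Polynomial.eval_X,
      Polynomial.eval_one]
    omega

theorem const (t : BTree) : PTime fun _ => t := by
  induction t with
  | leaf => exact leaf
  | node l r ihl ihr => exact node ihl ihr

theorem fst : PTime BTree.fst := by
  refine of_bounds (.seq (read 0) <| .switch fun v =>
    if v = some true then .seq swap drop else put 0 (some false)) .X (.C 22 * .X + .C 28)
    (fun x => by simpa using x.size_fst_le) fun x a b c v => ?_
  cases x with
  | leaf =>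
    have h1 : RunsIn (read 0) v ![some false :: a, b, c] (some false) ![a, b, c] 1 :=
      runsIn_read 0 (by simp) fun k hk => by fin_cases k <;> simp_all
    obtain ⟨v', h2⟩ := transforms_put_zero a b c (some false) (some false)
    refine ⟨v', (h1.seq (RunsIn.switch (n := 1) ?_)).mono ?_⟩
    · simpa using h2
    · simp
  | node l r =>
    have h1 : RunsIn (read 0) v ![some true :: (l.word ++ (r.word ++ a)), b, c] (some true)
        ![l.word ++ (r.word ++ a), b, c] 1 :=
      runsIn_read 0 (by simp) fun k hk => by fin_cases k <;> simp_all
    obtain ⟨v', h2⟩ := ((transforms_swap l r a b c).seq (transforms_drop r (l.word ++ a) b c))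
      (some true)
    refine ⟨v', RunsIn.mono (m := 1 + (14 * (l.size + r.size) + 20 + (8 * r.size + 6) + 1)) ?_ ?_⟩
    · simpa using h1.seq (RunsIn.switch (f := fun v =>
        if v = some true then .seq swap drop else put 0 (some false)) (by simpa using h2))
    · simp; omega

theorem snd : PTime BTree.snd := by
  refine of_bounds (.seq (read 0) <| .switch fun v =>
    if v = some true then drop else put 0 (some false)) .X (.C 8 * .X + .C 8)
    (fun x => by simpa using x.size_snd_le) fun x a b c v => ?_
  cases x with
  | leaf =>
    have h1 : RunsIn (read 0) v ![some false :: a, b, c] (some false) ![a, b, c] 1 :=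
      runsIn_read 0 (by simp) fun k hk => by fin_cases k <;> simp_all
    obtain ⟨v', h2⟩ := transforms_put_zero a b c (some false) (some false)
    refine ⟨v', (h1.seq (RunsIn.switch (n := 1) ?_)).mono ?_⟩
    · simpa using h2
    · simp
  | node l r =>
    have h1 : RunsIn (read 0) v ![some true :: (l.word ++ (r.word ++ a)), b, c] (some true)
        ![l.word ++ (r.word ++ a), b, c] 1 :=
      runsIn_read 0 (by simp) fun k hk => by fin_cases k <;> simp_all
    obtain ⟨v', h2⟩ := transforms_drop l (r.word ++ a) b c (some true)
    refine ⟨v', RunsIn.mono (m := 1 + (8 * l.size + 6 + 1)) ?_ ?_⟩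
    · simpa using h1.seq (RunsIn.switch (f := fun v =>
        if v = some true then drop else put 0 (some false)) (by simpa using h2))
    · simp; omega

theorem fst_comp (hf : PTime f) : PTime fun x => (f x).fst := fst.comp hf

theorem snd_comp (hf : PTime f) : PTime fun x => (f x).snd := snd.comp hf

-- The first bit of `f x` decides. If it is `false`, nothing of `f x` remains; if it is `true`, its
-- two subtrees remain and must be dropped before the branch starts.
open Classical in
theorem ite_leaf (hf : PTime f) (hg : PTime g) (hh : PTime h) :
    PTime fun x => if f x = .leaf then g x else h x := by
  obtain ⟨p, P, hp⟩ := hf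
  obtain ⟨q, Q, hq⟩ := hg
  obtain ⟨r, R, hr⟩ := hh
  refine of_bounds (.seq dup <| .seq p <| .seq (read 0) <| .switch fun v =>
      if v = some true then .seq drop (.seq drop r) else q) (Q + R)
    (.C 15 * .X + .C 26 + P + .C 8 * P + Q + R) (fun x => ?_) fun x a b c => ?_
  · split_ifs
    · exact (hq x).1.trans (by simp)
    · exact (hr x).1.trans (by simp)
  · have h0 := (hp x).1
    have h1 := (transforms_dup x a b c).seq <| ((hp x).2 (x.word ++ a) b c)
    intro v
    obtain ⟨v1, h2⟩ := transforms_dup x a b c v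
    obtain ⟨v2, h3⟩ := (hp x).2 (x.word ++ a) b c v1
    cases hx : f x with
    | leaf =>
      rw [hx] at h3
      have h4 : RunsIn (read 0) v2 ![some false :: (x.word ++ a), b, c] (some false)
          ![x.word ++ a, b, c] 1 :=
        runsIn_read 0 (by simp) fun k hk => by fin_cases k <;> simp_all
      obtain ⟨v', h5⟩ := (hq x).2 a b c (some false)
      refine ⟨v', RunsIn.mono (h2.seq (h3.seq (h4.seq (RunsIn.switch (n := Q.eval x.size) ?_)))) ?_⟩
      · simpa using h5
      · simp; omega
    | node s t =>
      rw [hx] at h3 h0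
      have h4 : RunsIn (read 0) v2 ![some true :: (s.word ++ (t.word ++ (x.word ++ a))), b, c]
          (some true) ![s.word ++ (t.word ++ (x.word ++ a)), b, c] 1 :=
        runsIn_read 0 (by simp) fun k hk => by fin_cases k <;> simp_all
      obtain ⟨v', h5⟩ := ((transforms_drop s (t.word ++ (x.word ++ a)) b c).seq <|
        (transforms_drop t (x.word ++ a) b c).seq <| (hr x).2 a b c) (some true)
      rw [word_node, List.cons_append, List.append_assoc] at h3
      refine ⟨v', RunsIn.mono (h2.seq (h3.seq (h4.seq (RunsIn.switch ?_))))
        (n := _) (m := _ + (_ + (1 + (8 * s.size + 6 + (8 * t.size + 6 + R.eval x.size) + 1)))) ?_⟩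
      · simpa using h5
      · simp at h0
        simp
        omega

/-- Iteration as many times as some tree has symbols, if the sizes stay polynomially bounded. -/
theorem iterate (hf : PTime f) (hg : PTime g) (hh : PTime h)
    (hb : ∃ B : Polynomial ℕ, ∀ x, ∀ i ≤ (g x).size, (f^[i] (h x)).size ≤ B.eval x.size) :
    PTime fun x => f^[(g x).size] (h x) := by
  obtain ⟨p, P, hp⟩ := hf
  obtain ⟨q, Q, hq⟩ := hg
  obtain ⟨r, R, hr⟩ := hh
  obtain ⟨B, hB⟩ := hb
  -- The string of `g x`, moved to stack 1, is the loop counter.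
  refine of_bounds (.seq dup <| .seq q <| .seq (put 1 none) <| .seq parse <| .seq r <| forEach 1 p)
    B (.C 15 * .X + .C 26 + Q + .C 5 * Q + R + (P.comp B + .C 2) * Q)
    (fun x => hB x _ le_rfl) fun x a b c => ?_
  have h1 := (hq x).1
  have h2 := transforms_forEach (p := p) (t := P.eval (B.eval x.size)) (b := b) (c := c)
    (fun i => (f^[i] (h x)).word ++ a) (g x).bits.reverse fun i hi b' => by
      rw [Function.iterate_succ_apply']
      refine ((hp _).2 a b' c).mono (P.eval_nat_mono (hB x i ?_))
      rw [List.length_reverse, length_bits] at hi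
      exact hi.le
  rw [List.length_reverse, length_bits] at h2
  have h3 := (transforms_dup x a b c).seq <| ((hq x).2 (x.word ++ a) b c).seq <|
    (transforms_put_one _ b c none).seq <| (transforms_parse (g x) (x.word ++ a) (none :: b) c).seq <|
    ((hr x).2 a _ c).seq h2
  refine Transforms.mono h3 ?_
  have h4 : (P.eval (B.eval x.size) + 2) * (g x).size ≤
      (P.eval (B.eval x.size) + 2) * Q.eval x.size := Nat.mul_le_mul_left _ h1
  simp only [Polynomial.eval_add, Polynomial.eval_mul, Polynomial.eval_C, Polynomial.eval_X,
    Polynomial.eval_comp]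
  omega

end PTime

/-- A function on trees in `PTime` gives a computation of `f` if `ea` and `eb` are the strings of
trees. -/
theorem PTime.computable {α β : Type} {g : BTree → BTree} (hg : PTime g) {s : α → BTree}
    {t : β → BTree} {f : α → β} (h : ∀ a, g (s a) = t (f a)) :
    Nonempty (TM2ComputableInPolyTime (fun a => (s a).word) (fun b => (t b).word) f) := by
  obtain ⟨p, P, hp⟩ := hg
  -- The final load restores the initial internal state, as a halting configuration requires.
  refine Prog.computable (.seq p (.load fun _ => none)) (0 : Fin 3) (0 : Fin 3) none
    (Equiv.refl _) (Equiv.refl _) (P + 1) fun a => ?_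
  obtain ⟨v', n, hn, hr⟩ := (hp (s a)).2 [] [] [] none
  have key : ∀ x : BTree, Function.update (fun _ : Fin 3 => []) 0 (x.word.map (Equiv.refl _).symm) =
      ![x.word ++ [], [], []] := by
    intro x
    funext i
    fin_cases i <;> simp
  refine ⟨n + 1, by simpa using hn, ?_⟩
  erw [key, key, ← h a]
  exact hr.seq (.load _ _ _)

end Turing.PolyTime

/-! ## Strings as trees -/

namespace Turing.PolyTime

open TM2 Prog

namespace BTree

/-- A list of trees, as a tree. -/
def ofList : List BTree → BTree
  | [] => leaf
  | x :: l => node x (ofList l)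

/-- A tree, as a list of trees. -/
def toList : BTree → List BTree
  | leaf => []
  | node x l => x :: toList l

@[simp] theorem ofList_nil : ofList [] = leaf := rfl
@[simp] theorem ofList_cons (x : BTree) (l : List BTree) : ofList (x :: l) = node x (ofList l) := rfl
@[simp] theorem toList_leaf : toList leaf = [] := rfl
@[simp] theorem toList_node (x l : BTree) : toList (node x l) = x :: toList l := rfl

@[simp] theorem toList_ofList (l : List BTree) : (ofList l).toList = l := by
  induction l with
  | nil => rfl
  | cons x l ih => simp [ih]

@[simp] theorem ofList_toList (x : BTree) : ofList x.toList = x := by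
  induction x with
  | leaf => rfl
  | node x l _ ih => simp [ih]

theorem ofList_injective : Function.Injective ofList :=
  Function.LeftInverse.injective toList_ofList

theorem size_ofList (l : List BTree) : (ofList l).size = (l.map fun x => x.size + 1).sum + 1 := by
  induction l with
  | nil => rfl
  | cons x l ih => simp [ih]; omega

/-- The list of `n` leaves. -/
def unary (n : ℕ) : BTree := ofList (List.replicate n leaf)

theorem unary_succ (n : ℕ) : unary (n + 1) = node leaf (unary n) := rfl

theorem unary_injective : Function.Injective unary := fun m n h => by
  simpa using congr_arg List.length (ofList_injective h)

@[simp] theorem size_unary (n : ℕ) : (unary n).size = 2 * n + 1 := by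
  simp [unary, size_ofList]
  omega

end BTree

open BTree

section Strings

set_option linter.unusedSectionVars false

variable {A : Type} [Fintype A]

/-- A symbol of a finite alphabet, as a tree. -/
noncomputable def symbolTree (s : A) : BTree := unary (Fintype.equivFin A s)

theorem symbolTree_injective : Function.Injective (symbolTree (A := A)) := fun _ _ h =>
  (Fintype.equivFin A).injective (Fin.ext (unary_injective h))

/-- A string, as a tree. -/
noncomputable def stringTree (l : List A) : BTree := ofList (l.map symbolTree)

@[simp] theorem stringTree_nil : stringTree ([] : List A) = .leaf := rfl

@[simp] theorem stringTree_cons (s : A) (l : List A) :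
    stringTree (s :: l) = .node (symbolTree s) (stringTree l) := rfl

theorem length_le_size_stringTree (l : List A) : l.length ≤ (stringTree l).size := by
  induction l with
  | nil => simp
  | cons s l ih => simp; omega

/-- Two stacks, one for strings over `A` and one for bits. -/
@[reducible]
def IOΓ (A : Type) : Bool → Type
  | true => A
  | false => Option Bool

/-- The contents of the two stacks. -/
def ioStk (l : List A) (w : List (Option Bool)) : ∀ k, List (IOΓ A k)
  | true => l
  | false => w

@[simp] theorem update_ioStk_true (l l' : List A) (w : List (Option Bool)) :
    Function.update (ioStk l w) true l' = ioStk l' w := by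
  funext k; cases k <;> simp [ioStk]

@[simp] theorem update_ioStk_false (l : List A) (w w' : List (Option Bool)) :
    Function.update (ioStk l w) false w' = ioStk l w' := by
  funext k; cases k <;> simp [ioStk]

theorem update_true_eq_ioStk (l : List A) :
    Function.update (β := fun k => List (IOΓ A k)) (fun _ => []) true l = ioStk l [] := by
  funext k; cases k <;> simp [ioStk]

theorem update_false_eq_ioStk (w : List (Option Bool)) :
    Function.update (β := fun k => List (IOΓ A k)) (fun _ => []) false w = ioStk [] w := by
  funext k; cases k <;> simp [ioStk]

/-! ### From strings to trees. -/

section Input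

/-- Push a string of bits, first symbol first. -/
def pushWord (w : List (Option Bool)) : Prog (IOΓ A) (Option A) :=
  w.foldr (fun s p => .seq (.push false fun _ => s) p) (.load fun v => v)

theorem runsIn_pushWord (w : List (Option Bool)) (v : Option A) (l : List A) :
    ∀ w' : List (Option Bool),
      RunsIn (pushWord w) v (ioStk l w') v (ioStk l (w.reverse ++ w')) (w.length + 1) := by
  induction w with
  | nil => intro w'; exact ⟨1, by simp, .load _ _ _⟩
  | cons s w ih =>
    intro w'
    have h1 := Runs.push (Γ := IOΓ A) (σ := Option A) false (fun _ => s) v (ioStk l w')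
    rw [update_ioStk_false] at h1
    have h2 := RunsIn.seq ⟨1, le_rfl, h1⟩ (ih (s :: w'))
    rw [List.reverse_cons, List.append_assoc]
    exact h2.mono (by rw [List.length_cons]; omega)

/-- Replace the symbols of a string by trees. -/
noncomputable def readString : Prog (IOΓ A) (Option A) :=
  .seq (.push false fun _ => some false) <| .seq (.pop true fun _ o => o) <|
    .loop Option.isSome <| .seq (.switch fun v => pushWord
      (v.elim [] fun s => (some true :: (symbolTree s).word).reverse)) (.pop true fun _ o => o)

/-- Each symbol becomes the new head of the list built so far, so the first symbol ends up innermost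
and the string comes out reversed. The cost per symbol is bounded through the size of its unary
code. -/
theorem runsIn_readString_loop (l : List A) : ∀ (v : Option A) (acc : List A),
    RunsIn (.seq (.pop true fun _ o => o) <|
      .loop Option.isSome <| .seq (.switch fun v => pushWord
        (v.elim [] fun s => (some true :: (symbolTree s).word).reverse)) (.pop true fun _ o => o)) v
      (ioStk l (stringTree acc).word) none (ioStk [] (stringTree (l.reverse ++ acc)).word)
      ((2 * Fintype.card A + 7) * l.length + 2) := by
  induction l with
  | nil =>
    intro v acc
    have h1 := Runs.pop (Γ := IOΓ A) true (fun _ o => o) v (ioStk [] (stringTree acc).word)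
    simp only [ioStk, List.head?_nil, List.tail_nil] at h1
    rw [update_ioStk_true] at h1
    exact ⟨2, by simp, h1.seq (.loop_exit rfl)⟩
  | cons s l ih =>
    intro v acc
    have h1 := Runs.pop (Γ := IOΓ A) true (fun _ o => o) v (ioStk (s :: l) (stringTree acc).word)
    simp only [ioStk, List.head?_cons, List.tail_cons] at h1
    rw [update_ioStk_true] at h1
    obtain ⟨m, hm, hr⟩ := ih (some s) (s :: acc)
    cases hr with
    | @seq _ _ _ _ v3 S1 _ _ m1 m2 hr1 hr2 =>
    have h2 := runsIn_pushWord (some true :: (symbolTree s).word).reverse (some s) l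
      (stringTree acc).word
    rw [List.reverse_reverse] at h2
    have h3 := RunsIn.seq ⟨1, le_rfl, h1⟩ <| RunsIn.loop_next (c := Option.isSome) rfl
      ((RunsIn.switch (v := some s) (f := fun v : Option A => pushWord (A := A)
        (v.elim [] fun s => (some true :: (symbolTree s).word).reverse)) h2).seq
        ⟨m1, le_rfl, by simpa using hr1⟩) ⟨m2, le_rfl, hr2⟩
    have h4 := (Fintype.equivFin A s).2
    refine RunsIn.mono (by simpa using h3) ?_
    simp only [List.length_cons, symbolTree, size_unary, mul_add]
    omega

/-- The tree of the reversed string is computable in polynomial time. -/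
theorem computable_readString {α : Type} (ea : α → List A) :
    Nonempty (TM2ComputableInPolyTime ea (fun a => (stringTree (ea a).reverse).word)
      fun a : α => a) := by
  let _ : Fintype (IOΓ A true) := inferInstanceAs (Fintype A)
  refine Prog.computable (readString (A := A)) true false none (Equiv.refl _) (Equiv.refl _)
    (.C (2 * Fintype.card A + 7) * .X + 3) fun a => ?_
  have h1 := Runs.push (Γ := IOΓ A) (σ := Option A) false (fun _ => some false) none (ioStk (ea a) [])
  rw [update_ioStk_false] at h1
  have h2 := RunsIn.seq ⟨1, le_rfl, h1⟩ (runsIn_readString_loop (ea a) none [])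
  obtain ⟨n, hn, hr⟩ := h2
  refine ⟨n, hn.trans ?_, ?_⟩
  · simp; omega
  · have h3 := update_true_eq_ioStk (ea a)
    have h4 := update_false_eq_ioStk (A := A) (stringTree (ea a).reverse).word
    erw [List.map_id, List.map_id, h3, h4]
    rw [List.append_nil] at hr
    exact hr

end Input

/-! ### From trees to strings. -/

section Output

variable [Nonempty A]

/-- Pop a bit. -/
def readBit : Prog (IOΓ A) (Option Bool × Fin (Fintype.card A + 1)) :=
  .pop false fun v o => (o.join, v.2)

theorem runs_readBit (l : List A) (s : Option Bool) (w : List (Option Bool))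
    (v : Option Bool × Fin (Fintype.card A + 1)) :
    Runs readBit v (ioStk l (s :: w)) (s, v.2) (ioStk l w) 1 := by
  have h := Runs.pop (Γ := IOΓ A) (σ := Option Bool × Fin (Fintype.card A + 1)) false
    (fun v o => (o.join, v.2)) v (ioStk l (s :: w))
  rw [update_ioStk_false] at h
  exact h

/-- Read a unary number and add it to the counter. -/
def readUnary : Prog (IOΓ A) (Option Bool × Fin (Fintype.card A + 1)) :=
  .seq readBit <| .loop (fun v => v.1 == some true) <|
    .seq (.load fun v => (v.1, v.2 + 1)) <| .seq readBit readBit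

open Classical in
/-- The symbol with the number in the counter. -/
noncomputable def counterSymbol (v : Option Bool × Fin (Fintype.card A + 1)) : A :=
  if h : v.2.val < Fintype.card A then (Fintype.equivFin A).symm ⟨v.2, h⟩
  else Classical.arbitrary A

/-- Replace the trees of a list by symbols. -/
noncomputable def writeString : Prog (IOΓ A) (Option Bool × Fin (Fintype.card A + 1)) :=
  .seq readBit <| .loop (fun v => v.1 == some true) <| .seq (.load fun v => (v.1, 0)) <|
    .seq readUnary <| .seq (.push true counterSymbol) readBit

/-- The string of `unary n` is `true false` repeated `n` times and a final `false`, so each round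
consumes two bits. The bound on `m + n` keeps the counter in `Fin` from wrapping around. -/
theorem runsIn_readUnary (l : List A) (w : List (Option Bool)) (n : ℕ) : ∀ (v : Option Bool) (m : ℕ)
    (h : m + n < Fintype.card A + 1),
    RunsIn readUnary (v, ⟨m, by omega⟩) (ioStk l ((unary n).word ++ w)) (some false, ⟨m + n, h⟩)
      (ioStk l w) (4 * n + 2) := by
  induction n with
  | zero =>
    intro v m h
    exact ⟨2, by simp, (runs_readBit l (some false) w (v, ⟨m, h⟩)).seq (.loop_exit rfl)⟩
  | succ n ih =>
    intro v m h
    obtain ⟨k, hk, hr⟩ := ih (some false) (m + 1) (by omega)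
    cases hr with
    | @seq _ _ _ _ v3 S1 _ _ m1 m2 hr1 hr2 =>
    have h0 : (⟨m, by omega⟩ : Fin (Fintype.card A + 1)) + 1 = ⟨m + 1, by omega⟩ := by
      ext
      rw [Fin.val_add_one_of_lt]
      simp [Fin.lt_def]
      omega
    have h1 := runs_readBit l (some true) (some false :: ((unary n).word ++ w)) (v, ⟨m, by omega⟩)
    have h2 := Runs.load (Γ := IOΓ A) (fun v : Option Bool × Fin (Fintype.card A + 1) => (v.1, v.2 + 1))
      (some true, ⟨m, by omega⟩) (ioStk l (some false :: ((unary n).word ++ w)))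
    dsimp only at h2
    rw [h0] at h2
    have h3 := runs_readBit l (some false) ((unary n).word ++ w)
      (some true, ⟨m + 1, by omega⟩)
    have h4 := h1.seq (.loop_next (c := fun v => v.1 == some true) (by rfl)
      (h2.seq (h3.seq hr1)) hr2)
    have h5 : (⟨m + 1 + n, by omega⟩ : Fin (Fintype.card A + 1)) = ⟨m + (n + 1), h⟩ := by
      ext
      simp only
      omega
    rw [h5] at h4
    rw [unary_succ, word_node]
    exact ⟨_, by omega, h4⟩

theorem runsIn_writeString (l : List A) : ∀ (v : Option Bool) (m : Fin (Fintype.card A + 1))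
    (acc : List A), ∃ m',
    RunsIn writeString (v, m) (ioStk acc (stringTree l).word) (some false, m')
      (ioStk (l.reverse ++ acc) []) ((4 * Fintype.card A + 6) * l.length + 2) := by
  induction l with
  | nil =>
    intro v m acc
    exact ⟨m, 2, by simp, (runs_readBit acc (some false) [] (v, m)).seq (.loop_exit rfl)⟩
  | cons s l ih =>
    intro v m acc
    have hs := (Fintype.equivFin A s).2
    let j : Fin (Fintype.card A + 1) := ⟨0 + Fintype.equivFin A s, by omega⟩
    obtain ⟨m', k, hk, hr⟩ := ih (some false) j (s :: acc)
    cases hr with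
    | @seq _ _ _ _ v3 S1 _ _ m1 m2 hr1 hr2 =>
    have h1 := runs_readBit acc (some true) ((symbolTree s).word ++ (stringTree l).word) (v, m)
    have h2 := Runs.load (Γ := IOΓ A) (fun v : Option Bool × Fin (Fintype.card A + 1) => (v.1, 0))
      (some true, m) (ioStk acc ((symbolTree s).word ++ (stringTree l).word))
    obtain ⟨n, hn, h3⟩ := runsIn_readUnary acc (stringTree l).word (Fintype.equivFin A s) (some true)
      0 (by omega)
    have h4 := Runs.push (Γ := IOΓ A) true counterSymbol (some false, j)
      (ioStk acc (stringTree l).word)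
    have h5 : counterSymbol (some false, j) = s := by
      simp [counterSymbol, j]
    rw [update_ioStk_true, h5] at h4
    have h6 := h1.seq (.loop_next (c := fun v => v.1 == some true) (by rfl)
      (h2.seq (h3.seq (h4.seq hr1))) hr2)
    rw [List.reverse_cons, List.append_assoc]
    refine ⟨m', _, ?_, by rw [stringTree_cons, word_node]; exact h6⟩
    simp only [List.length_cons, mul_add, mul_one]
    omega

/-- The reversed string of a tree is computable in polynomial time. -/
theorem computable_writeString {β : Type} (eb : β → List A) :
    Nonempty (TM2ComputableInPolyTime (fun b => (stringTree (eb b).reverse).word) eb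
      fun b : β => b) := by
  refine Prog.computable (.seq (writeString (A := A)) (.load fun _ => (none, 0))) false true
    (none, 0) (Equiv.refl _) (Equiv.refl _) (.C (4 * Fintype.card A + 6) * .X + 3) fun b => ?_
  obtain ⟨m', n, hn, hr⟩ := runsIn_writeString (eb b).reverse none 0 []
  refine ⟨n + 1, ?_, ?_⟩
  · have h1 := length_le_size_stringTree (eb b).reverse
    have h2 : (4 * Fintype.card A + 6) * (eb b).reverse.length ≤
        (4 * Fintype.card A + 6) * (stringTree (eb b).reverse).size := Nat.mul_le_mul_left _ h1
    simp only [Polynomial.eval_add, Polynomial.eval_mul, Polynomial.eval_C, Polynomial.eval_X,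
      length_word, Polynomial.eval_ofNat]
    omega
  · have h3 := update_true_eq_ioStk (eb b)
    have h4 := update_false_eq_ioStk (A := A) (stringTree (eb b).reverse).word
    erw [List.map_id, List.map_id, h3, h4]
    rw [List.reverse_reverse, List.append_nil] at hr
    exact hr.seq (.load _ _ _)

end Output

end Strings

/-- A function on strings is computable in polynomial time if the corresponding function on the
trees of the reversed strings is in `PTime`. -/
theorem PTime.computable_strings {α β A B : Type} [Fintype A] [Fintype B] [Nonempty B]
    {g : BTree → BTree} (hg : PTime g) {ea : α → List A} {eb : β → List B} {f : α → β}
    (h : ∀ a, g (stringTree (ea a).reverse) = stringTree (eb (f a)).reverse) :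
    Nonempty (TM2ComputableInPolyTime ea eb f) := by
  obtain ⟨h1⟩ := computable_readString ea
  obtain ⟨h2⟩ := hg.computable (s := fun a => stringTree (ea a).reverse)
    (t := fun b => stringTree (eb b).reverse) h
  obtain ⟨h3⟩ := computable_writeString eb
  obtain ⟨h4⟩ := h1.comp_nonempty h2
  exact h4.comp_nonempty h3

end Turing.PolyTime

/-! ## Predicates, lists and numbers in polynomial time -/

namespace Turing.PolyTime

open BTree

open Classical in
/-- The truth value of a proposition, as a tree. -/
noncomputable def BTree.ofProp (p : Prop) : BTree := if p then node leaf leaf else leaf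

@[simp] theorem BTree.ofProp_eq_leaf {p : Prop} : ofProp p = leaf ↔ ¬p := by
  unfold ofProp; split_ifs <;> simp_all

/-- The predicates on trees that are decidable in polynomial time. -/
def PPred (P : BTree → Prop) : Prop := PTime fun x => ofProp (P x)

/-! ### Conditionals and Boolean combinations. -/

section Closure

variable {P Q : BTree → Prop} {f g h i : BTree → BTree}

open Classical in
theorem PTime.ite (hP : PPred P) (hf : PTime f) (hg : PTime g) :
    PTime fun x => if P x then f x else g x := by
  have := PTime.ite_leaf hP hg hf
  simp only [ofProp_eq_leaf, ite_not] at this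
  exact this

namespace PPred

theorem congr (hP : PPred P) (h : ∀ x, P x ↔ Q x) : PPred Q := by
  have : P = Q := funext fun x => propext (h x)
  exact this ▸ hP

theorem comp (hP : PPred P) (hf : PTime f) : PPred fun x => P (f x) := PTime.comp hP hf

theorem eq_leaf (hf : PTime f) : PPred fun x => f x = .leaf := by
  have := PTime.ite_leaf hf (.const (.node .leaf .leaf)) .leaf
  exact this

theorem not (hP : PPred P) : PPred fun x => ¬P x := by
  refine (PTime.ite hP .leaf (.const (.node .leaf .leaf))).congr fun x => ?_
  by_cases h : P x <;> simp [ofProp, h]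

theorem and (hP : PPred P) (hQ : PPred Q) : PPred fun x => P x ∧ Q x := by
  refine (PTime.ite hP hQ .leaf).congr fun x => ?_
  by_cases h : P x
  · simp only [h, if_true, true_and]
  · simp [ofProp, h]

theorem or (hP : PPred P) (hQ : PPred Q) : PPred fun x => P x ∨ Q x :=
  (hP.not.and hQ.not).not.congr fun x => by tauto

theorem imp (hP : PPred P) (hQ : PPred Q) : PPred fun x => P x → Q x :=
  (hP.not.or hQ).congr fun x => by tauto

theorem eq_const (hf : PTime f) (t : BTree) : PPred fun x => f x = t := by
  induction t generalizing f with
  | leaf => exact eq_leaf hf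
  | node l r ihl ihr =>
    refine ((eq_leaf hf).not.and ((ihl hf.fst_comp).and (ihr hf.snd_comp))).congr fun x => ?_
    cases f x <;> simp

end PPred

end Closure

theorem PTime.exists_size_le {f : BTree → BTree} (hf : PTime f) :
    ∃ P : Polynomial ℕ, ∀ x, (f x).size ≤ P.eval x.size :=
  let ⟨_, P, hP⟩ := hf
  ⟨P, fun x => (hP x).1⟩

/-! ### Folds and bounded quantifiers. -/

section Fold

variable {F : BTree → BTree → BTree → BTree} {l z : BTree → BTree}

/-- Folding a function over a list, if the sizes of the results stay polynomially bounded. -/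
theorem PTime.foldl (hF : PTime fun y => F y.fst.fst y.fst.snd y.snd) (hl : PTime l) (hz : PTime z)
    (hb : ∃ B : Polynomial ℕ, ∀ x, ∀ l' : List BTree, l' <+: (l x).toList →
      (l'.foldl (F x) (z x)).size ≤ B.eval x.size) :
    PTime fun x => (l x).toList.foldl (F x) (z x) := by
  classical
  let S : BTree → BTree := fun s => if s.snd = .leaf then s else
    .node (.node s.fst.fst (F s.fst.fst s.fst.snd s.snd.fst)) s.snd.snd
  have hS : PTime S := by
    refine PTime.ite_leaf .snd .id ((PTime.node (PTime.fst.comp .fst) ?_).node (PTime.snd.comp .snd))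
    exact hF.comp (PTime.fst.node (PTime.fst.comp .snd))
  have key : ∀ (x : BTree) (i : ℕ) (t acc : BTree), S^[i] (.node (.node x acc) t) =
      .node (.node x ((t.toList.take i).foldl (F x) acc)) (BTree.snd^[i] t) := by
    intro x i
    induction i with
    | zero => intro t acc; simp
    | succ i ih =>
      intro t acc
      rw [Function.iterate_succ_apply, Function.iterate_succ_apply]
      cases t with
      | leaf => simpa [S] using ih .leaf acc
      | node a t => simpa [S] using ih t (F x acc a)
  have sizes : ∀ (i : ℕ) (t : BTree), (BTree.snd^[i] t).size ≤ t.size := by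
    intro i
    induction i with
    | zero => intro t; rfl
    | succ i ih =>
      intro t
      rw [Function.iterate_succ_apply]
      exact (ih _).trans t.size_snd_le
  have length_le : ∀ t : BTree, t.toList.length ≤ t.size := by
    intro t
    induction t with
    | leaf => simp
    | node a t _ ih => simp; omega
  obtain ⟨B, hB⟩ := hb
  obtain ⟨L, hL⟩ := hl.exists_size_le
  have h1 : PTime fun x => S^[(l x).size] (.node (.node x (z x)) (l x)) := by
    refine hS.iterate hl ((PTime.id.node hz).node hl) ⟨.X + B + L + 2, fun x i _ => ?_⟩
    rw [key]
    have h2 := hB x _ (List.take_prefix i _)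
    have h3 := sizes i (l x)
    have h4 := hL x
    simp
    omega
  refine (h1.fst_comp.snd_comp).congr fun x => ?_
  rw [key, List.take_of_length_le (length_le _)]
  rfl

theorem size_ofList_le_of_prefix {l' : List BTree} {t : BTree} (h : l' <+: t.toList) :
    (ofList l').size ≤ t.size := by
  induction l' generalizing t with
  | nil => exact t.size_pos
  | cons a l' ih =>
    cases t with
    | leaf => simp at h
    | node b t =>
      rw [toList_node, List.cons_prefix_cons] at h
      have := ih h.2
      simp only [ofList_cons, size_node, h.1]
      omega

/-- Folding a function that adds to the size at most a multiple of the size of the list entry. -/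
theorem PTime.foldl_of_add (hF : PTime fun y => F y.fst.fst y.fst.snd y.snd) (hl : PTime l)
    (hz : PTime z)
    (hb : ∃ Q : Polynomial ℕ, ∀ e acc a, (F e acc a).size ≤ acc.size + Q.eval e.size * a.size) :
    PTime fun x => (l x).toList.foldl (F x) (z x) := by
  obtain ⟨Q, hQ⟩ := hb
  obtain ⟨L, hL⟩ := hl.exists_size_le
  obtain ⟨Z, hZ⟩ := hz.exists_size_le
  -- The sizes of the entries add up to at most the size of the list, which `L` bounds.
  refine hF.foldl hl hz ⟨Z + Q * L, fun x l' h => ?_⟩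
  have key : ∀ (l' : List BTree) (acc : BTree),
      (l'.foldl (F x) acc).size ≤ acc.size + Q.eval x.size * (ofList l').size := by
    intro l'
    induction l' with
    | nil => intro acc; simp
    | cons a l' ih =>
      intro acc
      have h1 := ih (F x acc a)
      have h2 := hQ x acc a
      simp only [List.foldl_cons, ofList_cons, size_node, mul_add]
      omega
  have h1 := key l' (z x)
  have h2 : Q.eval x.size * (ofList l').size ≤ Q.eval x.size * L.eval x.size :=
    Nat.mul_le_mul_left _ ((size_ofList_le_of_prefix h).trans (hL x))
  have h3 := hZ x
  simp only [Polynomial.eval_add, Polynomial.eval_mul]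
  omega

namespace PPred

variable {R : BTree → BTree → Prop} {f : BTree → BTree}

/-- Bounded existential quantification. -/
theorem exists_mem (hR : PPred fun y => R y.fst y.snd) (hf : PTime f) :
    PPred fun x => ∃ a ∈ (f x).toList, R x a := by
  classical
  have h1 : PTime fun x => (f x).toList.foldl
      (fun acc a => if R x a then .node .leaf .leaf else acc) .leaf := by
    refine PTime.foldl_of_add (F := fun x acc a => if R x a then .node .leaf .leaf else acc)
      (PTime.ite (hR.comp (PTime.node (PTime.fst.comp .fst) .snd)) (.const _)
        (PTime.snd.comp .fst)) hf (.const _) ⟨3, fun e acc a => ?_⟩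
    have := a.size_pos
    split_ifs
    · simp; omega
    · simp
  refine h1.congr fun x => ?_
  have key : ∀ (l : List BTree) (acc : BTree),
      l.foldl (fun acc a => if R x a then .node .leaf .leaf else acc) acc =
        if ∃ a ∈ l, R x a then .node .leaf .leaf else acc := by
    intro l
    induction l with
    | nil => simp
    | cons a l ih =>
      intro acc
      rw [List.foldl_cons, ih]
      by_cases h1 : R x a <;> by_cases h2 : ∃ a ∈ l, R x a <;> simp [h1, h2]
  rw [key]
  simp only [ofProp]
  congr

/-- Bounded universal quantification. -/
theorem forall_mem (hR : PPred fun y => R y.fst y.snd) (hf : PTime f) :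
    PPred fun x => ∀ a ∈ (f x).toList, R x a :=
  (exists_mem (R := fun x a => ¬R x a) hR.not hf).not.congr fun x => by push Not; rfl

end PPred

theorem PTime.reverse {f : BTree → BTree} (hf : PTime f) :
    PTime fun x => ofList (f x).toList.reverse := by
  have h1 : PTime fun x => (f x).toList.foldl (fun acc a => .node a acc) .leaf := by
    refine PTime.foldl_of_add (F := fun _ acc a => .node a acc) (PTime.node .snd (PTime.snd.comp .fst))
      hf .leaf ⟨2, fun e acc a => ?_⟩
    have := a.size_pos
    simp
    omega
  refine h1.congr fun x => ?_
  have key : ∀ (l : List BTree) (acc : BTree),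
      l.foldl (fun acc a => .node a acc) acc = ofList (l.reverse ++ acc.toList) := by
    intro l
    induction l with
    | nil => intro acc; simp
    | cons a l ih => intro acc; simp [ih]
  simp [key]

end Fold

/-! ### Arithmetic of binary numbers. -/

section Numbers

open Classical in
/-- The value of a tree, as a list of binary digits, the least significant digit first. -/
noncomputable def BTree.val : BTree → ℕ
  | leaf => 0
  | node a l => (if a = leaf then 0 else 1) + 2 * val l

open Classical in
/-- The first digit. -/
noncomputable def BTree.bit (x : BTree) : ℕ := if x.fst = leaf then 0 else 1

theorem BTree.val_eq (x : BTree) : x.val = x.bit + 2 * x.snd.val := by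
  cases x
  · simp [bit, val]
  · rfl

theorem BTree.bit_le_one (x : BTree) : x.bit ≤ 1 := by unfold bit; split_ifs <;> simp

@[simp] theorem BTree.val_leaf : leaf.val = 0 := rfl

@[simp] theorem BTree.val_one : (node (node leaf leaf) leaf).val = 1 := by simp [val]

open Classical in
/-- The successor of a number. -/
noncomputable def BTree.incr : BTree → BTree
  | leaf => node (node leaf leaf) leaf
  | node a l => if a = leaf then node (node leaf leaf) l else node leaf (incr l)

theorem BTree.val_incr (x : BTree) : x.incr.val = x.val + 1 := by
  induction x with
  | leaf => simp [incr]
  | node a l _ ih =>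
    unfold incr
    split_ifs with h
    · simp [val, h]; omega
    · simp [val, ih, h]; omega

theorem BTree.size_incr_le (x : BTree) : x.incr.size ≤ x.size + 4 := by
  induction x with
  | leaf => simp [incr]
  | node a l _ ih =>
    unfold incr
    split_ifs with h
    · simp [h]; omega
    · have := a.size_pos
      simp
      omega

/-- The recursion of `incr` becomes a fold whose accumulator holds the carry, initially set, and the
digits written so far in reverse. A carry left at the end becomes a new leading digit before the
list is reversed. -/
theorem PTime.incr {f : BTree → BTree} (hf : PTime f) : PTime fun x => (f x).incr := by
  classical
  let F : BTree → BTree → BTree → BTree := fun _ acc a =>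
    if acc.fst = .leaf then .node .leaf (.node a acc.snd)
    else if a = .leaf then .node .leaf (.node (.node .leaf .leaf) acc.snd)
    else .node (.node .leaf .leaf) (.node .leaf acc.snd)
  have hF : PTime fun y => F y.fst.fst y.fst.snd y.snd := by
    have h1 : PTime fun y => y.fst.snd.fst := PTime.fst.comp (PTime.snd.comp .fst)
    have h2 : PTime fun y => y.fst.snd.snd := PTime.snd.comp (PTime.snd.comp .fst)
    exact PTime.ite (PPred.eq_leaf h1) (PTime.leaf.node (PTime.snd.node h2))
      (PTime.ite (PPred.eq_leaf .snd) (PTime.leaf.node ((PTime.const _).node h2))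
        ((PTime.const _).node (PTime.leaf.node h2)))
  have h1 : PTime fun x => (f x).toList.foldl (F x) (.node (.node .leaf .leaf) .leaf) := by
    refine hF.foldl_of_add hf (.const _) ⟨8, fun e acc a => ?_⟩
    have h1 := a.size_pos
    have h2 : acc.snd.size ≤ acc.size := acc.size_snd_le
    simp only [F]
    split_ifs <;> simp <;> omega
  have h2 := (PTime.ite (PPred.eq_leaf h1.fst_comp) h1.snd_comp
    ((PTime.const (.node .leaf .leaf)).node h1.snd_comp)).reverse
  refine h2.congr fun x => ?_
  have key0 : ∀ (t out : BTree), t.toList.foldl (F x) (.node .leaf out) =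
      .node .leaf (ofList (t.toList.reverse ++ out.toList)) := by
    intro t
    induction t with
    | leaf => simp
    | node a l _ ih =>
      intro out
      have h3 : F x (.node .leaf out) a = .node .leaf (.node a out) := by simp [F]
      simp [h3, ih]
  have key : ∀ (t out : BTree), (if (t.toList.foldl (F x) (.node (.node .leaf .leaf) out)).fst = .leaf
        then (t.toList.foldl (F x) (.node (.node .leaf .leaf) out)).snd
        else .node (.node .leaf .leaf) (t.toList.foldl (F x) (.node (.node .leaf .leaf) out)).snd) =
      ofList (t.incr.toList.reverse ++ out.toList) := by
    intro t
    induction t with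
    | leaf => simp [BTree.incr]
    | node a l _ ih =>
      intro out
      by_cases ha : a = .leaf
      · have h3 : F x (.node (.node .leaf .leaf) out) a = .node .leaf (.node (.node .leaf .leaf) out) := by
          simp [F, ha]
        simp only [toList_node, List.foldl_cons, h3, key0]
        simp [BTree.incr, ha]
      · have h3 : F x (.node (.node .leaf .leaf) out) a =
            .node (.node .leaf .leaf) (.node .leaf out) := by
          simp [F, ha]
        simp only [toList_node, List.foldl_cons, h3]
        rw [ih]
        simp [BTree.incr, ha]
  rw [key]
  simp

/-- The length of a list, as a binary number. -/
noncomputable def BTree.len (x : BTree) : BTree := x.toList.foldl (fun acc _ => acc.incr) .leaf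

theorem BTree.val_len (x : BTree) : x.len.val = x.toList.length := by
  have key : ∀ (l : List BTree) (acc : BTree),
      (l.foldl (fun acc _ => acc.incr) acc).val = l.length + acc.val := by
    intro l
    induction l with
    | nil => simp
    | cons a l ih => intro acc; simp [ih, val_incr]; omega
  simp [len, key]

theorem PTime.len {f : BTree → BTree} (hf : PTime f) : PTime fun x => (f x).len := by
  refine PTime.foldl_of_add (F := fun _ acc _ => acc.incr) (PTime.incr (PTime.snd.comp .fst)) hf .leaf
    ⟨4, fun e acc a => ?_⟩
  have h1 := acc.size_incr_le
  have h2 := a.size_pos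
  simp
  omega

open Classical in
/-- Add the first digit of `p` to the unary number `q`. -/
noncomputable def addBit (p q : BTree) : BTree := if p.fst = .leaf then q else .node .leaf q

open Classical in
/-- Add the complement of the first digit of `p` to the unary number `q`. -/
noncomputable def addNotBit (p q : BTree) : BTree := if p.fst = .leaf then .node .leaf q else q

open Classical in
/-- Half of a unary number below `8`, rounded down. -/
noncomputable def half (r : BTree) : BTree :=
  if r.snd = .leaf then unary 0 else if r.snd.snd.snd = .leaf then unary 1
  else if r.snd.snd.snd.snd.snd = .leaf then unary 2 else unary 3

theorem addBit_unary (p : BTree) (m : ℕ) : addBit p (unary m) = unary (m + p.bit) := by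
  unfold addBit BTree.bit
  split_ifs <;> rfl

theorem addNotBit_unary (p : BTree) (m : ℕ) : addNotBit p (unary m) = unary (m + (1 - p.bit)) := by
  unfold addNotBit BTree.bit
  split_ifs <;> rfl

theorem half_unary (m : ℕ) (hm : m ≤ 7) : half (unary m) = unary (m / 2) := by
  unfold half
  interval_cases m <;> simp [unary]

/-- One step of the comparison of `a + b` with `c + d`: the first component is a carry in unary. -/
noncomputable def compareStep (s : BTree) : BTree :=
  .node (half (addBit s.snd.snd.fst (addBit s.snd.snd.snd
      (addNotBit s.snd.fst.fst (addNotBit s.snd.fst.snd s.fst)))))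
    (.node (.node s.snd.fst.fst.snd s.snd.fst.snd.snd) (.node s.snd.snd.fst.snd s.snd.snd.snd.snd))

theorem ptime_compareStep : PTime compareStep := by
  have add : ∀ {p q : BTree → BTree}, PTime p → PTime q → PTime fun x => addBit (p x) (q x) :=
    fun hp hq => PTime.ite (PPred.eq_leaf hp.fst_comp) hq (PTime.leaf.node hq)
  have addNot : ∀ {p q : BTree → BTree}, PTime p → PTime q →
      PTime fun x => addNotBit (p x) (q x) :=
    fun hp hq => PTime.ite (PPred.eq_leaf hp.fst_comp) (PTime.leaf.node hq) hq
  have ha : PTime fun s => s.snd.fst.fst := PTime.snd.fst_comp.fst_comp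
  have hb : PTime fun s => s.snd.fst.snd := PTime.snd.fst_comp.snd_comp
  have hc : PTime fun s => s.snd.snd.fst := PTime.snd.snd_comp.fst_comp
  have hd : PTime fun s => s.snd.snd.snd := PTime.snd.snd_comp.snd_comp
  have hh : PTime half := PTime.ite (PPred.eq_leaf PTime.snd) (.const _)
    (PTime.ite (PPred.eq_leaf PTime.snd.snd_comp.snd_comp) (.const _)
      (PTime.ite (PPred.eq_leaf PTime.snd.snd_comp.snd_comp.snd_comp.snd_comp) (.const _) (.const _)))
  exact (hh.comp (add hc (add hd (addNot ha (addNot hb .fst))))).node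
    ((ha.snd_comp.node hb.snd_comp).node (hc.snd_comp.node hd.snd_comp))

theorem compareStep_node (r : ℕ) (hr : r ≤ 3) (a b c d : BTree) :
    compareStep (.node (unary r) (.node (.node a b) (.node c d))) =
      .node (unary ((r + c.bit + d.bit + (1 - a.bit) + (1 - b.bit)) / 2))
        (.node (.node a.snd b.snd) (.node c.snd d.snd)) := by
  have h1 := a.bit_le_one
  have h2 := b.bit_le_one
  have h3 := c.bit_le_one
  have h4 := d.bit_le_one
  simp only [compareStep, fst_node, snd_node, addBit_unary, addNotBit_unary]
  rw [half_unary _ (by omega)]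
  congr 3
  omega

/-- The inequality `2 + a + b ≤ r + c + d` is invariant. Splitting off the lowest digits and adding
the complements of those of `a` and `b` makes the rest even, so halving the carry, rounded down,
loses nothing; as `(3 + 4) / 2 = 3`, the carry stays at most 3. -/
theorem compareStep_iterate (i : ℕ) : ∀ (r : ℕ) (_ : r ≤ 3) (a b c d : BTree), ∃ r' ≤ 3,
    compareStep^[i] (.node (unary r) (.node (.node a b) (.node c d))) =
      .node (unary r') (.node (.node (BTree.snd^[i] a) (BTree.snd^[i] b))
        (.node (BTree.snd^[i] c) (BTree.snd^[i] d))) ∧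
    (2 + a.val + b.val ≤ r + c.val + d.val ↔
      2 + (BTree.snd^[i] a).val + (BTree.snd^[i] b).val ≤
        r' + (BTree.snd^[i] c).val + (BTree.snd^[i] d).val) := by
  induction i with
  | zero => intro r hr a b c d; exact ⟨r, hr, rfl, Iff.rfl⟩
  | succ i ih =>
    intro r hr a b c d
    simp only [Function.iterate_succ_apply]
    rw [compareStep_node r hr]
    have h1 := a.bit_le_one
    have h2 := b.bit_le_one
    have h3 := c.bit_le_one
    have h4 := d.bit_le_one
    obtain ⟨r', hr', h5, h6⟩ := ih ((r + c.bit + d.bit + (1 - a.bit) + (1 - b.bit)) / 2) (by omega)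
      a.snd b.snd c.snd d.snd
    refine ⟨r', hr', h5, Iff.trans ?_ h6⟩
    rw [a.val_eq, b.val_eq, c.val_eq, d.val_eq]
    omega

theorem BTree.size_iterate_snd_le (i : ℕ) (t : BTree) : (BTree.snd^[i] t).size ≤ t.size := by
  induction i generalizing t with
  | zero => rfl
  | succ i ih => exact (ih _).trans t.size_snd_le

theorem BTree.iterate_snd_eq_leaf (t : BTree) : ∀ i, t.size ≤ i → BTree.snd^[i] t = leaf := by
  have leaf_eq : ∀ i, BTree.snd^[i] leaf = leaf := by
    intro i
    induction i with
    | zero => rfl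
    | succ i ih => exact ih
  induction t with
  | leaf => intro i _; exact leaf_eq i
  | node a t _ ih =>
    intro i hi
    cases i with
    | zero => simp at hi
    | succ i =>
      simp only [size_node] at hi
      exact ih i (by omega)

namespace PPred

variable {f g h k : BTree → BTree}

/-- Comparison of sums of two binary numbers. -/
theorem add_le_add (hf : PTime f) (hg : PTime g) (hh : PTime h) (hk : PTime k) :
    PPred fun x => (f x).val + (g x).val ≤ (h x).val + (k x).val := by
  have hq := (hf.node hg).node (hh.node hk)
  -- With initial carry 2 the invariant is the inequality to be decided. After this many steps all
  -- four numbers are exhausted and it says that the final carry is at least 2.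
  have h1 : PTime fun x => compareStep^[(BTree.node (.node (f x) (g x)) (.node (h x) (k x))).size]
      (.node (unary 2) (.node (.node (f x) (g x)) (.node (h x) (k x)))) := by
    obtain ⟨Q, hQ⟩ := hq.exists_size_le
    refine ptime_compareStep.iterate hq ((PTime.const _).node hq) ⟨Q + 8, fun x i _ => ?_⟩
    obtain ⟨r', hr', h2, -⟩ := compareStep_iterate i 2 (by omega) (f x) (g x) (h x) (k x)
    rw [h2]
    have h3 := size_iterate_snd_le i (f x)
    have h4 := size_iterate_snd_le i (g x)
    have h5 := size_iterate_snd_le i (h x)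
    have h6 := size_iterate_snd_le i (k x)
    have h7 := hQ x
    simp only [size_node, size_unary, Polynomial.eval_add, Polynomial.eval_ofNat] at h7 ⊢
    omega
  refine (eq_leaf h1.fst_comp.snd_comp).not.congr fun x => ?_
  obtain ⟨r', hr', h2, h3⟩ := compareStep_iterate
    (BTree.node (.node (f x) (g x)) (.node (h x) (k x))).size 2 (by omega) (f x) (g x) (h x) (k x)
  rw [h2]
  rw [iterate_snd_eq_leaf (f x) _ (by simp; omega), iterate_snd_eq_leaf (g x) _ (by simp; omega),
    iterate_snd_eq_leaf (h x) _ (by simp; omega), iterate_snd_eq_leaf (k x) _ (by simp; omega)] at h3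
  have h4 : (unary r').snd = .leaf ↔ r' ≤ 1 := by
    interval_cases r' <;> simp [unary]
  simp only [val_leaf] at h3
  simp only [fst_node, h4]
  omega

theorem val_le (hf : PTime f) (hg : PTime g) : PPred fun x => (f x).val ≤ (g x).val :=
  (add_le_add hf .leaf hg .leaf).congr fun x => by simp

theorem val_lt (hf : PTime f) (hg : PTime g) : PPred fun x => (f x).val < (g x).val :=
  (val_le hg hf).not.congr fun x => by simp

theorem val_eq (hf : PTime f) (hg : PTime g) : PPred fun x => (f x).val = (g x).val :=
  ((val_le hf hg).and (val_le hg hf)).congr fun x => by omega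

end PPred

end Numbers

end Turing.PolyTime

/-! ## Folding over strings -/

namespace Turing.PolyTime

open BTree Computability

section FoldString

variable {A : Type} [Fintype A]

/-- Folding over a string a function for each symbol. -/
theorem PTime.foldl_string (δ : A → BTree → BTree) (hδ : ∀ s, PTime (δ s)) (c : ℕ)
    (hc : ∀ s acc, (δ s acc).size ≤ acc.size + c) (z : BTree) :
    ∃ g, PTime g ∧ ∀ l : List A, g (stringTree l) = l.foldl (fun acc s => δ s acc) z := by
  classical
  -- A case distinction over the finite alphabet, built by adding one symbol at a time; it is
  -- applied to the list of all symbols.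
  have cases : ∀ L : List A, ∃ G : BTree → BTree → BTree, (PTime fun y => G y.fst y.snd) ∧
      (∀ acc a, (G acc a).size ≤ acc.size + c) ∧
      ∀ s ∈ L, ∀ acc, G acc (symbolTree s) = δ s acc := by
    intro L
    induction L with
    | nil => exact ⟨fun acc _ => acc, .fst, fun _ _ => by simp, by simp⟩
    | cons s L ih =>
      obtain ⟨G, h1, h2, h3⟩ := ih
      refine ⟨fun acc a => if a = symbolTree s then δ s acc else G acc a,
        PTime.ite (PPred.eq_const .snd _) ((hδ s).comp .fst) h1, fun acc a => ?_, ?_⟩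
      · dsimp only
        split_ifs
        · exact hc s acc
        · exact h2 acc a
      · intro t ht acc
        dsimp only
        split_ifs with h
        · rw [symbolTree_injective h]
        · refine h3 t ((List.mem_cons.1 ht).resolve_left ?_) acc
          rintro rfl
          exact h rfl
  obtain ⟨G, h1, h2, h3⟩ := cases Finset.univ.toList
  refine ⟨fun x => x.toList.foldl (fun acc a => G acc a) z,
    PTime.foldl_of_add (F := fun _ acc a => G acc a) (h1.comp (PTime.fst.snd_comp.node .snd)) .id
      (.const z) ⟨.C c, fun e acc a => (h2 acc a).trans ?_⟩, fun l => ?_⟩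
  · simpa using Nat.le_mul_of_pos_right c a.size_pos
  · dsimp only
    rw [stringTree, toList_ofList, List.foldl_map]
    congr 1
    funext acc s
    exact h3 s (by simp) acc

end FoldString

end Turing.PolyTime

/-! ## The reduction is computable in polynomial time -/

open Turing.PolyTime Turing.PolyTime.BTree Computability

/-- One step of the computation of `singleLabelMap`, from the end of the string to its beginning.
The first component is `0` between blocks, `1` within a block, and `2` in front of the blocks. -/
def singleLabelStep : Γ' → ℕ × List Γ' → ℕ × List Γ'
  | .bra, x => (0, .bra :: x.2)
  | .ket, x => (1, .bit true :: .comma :: .ket :: x.2)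
  | .comma, x => if x.1 = 0 then (2, .comma :: .bit true :: .comma :: .bit true :: .comma :: x.2)
      else (x.1, .comma :: x.2)
  | s, x => (x.1, s :: x.2)

theorem foldr_singleLabelStep_bit (l : List Bool) (x : ℕ × List Γ') :
    (l.map Γ'.bit).foldr singleLabelStep x = (x.1, l.map Γ'.bit ++ x.2) := by
  induction l with
  | nil => rfl
  | cons b l ih => rw [List.map_cons, List.foldr_cons, ih]; rfl

theorem foldr_singleLabelStep_number (m i : ℕ) (hi : i ≠ 0) (l : List Γ') :
    (encodeNumber m).foldr singleLabelStep (i, l) = (i, encodeNumber m ++ l) := by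
  rw [encodeNumber, List.foldr_append, List.foldr_cons, List.foldr_nil, singleLabelStep, if_neg hi,
    foldr_singleLabelStep_bit]
  simp

theorem encodeNumber_one : encodeNumber 1 = [Γ'.bit true, Γ'.comma] := rfl

theorem foldr_singleLabelStep_blocks (l : List (ℕ × ℕ)) :
    ((l.map fun p => [p.1, p.2]).flatMap encodeBlock).foldr singleLabelStep (0, []) =
      (0, (l.map fun p => [p.1, p.2, 1]).flatMap encodeBlock) := by
  induction l with
  | nil => rfl
  | cons p l ih =>
    rw [List.map_cons, List.flatMap_cons, List.foldr_append, ih]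
    simp [encodeBlock, singleLabelStep, foldr_singleLabelStep_number, encodeNumber_one]

theorem foldr_singleLabelStep_unary (n : ℕ) (l : List Γ') :
    (encodeUnary n).foldr singleLabelStep (2, l) = (2, encodeUnary n ++ l) := by
  have key : ∀ (n : ℕ) (l : List Γ'), (List.replicate n Γ'.blank).foldr singleLabelStep (2, l) =
      (2, List.replicate n Γ'.blank ++ l) := by
    intro n l
    induction n with
    | zero => rfl
    | succ n ih => rw [List.replicate_succ, List.foldr_cons, ih]; rfl
  rw [encodeUnary, List.foldr_append]
  simp [singleLabelStep, key]

theorem edgeList_ofStatic_blocks {n : ℕ} (G : SimpleGraph (Fin n)) :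
    ((edgeList G).map fun p => (p.1 : ℕ) :: (p.2 : ℕ) ::
      ((TemporalGraph.ofStatic G).label s(p.1, p.2)).sort (· ≤ ·)) =
    ((edgeList G).map fun p => ((p.1 : ℕ), (p.2 : ℕ))).map fun p => [p.1, p.2, 1] := by
  rw [List.map_map]
  refine List.map_congr_left fun p hp => ?_
  have h : G.Adj p.1 p.2 := (mem_edgeList.1 hp).2
  simp [TemporalGraph.ofStatic, h]

/-- Scanned from the end, the first comma outside brackets is the one after the budget, and the two
numbers 1 go behind it. State 2 then protects the comma after the vertex count. Within blocks the
label 1 is inserted at each closing bracket. -/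
theorem foldr_singleLabelStep_encode (I : ClusterEditingInstance) :
    I.encode.foldr singleLabelStep (0, []) =
      (2, (⟨I.n, TemporalGraph.ofStatic I.graph, I.k, 1, 1⟩ : ETCInstance).encode) := by
  have h1 : ((edgeList I.graph).map fun p => [(p.1 : ℕ), (p.2 : ℕ)]) =
      ((edgeList I.graph).map fun p => ((p.1 : ℕ), (p.2 : ℕ))).map fun p => [p.1, p.2] := by
    simp
  have h2 : ∀ (m : ℕ) (l : List Γ'), (encodeNumber m).foldr singleLabelStep (0, l) =
      (2, encodeNumber m ++ (encodeNumber 1 ++ (encodeNumber 1 ++ l))) := by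
    intro m l
    rw [encodeNumber, List.foldr_append, List.foldr_cons, List.foldr_nil, singleLabelStep,
      if_pos rfl, foldr_singleLabelStep_bit]
    simp [encodeNumber_one]
  rw [ClusterEditingInstance.encode, ETCInstance.encode, List.foldr_append, List.foldr_append, h1,
    foldr_singleLabelStep_blocks, h2, foldr_singleLabelStep_unary]
  congr 6
  exact (edgeList_ofStatic_blocks I.graph).symm

/-- The state of the transducer is kept in unary and its output as a list of symbol trees; each
input symbol then acts by a fixed composition of tree operations. -/
theorem exists_ptime_singleLabel : ∃ g, PTime g ∧ ∀ l : List Γ', g (stringTree l) =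
    stringTree (l.foldl (fun x s => singleLabelStep s x) (0, [])).2.reverse := by
  classical
  let keep : Γ' → BTree → BTree := fun s x => .node x.fst (.node (symbolTree s) x.snd)
  have hkeep : ∀ s, PTime (keep s) := fun s => PTime.fst.node ((PTime.const _).node .snd)
  let δ : Γ' → BTree → BTree
    | .bra => fun x => .node (unary 0) (.node (symbolTree Γ'.bra) x.snd)
    | .ket => fun x => .node (unary 1) (.node (symbolTree (Γ'.bit true)) <|
        .node (symbolTree Γ'.comma) <| .node (symbolTree Γ'.ket) x.snd)
    | .comma => fun x => if x.fst = .leaf then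
        .node (unary 2) (.node (symbolTree Γ'.comma) <| .node (symbolTree (Γ'.bit true)) <|
          .node (symbolTree Γ'.comma) <| .node (symbolTree (Γ'.bit true)) <|
          .node (symbolTree Γ'.comma) x.snd)
        else keep .comma x
    | s => keep s
  have hδ : ∀ s, PTime (δ s) := by
    intro s
    cases s with
    | bra => exact (PTime.const _).node ((PTime.const _).node .snd)
    | ket => exact (PTime.const _).node <| (PTime.const _).node <| (PTime.const _).node <|
        (PTime.const _).node .snd
    | comma => exact PTime.ite (PPred.eq_leaf .fst) ((PTime.const _).node <| (PTime.const _).node <|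
        (PTime.const _).node <| (PTime.const _).node <| (PTime.const _).node <|
        (PTime.const _).node .snd) (hkeep _)
    | bit b => exact hkeep _
    | blank => exact hkeep _
  have hs : ∀ s : Γ', (symbolTree s).size ≤ 2 * Fintype.card Γ' + 1 := by
    intro s
    have := (Fintype.equivFin Γ' s).2
    rw [symbolTree, size_unary]
    omega
  have hx : ∀ x : BTree, x.fst.size + x.snd.size ≤ x.size + 1 := by
    intro x
    cases x
    · simp
    · simp only [fst_node, snd_node, size_node]; omega
  -- At most five symbols are written in a step, each of size at most `2 * Fintype.card Γ' + 1`.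
  have hc : ∀ s x, (δ s x).size ≤ x.size + (10 * Fintype.card Γ' + 30) := by
    intro s x
    have h1 := hx x
    have h2 := hs s
    have h3 := hs .comma
    have h4 := hs (.bit true)
    have h5 := x.size_snd_le
    cases s with
    | comma =>
      dsimp only [δ]
      split_ifs
      · simp only [size_node, size_unary]; omega
      · simp only [keep, size_node]; omega
    | _ => simp only [δ, keep, size_node, size_unary]; omega
  have hu : ∀ m, unary m = .leaf ↔ m = 0 := fun m => by cases m <;> simp [unary, List.replicate_succ]
  obtain ⟨g, hg, hgl⟩ := PTime.foldl_string δ hδ _ hc (.node (unary 0) .leaf)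
  refine ⟨fun x => ofList (g x).snd.toList.reverse, hg.snd_comp.reverse, fun l => ?_⟩
  have key : ∀ (l : List Γ') (x : ℕ × List Γ'), l.foldl (fun acc s => δ s acc)
      (.node (unary x.1) (stringTree x.2)) =
      .node (unary (l.foldl (fun x s => singleLabelStep s x) x).1)
        (stringTree (l.foldl (fun x s => singleLabelStep s x) x).2) := by
    intro l
    induction l with
    | nil => intro x; rfl
    | cons s l ih =>
      intro x
      rw [List.foldl_cons, List.foldl_cons, ← ih]
      congr 1
      cases s with
      | comma =>
        by_cases h : x.1 = 0
        · simp [δ, singleLabelStep, h, hu]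
        · simp [δ, singleLabelStep, h, hu, keep]
      | _ => simp [δ, singleLabelStep, keep]
  have h1 := key l (0, [])
  rw [stringTree_nil] at h1
  dsimp only
  rw [hgl, h1, snd_node, stringTree, toList_ofList, stringTree, List.map_reverse]

theorem singleLabelMap_computable (𝒞 : GraphClass) :
    Nonempty (Turing.TM2ComputableInPolyTime (ClusterEditingOn 𝒞).encode
      (EditingToTemporalCliquesOn 𝒞).encode (singleLabelMap 𝒞)) := by
  obtain ⟨g, hg, h⟩ := exists_ptime_singleLabel
  let ea : {I : ClusterEditingInstance // I.graph ∈ 𝒞 I.n} → List Γ' := fun I => I.1.encode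
  let eb : {J : ETCInstance // J.temporalGraph.underlying ∈ 𝒞 J.n} → List Γ' := fun J => J.1.encode
  refine hg.computable_strings (A := Γ') (B := Γ') (ea := ea) (eb := eb) (f := singleLabelMap 𝒞)
    fun I => ?_
  rw [h, List.foldl_reverse, foldr_singleLabelStep_encode]
  rfl

/-! ## Reading instances and certificates -/

namespace Turing.PolyTime

open BTree Computability

/-- A string of binary digits, as a tree. -/
def BTree.ofBits (l : List Bool) : BTree := ofList (l.map fun b => if b then node leaf leaf else leaf)

/-- A number in binary, as a tree. -/
def BTree.num (m : ℕ) : BTree := ofBits (encodeNat m)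

theorem BTree.val_ofBits_encodePosNum (p : PosNum) : (ofBits (encodePosNum p)).val = p := by
  induction p with
  | one => simp [ofBits, encodePosNum]
  | bit0 p ih =>
    rw [PosNum.cast_bit0, ← ih]
    simp [ofBits, encodePosNum, val]
    omega
  | bit1 p ih =>
    rw [PosNum.cast_bit1, ← ih]
    simp [ofBits, encodePosNum, val]
    omega

@[simp] theorem BTree.val_num (m : ℕ) : (num m).val = m := by
  have h : ∀ n : Num, (ofBits (encodeNum n)).val = n := by
    intro n
    cases n with
    | zero => rfl
    | pos p => exact val_ofBits_encodePosNum p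
  rw [num, encodeNat, h, Num.to_of_nat]

theorem BTree.size_ofBits_le (l : List Bool) : (ofBits l).size ≤ 4 * l.length + 1 := by
  induction l with
  | nil => simp [ofBits]
  | cons b l ih =>
    cases b <;> simp [ofBits] at ih ⊢ <;> omega

theorem length_encodeNat_le {m L : ℕ} (h : m < 2 ^ L) : (encodeNat m).length ≤ L := by
  have pos : ∀ (p : PosNum) (L : ℕ), (p : ℕ) < 2 ^ L → (encodePosNum p).length ≤ L := by
    intro p
    induction p with
    | one =>
      intro L hL
      cases L with
      | zero => simp at hL
      | succ L => simp [encodePosNum]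
    | bit0 p ih =>
      intro L hL
      rw [PosNum.cast_bit0] at hL
      cases L with
      | zero => have := PosNum.cast_pos (α := ℕ) p; simp at hL; omega
      | succ L =>
        have := ih L (by rw [pow_succ] at hL; omega)
        simpa [encodePosNum] using this
    | bit1 p ih =>
      intro L hL
      rw [PosNum.cast_bit1] at hL
      cases L with
      | zero => simp at hL
      | succ L =>
        have := ih L (by rw [pow_succ] at hL; omega)
        simpa [encodePosNum] using this
  have num : ∀ n : Num, (n : ℕ) < 2 ^ L → (encodeNum n).length ≤ L := by
    intro n hn
    cases n with
    | zero => simp [encodeNum]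
    | pos p => exact pos p L hn
  exact num m (by rwa [Num.to_of_nat])

theorem lt_two_pow_length_encodeNat (m : ℕ) : m < 2 ^ (encodeNat m).length := by
  have pos : ∀ p : PosNum, (p : ℕ) < 2 ^ (encodePosNum p).length := by
    intro p
    induction p with
    | one => simp [encodePosNum]
    | bit0 p ih => rw [PosNum.cast_bit0, encodePosNum, List.length_cons, pow_succ]; omega
    | bit1 p ih => rw [PosNum.cast_bit1, encodePosNum, List.length_cons, pow_succ]; omega
  have num : ∀ n : Num, (n : ℕ) < 2 ^ (encodeNum n).length := by
    intro n
    cases n with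
    | zero => simp [encodeNum]
    | pos p => exact pos p
  simpa [encodeNat] using num m

theorem BTree.size_num_le {m L : ℕ} (h : m < 2 ^ L) : (num m).size ≤ 4 * L + 1 :=
  (size_ofBits_le _).trans (by have := length_encodeNat_le h; omega)

/-- One step of reading an instance with a certificate, from the end of the string to its
beginning. The state consists of the list of numbers under construction, the list of blocks, and
the stack of trees of the certificate. -/
def parseStep : Γ' ⊕ Bool → BTree → BTree
  | .inl .blank, x => node (node (node leaf x.fst.fst) x.fst.snd) x.snd
  | .inl (.bit b), x => node (node (node (if b then node leaf leaf else leaf) x.fst.fst) x.fst.snd) x.snd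
  | .inl .comma, x => node (node leaf x.fst) x.snd
  | .inl .ket, x => node leaf x.snd
  | .inl .bra, x => node leaf (node (node x.fst x.snd.fst) x.snd.snd)
  | .inr false, x => node x.fst (node x.snd.fst (node leaf x.snd.snd))
  | .inr true, x => node x.fst (node x.snd.fst
      (node (node x.snd.snd.fst x.snd.snd.snd.fst) x.snd.snd.snd.snd))

/-- Prefix notation read backwards is evaluated with a stack: `false` pushes a leaf, and `true`
joins the two topmost trees. -/
theorem foldr_parseStep_bits (c : BTree) : ∀ x y z : BTree,
    (c.bits.map Sum.inr).foldr parseStep (node x (node y z)) = node x (node y (node c z)) := by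
  induction c with
  | leaf => intro x y z; rfl
  | node l r ihl ihr =>
    intro x y z
    simp only [bits, List.map_cons, List.map_append, List.foldr_cons, List.foldr_append]
    rw [ihr, ihl]
    rfl

theorem foldr_parseStep_bit (l : List Bool) (x y z : BTree) :
    ((l.map Γ'.bit).map Sum.inl).foldr parseStep (node (node x y) z) =
      node (node (ofList ((l.map fun b => if b then node leaf leaf else leaf) ++ x.toList)) y) z := by
  induction l with
  | nil => simp
  | cons b l ih => simp only [List.map_cons, List.foldr_cons, ih]; simp [parseStep]

theorem foldr_parseStep_number (m : ℕ) (x y : BTree) :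
    ((encodeNumber m).map Sum.inl).foldr parseStep (node x y) = node (node (num m) x) y := by
  rw [encodeNumber, List.map_append, List.foldr_append]
  simp only [List.map_cons, List.map_nil, List.foldr_cons, List.foldr_nil, parseStep, fst_node,
    snd_node, foldr_parseStep_bit]
  simp [num, ofBits]

theorem foldr_parseStep_unary (n : ℕ) (x y : BTree) :
    ((encodeUnary n).map Sum.inl).foldr parseStep (node x y) = node (node (unary n) x) y := by
  have key : ∀ n : ℕ, ((List.replicate n Γ'.blank).map Sum.inl).foldr parseStep
      (node (node leaf x) y) = node (node (unary n) x) y := by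
    intro n
    induction n with
    | zero => rfl
    | succ n ih => simp only [List.replicate_succ, List.map_cons, List.foldr_cons, ih]; rfl
  rw [encodeUnary, List.map_append, List.foldr_append]
  exact key n

theorem foldr_parseStep_block (l : List ℕ) (x y z : BTree) :
    ((encodeBlock l).map Sum.inl).foldr parseStep (node x (node y z)) =
      node leaf (node (node (ofList (l.map num)) y) z) := by
  have key : ((l.flatMap encodeNumber).map Sum.inl).foldr parseStep (node leaf (node y z)) =
      node (ofList (l.map num)) (node y z) := by
    induction l with
    | nil => rfl
    | cons m l ih =>
      rw [List.flatMap_cons, List.map_append, List.foldr_append, ih, foldr_parseStep_number]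
      rfl
  rw [encodeBlock, List.map_cons, List.map_append, List.foldr_cons, List.foldr_append]
  simp only [List.map_cons, List.map_nil, List.foldr_cons, List.foldr_nil]
  rw [parseStep, snd_node, key]
  rfl

theorem foldr_parseStep_blocks (l : List (List ℕ)) (y : BTree) :
    ((l.flatMap encodeBlock).map Sum.inl).foldr parseStep (node leaf (node leaf y)) =
      node leaf (node (ofList (l.map fun b => ofList (b.map num))) y) := by
  induction l with
  | nil => rfl
  | cons b l ih =>
    rw [List.flatMap_cons, List.map_append, List.foldr_append, ih, foldr_parseStep_block]
    rfl

/-- The blocks of the encoding of a temporal graph. -/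
noncomputable def _root_.ETCInstance.blocks (I : ETCInstance) : List (List ℕ) :=
  (edgeList I.temporalGraph.underlying).map fun p =>
    (p.1 : ℕ) :: (p.2 : ℕ) :: (I.temporalGraph.label s(p.1, p.2)).sort (· ≤ ·)

/-- A certificate string that is not the string of a tree still leaves some stack `y` and cannot
disturb the instance part. Nothing more about it is needed, as any data that pass the check prove a
yes-instance. -/
theorem foldr_parseStep_encode (I : ETCInstance) (w : List Bool) :
    ∃ y, (I.encode.map Sum.inl ++ w.map Sum.inr).foldr parseStep (node leaf (node leaf leaf)) =
      node (ofList [unary I.n, num I.k, num I.Δ₁, num I.Δ₂])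
        (node (ofList (I.blocks.map fun b => ofList (b.map num))) y) ∧
      ∀ c : BTree, w = c.bits → y = node c leaf := by
  have h1 : ∀ w : List Bool, ∃ y, (w.map Sum.inr).foldr parseStep (node leaf (node leaf leaf)) =
      node leaf (node leaf y) := by
    intro w
    induction w with
    | nil => exact ⟨_, rfl⟩
    | cons b w ih =>
      obtain ⟨y, hy⟩ := ih
      rw [List.map_cons, List.foldr_cons, hy]
      cases b <;> exact ⟨_, rfl⟩
  obtain ⟨y, hy⟩ := h1 w
  refine ⟨y, ?_, ?_⟩
  · rw [List.foldr_append, hy, ETCInstance.encode]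
    simp only [List.map_append, List.foldr_append]
    have h2 := foldr_parseStep_blocks I.blocks y
    rw [ETCInstance.blocks] at h2
    rw [h2, foldr_parseStep_number, foldr_parseStep_number, foldr_parseStep_number,
      foldr_parseStep_unary]
    rfl
  · rintro c rfl
    rw [foldr_parseStep_bits] at hy
    simpa using hy.symm

theorem exists_ptime_parse : ∃ g, PTime g ∧ ∀ l : List (Γ' ⊕ Bool),
    g (stringTree l.reverse) = l.foldr parseStep (node leaf (node leaf leaf)) := by
  have hp : ∀ s, PTime (parseStep s) := by
    intro s
    rcases s with (_ | b | _ | _ | _) | (_ | _)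
    · exact ((PTime.leaf.node PTime.fst.fst_comp).node PTime.fst.snd_comp).node .snd
    · exact (((PTime.const _).node PTime.fst.fst_comp).node PTime.fst.snd_comp).node .snd
    · exact PTime.leaf.node ((PTime.fst.node PTime.snd.fst_comp).node PTime.snd.snd_comp)
    · exact PTime.leaf.node .snd
    · exact (PTime.leaf.node .fst).node .snd
    · exact PTime.fst.node (PTime.snd.fst_comp.node (PTime.leaf.node PTime.snd.snd_comp))
    · exact PTime.fst.node (PTime.snd.fst_comp.node ((PTime.snd.snd_comp.fst_comp.node
        PTime.snd.snd_comp.snd_comp.fst_comp).node PTime.snd.snd_comp.snd_comp.snd_comp))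
  have hx : ∀ x : BTree, x.fst.size + x.snd.size ≤ x.size + 1 := by
    intro x
    cases x
    · simp
    · simp only [fst_node, snd_node, size_node]; omega
  have hc : ∀ s x, (parseStep s x).size ≤ x.size + 20 := by
    intro s x
    have h1 := hx x
    have h2 := hx x.fst
    have h3 := hx x.snd
    have h4 := hx x.snd.snd
    have h5 := hx x.snd.snd.snd
    have h6 := x.size_snd_le
    rcases s with (_ | (_ | _) | _ | _ | _) | (_ | _)
    all_goals simp [parseStep]
    all_goals omega
  obtain ⟨g, hg, h⟩ := PTime.foldl_string parseStep hp 20 hc (node leaf (node leaf leaf))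
  exact ⟨g, hg, fun l => by rw [h, List.foldl_reverse]⟩

end Turing.PolyTime

/-! ## Certificates for Editing to Temporal Cliques -/

/-- `H` is the list of time-edges of a cluster temporal graph, `E` a list of edits that leads to it
from the time-edges in `B`, and `T` a collection of templates. An entry of `B` is an edge and the
list of its times, an entry of `T` consists of the ends of the interval and the list of vertices. -/
structure Certifies (n k Δ₁ Δ₂ : ℕ) (B : List (ℕ × ℕ × List ℕ)) (H E : List (ℕ × ℕ × ℕ))
    (T : List (ℕ × ℕ × List ℕ)) : Prop where
  valid : ∀ e ∈ H, e.1 < e.2.1 ∧ e.2.1 < n ∧ 0 < e.2.2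
  length_le : E.length ≤ k
  mem_of_mem : ∀ e ∈ H, (∃ b ∈ B, b.1 = e.1 ∧ b.2.1 = e.2.1 ∧ ∃ t ∈ b.2.2, t = e.2.2) ∨
    ∃ e' ∈ E, e'.1 = e.1 ∧ e'.2.1 = e.2.1 ∧ e'.2.2 = e.2.2
  mem_or_mem : ∀ b ∈ B, ∀ t ∈ b.2.2, (∃ e ∈ H, e.1 = b.1 ∧ e.2.1 = b.2.1 ∧ e.2.2 = t) ∨
    ∃ e ∈ E, e.1 = b.1 ∧ e.2.1 = b.2.1 ∧ e.2.2 = t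
  cover : ∀ e ∈ H, ∃ C ∈ T, (∃ x ∈ C.2.2, x = e.1) ∧ (∃ x ∈ C.2.2, x = e.2.1) ∧
    C.1 ≤ e.2.2 ∧ e.2.2 ≤ C.2.1
  times : ∀ C ∈ T, 0 < C.1 ∧ C.1 ≤ C.2.1 ∧ ∃ e ∈ H, C.2.1 ≤ e.2.2
  independent : ∀ C ∈ T, ∀ D ∈ T,
    (C.1 = D.1 ∧ C.2.1 = D.2.1 ∧ (∀ x ∈ C.2.2, ∃ y ∈ D.2.2, x = y) ∧ ∀ y ∈ D.2.2, ∃ x ∈ C.2.2, x = y) ∨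
    (∀ x ∈ C.2.2, ∀ y ∈ D.2.2, ¬x = y) ∨ C.2.1 + Δ₂ ≤ D.1 ∨ D.2.1 + Δ₂ ≤ C.1
  -- There may be exponentially many windows, so only those that matter are inspected: the first
  -- one, and for each occurrence at time t the one starting at t + 1, provided that t + 1 is an
  -- admissible start.
  dense : ∀ C ∈ T, ∀ x ∈ C.2.2, ∀ y ∈ C.2.2, x < y →
    (∃ e ∈ H, e.1 = x ∧ e.2.1 = y ∧ C.1 ≤ e.2.2 ∧ e.2.2 < C.1 + Δ₁) ∧
    ∀ e ∈ H, e.1 = x → e.2.1 = y → C.1 ≤ e.2.2 + 1 → e.2.2 + Δ₁ ≤ C.2.1 →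
      ∃ e' ∈ H, e'.1 = x ∧ e'.2.1 = y ∧ e.2.2 < e'.2.2 ∧ e'.2.2 ≤ e.2.2 + Δ₁

namespace Turing.PolyTime

open BTree

/-- A tree, as a list of triples of numbers. -/
noncomputable def BTree.toTriples (x : BTree) : List (ℕ × ℕ × ℕ) :=
  x.toList.map fun e => (e.fst.val, e.snd.fst.val, e.snd.snd.val)

/-- A tree, as a list of pairs of numbers with a list of numbers. -/
noncomputable def BTree.toBlocks (x : BTree) : List (ℕ × ℕ × List ℕ) :=
  x.toList.map fun e => (e.fst.val, e.snd.fst.val, e.snd.snd.toList.map val)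

/-- Triples of numbers, as a tree. -/
def BTree.ofTriples (l : List (ℕ × ℕ × ℕ)) : BTree :=
  ofList (l.map fun e => node (num e.1) (node (num e.2.1) (num e.2.2)))

/-- Pairs of numbers with lists of numbers, as a tree. -/
def BTree.ofBlocks (l : List (ℕ × ℕ × List ℕ)) : BTree :=
  ofList (l.map fun e => node (num e.1) (node (num e.2.1) (ofList (e.2.2.map num))))

@[simp] theorem BTree.toTriples_ofTriples (l : List (ℕ × ℕ × ℕ)) : (ofTriples l).toTriples = l := by
  simp [toTriples, ofTriples, Function.comp_def]

@[simp] theorem BTree.toBlocks_ofBlocks (l : List (ℕ × ℕ × List ℕ)) :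
    (ofBlocks l).toBlocks = l := by
  simp [toBlocks, ofBlocks, Function.comp_def]

theorem PPred.add_le {f g h : BTree → BTree} (hf : PTime f) (hg : PTime g) (hh : PTime h) :
    PPred fun x => (f x).val + (g x).val ≤ (h x).val :=
  (add_le_add hf hg hh .leaf).congr fun x => by simp

theorem PPred.le_add {f g h : BTree → BTree} (hf : PTime f) (hg : PTime g) (hh : PTime h) :
    PPred fun x => (f x).val ≤ (g x).val + (h x).val :=
  (add_le_add hf .leaf hg hh).congr fun x => by simp

theorem PPred.lt_add {f g h : BTree → BTree} (hf : PTime f) (hg : PTime g) (hh : PTime h) :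
    PPred fun x => (f x).val < (g x).val + (h x).val :=
  (add_le_add hg hh hf .leaf).not.congr fun x => by simp

theorem PPred.le_succ {f g : BTree → BTree} (hf : PTime f) (hg : PTime g) :
    PPred fun x => (f x).val ≤ (g x).val + 1 :=
  (add_le_add hf .leaf hg (.const (.node (.node .leaf .leaf) .leaf))).congr fun x => by simp

theorem PPred.val_pos {f : BTree → BTree} (hf : PTime f) : PPred fun x => 0 < (f x).val :=
  (val_lt .leaf hf).congr fun x => by simp

-- Every quantifier ranges over a list within the data, and every atomic formula compares sums of
-- binary numbers, so the closure rules of `PPred` suffice. The vertex count is unary and enters as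
-- the binary length of a list.
set_option maxHeartbeats 2000000 in
theorem PPred.certifies {n k d D B H E T : BTree → BTree} (hn : PTime n) (hk : PTime k)
    (hd : PTime d) (hD : PTime D) (hB : PTime B) (hH : PTime H) (hE : PTime E) (hT : PTime T) :
    PPred fun y => Certifies (n y).toList.length (k y).val (d y).val (D y).val (B y).toBlocks
      (H y).toTriples (E y).toTriples (T y).toBlocks := by
  have hn' := hn.len
  have h : PPred fun y =>
      (∀ e ∈ (H y).toList, e.fst.val < e.snd.fst.val ∧ e.snd.fst.val < (n y).len.val ∧
      0 < e.snd.snd.val) ∧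
      (E y).len.val ≤ (k y).val ∧
      (∀ e ∈ (H y).toList, (∃ b ∈ (B y).toList, b.fst.val = e.fst.val ∧
      b.snd.fst.val = e.snd.fst.val ∧ ∃ t ∈ b.snd.snd.toList, t.val = e.snd.snd.val) ∨
      ∃ e' ∈ (E y).toList, e'.fst.val = e.fst.val ∧ e'.snd.fst.val = e.snd.fst.val ∧
        e'.snd.snd.val = e.snd.snd.val) ∧
      (∀ b ∈ (B y).toList, ∀ t ∈ b.snd.snd.toList,
      (∃ e ∈ (H y).toList, e.fst.val = b.fst.val ∧ e.snd.fst.val = b.snd.fst.val ∧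
        e.snd.snd.val = t.val) ∨
      ∃ e ∈ (E y).toList, e.fst.val = b.fst.val ∧ e.snd.fst.val = b.snd.fst.val ∧
        e.snd.snd.val = t.val) ∧
      (∀ e ∈ (H y).toList, ∃ C ∈ (T y).toList,
      (∃ x ∈ C.snd.snd.toList, x.val = e.fst.val) ∧
      (∃ x ∈ C.snd.snd.toList, x.val = e.snd.fst.val) ∧
      C.fst.val ≤ e.snd.snd.val ∧ e.snd.snd.val ≤ C.snd.fst.val) ∧
      (∀ C ∈ (T y).toList, 0 < C.fst.val ∧ C.fst.val ≤ C.snd.fst.val ∧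
      ∃ e ∈ (H y).toList, C.snd.fst.val ≤ e.snd.snd.val) ∧
      (∀ C ∈ (T y).toList, ∀ C' ∈ (T y).toList,
      (C.fst.val = C'.fst.val ∧ C.snd.fst.val = C'.snd.fst.val ∧
        (∀ u ∈ C.snd.snd.toList, ∃ v ∈ C'.snd.snd.toList, u.val = v.val) ∧
        ∀ v ∈ C'.snd.snd.toList, ∃ u ∈ C.snd.snd.toList, u.val = v.val) ∨
      (∀ u ∈ C.snd.snd.toList, ∀ v ∈ C'.snd.snd.toList, ¬u.val = v.val) ∨
      C.snd.fst.val + (D y).val ≤ C'.fst.val ∨ C'.snd.fst.val + (D y).val ≤ C.fst.val) ∧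
      (∀ C ∈ (T y).toList, ∀ u ∈ C.snd.snd.toList, ∀ v ∈ C.snd.snd.toList,
      u.val < v.val →
      (∃ e ∈ (H y).toList, e.fst.val = u.val ∧ e.snd.fst.val = v.val ∧
        C.fst.val ≤ e.snd.snd.val ∧ e.snd.snd.val < C.fst.val + (d y).val) ∧
      ∀ e ∈ (H y).toList, e.fst.val = u.val → e.snd.fst.val = v.val →
        C.fst.val ≤ e.snd.snd.val + 1 → e.snd.snd.val + (d y).val ≤ C.snd.fst.val →
        ∃ e' ∈ (H y).toList, e'.fst.val = u.val ∧ e'.snd.fst.val = v.val ∧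
          e.snd.snd.val < e'.snd.snd.val ∧ e'.snd.snd.val ≤ e.snd.snd.val + (d y).val) := by
    repeat' first
      | apply forall_mem | apply exists_mem | apply PPred.and | apply PPred.or | apply PPred.not
      | apply PPred.imp | apply val_pos | apply val_lt | apply lt_add | apply le_succ
      | apply add_le | apply le_add | apply val_le | apply PPred.val_eq
      | exact PTime.fst | exact PTime.snd | exact PTime.id | exact hE.len
      | apply PTime.comp hH | apply PTime.comp hB | apply PTime.comp hE | apply PTime.comp hT
      | apply PTime.comp hd | apply PTime.comp hD | apply PTime.comp hn' | apply PTime.comp hk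
      | apply PTime.fst_comp | apply PTime.snd_comp
  refine h.congr fun y => ?_
  have key : ∀ {n k d D B H E T}, Certifies n k d D B H E T ↔ _ ∧ _ ∧ _ ∧ _ ∧ _ ∧ _ ∧ _ ∧ _ :=
    ⟨fun ⟨h1, h2, h3, h4, h5, h6, h7, h8⟩ => ⟨h1, h2, h3, h4, h5, h6, h7, h8⟩,
      fun ⟨h1, h2, h3, h4, h5, h6, h7, h8⟩ => ⟨h1, h2, h3, h4, h5, h6, h7, h8⟩⟩
  have ex : ∀ {α β : Type} (f : α → β) (l : List α) (P : β → Prop),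
      (∃ b ∈ l.map f, P b) ↔ ∃ a ∈ l, P (f a) := by simp
  rw [key]
  simp only [toTriples, toBlocks, List.forall_mem_map, ex, List.length_map, val_len]

end Turing.PolyTime

/-! ## The verifier -/

/-- The edges of a temporal graph, each one with the list of its times. -/
noncomputable def ETCInstance.timedEdges (I : ETCInstance) : List (ℕ × ℕ × List ℕ) :=
  (edgeList I.temporalGraph.underlying).map fun p =>
    ((p.1 : ℕ), (p.2 : ℕ), (I.temporalGraph.label s(p.1, p.2)).sort (· ≤ ·))

namespace Turing.PolyTime

open BTree Computability

/-- The string of a certificate. -/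
def certificate (H E : List (ℕ × ℕ × ℕ)) (T : List (ℕ × ℕ × List ℕ)) : List Bool :=
  (node (ofTriples H) (node (ofTriples E) (ofBlocks T))).bits

@[simp] theorem BTree.toList_unary_length (n : ℕ) : (unary n).toList.length = n := by
  cases n <;> simp [unary]

theorem exists_verifier (𝒞 : GraphClass) :
    ∃ verify : (EditingToTemporalCliquesOn 𝒞).Instance × List Bool → Bool,
      Nonempty (TM2ComputableInPolyTime (EditingToTemporalCliquesOn 𝒞).encodeWithCertificate
        encodeBool verify) ∧
      ∀ I : {I : ETCInstance // I.temporalGraph.underlying ∈ 𝒞 I.n},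
        (∀ w, verify (I, w) = true → ∃ H E T,
          Certifies I.1.n I.1.k I.1.Δ₁ I.1.Δ₂ I.1.timedEdges H E T) ∧
        ∀ H E T, Certifies I.1.n I.1.k I.1.Δ₁ I.1.Δ₂ I.1.timedEdges H E T →
          verify (I, certificate H E T) = true := by
  classical
  obtain ⟨g, hg, h⟩ := exists_ptime_parse
  let P : BTree → Prop := fun y => Certifies y.fst.fst.toList.length y.fst.snd.fst.val
    y.fst.snd.snd.fst.val y.fst.snd.snd.snd.fst.val y.snd.fst.toBlocks
    y.snd.snd.fst.fst.toTriples y.snd.snd.fst.snd.fst.toTriples y.snd.snd.fst.snd.snd.toBlocks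
  have hP : PPred P := by
    apply PPred.certifies
    all_goals repeat' first | exact PTime.fst | exact PTime.snd | apply PTime.fst_comp | apply PTime.snd_comp
  have hB : ∀ I : ETCInstance, (ofList (I.blocks.map fun b => ofList (b.map num))).toBlocks =
      I.timedEdges := by
    intro I
    rw [ETCInstance.blocks, ETCInstance.timedEdges, ← toBlocks_ofBlocks (List.map _ _), ofBlocks,
      List.map_map, List.map_map]
    rfl
  let ea : {I : ETCInstance // I.temporalGraph.underlying ∈ 𝒞 I.n} × List Bool → List (Γ' ⊕ Bool) :=
    fun x => x.1.1.encode.map Sum.inl ++ x.2.map Sum.inr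
  let f : {I : ETCInstance // I.temporalGraph.underlying ∈ 𝒞 I.n} × List Bool → Bool :=
    fun x => decide (P (g (stringTree (ea x).reverse)))
  have hgP : PTime fun x => if P (g x) then stringTree [true] else stringTree [false] :=
    PTime.ite (hP.comp hg) (.const _) (.const _)
  refine ⟨f, hgP.computable_strings (ea := ea) (eb := encodeBool) (f := f) fun x => ?_, ?_⟩
  · by_cases hx : P (g (stringTree (ea x).reverse)) <;> simp [f, hx, encodeBool]
  intro I
  have key : ∀ w : List Bool, ∃ y, (f (I, w) = true ↔ Certifies I.1.n I.1.k I.1.Δ₁ I.1.Δ₂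
      I.1.timedEdges y.fst.fst.toTriples y.fst.snd.fst.toTriples y.fst.snd.snd.toBlocks) ∧
      ∀ c : BTree, w = c.bits → y = node c leaf := by
    intro w
    obtain ⟨y, h1, h2⟩ := foldr_parseStep_encode I.1 w
    refine ⟨y, ?_, h2⟩
    simp only [f, P, ea, decide_eq_true_eq, h, h1, fst_node, snd_node, ofList_cons,
      toList_unary_length, val_num, hB]
  refine ⟨fun w hw => ?_, fun H E T hc => ?_⟩
  · obtain ⟨y, h1, -⟩ := key w
    exact ⟨_, _, _, h1.1 hw⟩
  · obtain ⟨y, h1, h2⟩ := key (certificate H E T)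
    rw [h2 _ rfl] at h1
    exact h1.2 (by simpa using hc)

end Turing.PolyTime

/-! ## Certified instances are yes-instances -/

namespace TemporalGraph

variable {V : Type*}

open Classical in
/-- The temporal graph with a given finite set of time-edges. -/
noncomputable def ofTimeEdges (S : Finset (Sym2 V × ℕ)) (h : ∀ p ∈ S, ¬p.1.IsDiag ∧ 0 < p.2) :
    TemporalGraph V where
  underlying := SimpleGraph.fromEdgeSet {e | ∃ t, (e, t) ∈ S}
  label e := (S.filter fun p => p.1 = e).image Prod.snd
  label_pos e t ht := by
    obtain ⟨p, hp, rfl⟩ := Finset.mem_image.1 ht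
    exact (h p (Finset.mem_filter.1 hp).1).2
  label_nonempty_iff e := by
    rw [SimpleGraph.edgeSet_fromEdgeSet, Finset.image_nonempty, Set.mem_sdiff]
    constructor
    · rintro ⟨p, hp⟩
      obtain ⟨hS, rfl⟩ := Finset.mem_filter.1 hp
      exact ⟨⟨p.2, hS⟩, (h p hS).1⟩
    · rintro ⟨⟨t, ht⟩, -⟩
      exact ⟨(e, t), by simpa using ht⟩

@[simp] theorem timeEdges_ofTimeEdges (S : Finset (Sym2 V × ℕ)) (h) :
    (ofTimeEdges S h).timeEdges = S := by
  ext ⟨e, t⟩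
  simp [timeEdges, ofTimeEdges]

theorem mem_label {𝒢 : TemporalGraph V} {e : Sym2 V} {t : ℕ} :
    t ∈ 𝒢.label e ↔ (e, t) ∈ 𝒢.timeEdges := Iff.rfl

theorem ne_of_mem_label {𝒢 : TemporalGraph V} {u v : V} {t : ℕ} (h : t ∈ 𝒢.label s(u, v)) :
    u ≠ v :=
  ((SimpleGraph.mem_edgeSet _).1 ((𝒢.label_nonempty_iff _).1 ⟨t, h⟩)).ne

theorem bddAbove_times [Finite V] (𝒢 : TemporalGraph V) : BddAbove {t | ∃ e, t ∈ 𝒢.label e} := by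
  have := Fintype.ofFinite (Sym2 V)
  have h : {t | ∃ e, t ∈ 𝒢.label e} = ⋃ e, (𝒢.label e : Set ℕ) := by ext; simp
  rw [h]
  exact (Set.finite_iUnion fun e => (𝒢.label e).finite_toSet).bddAbove

theorem le_lifetime [Finite V] {𝒢 : TemporalGraph V} {e : Sym2 V} {t : ℕ} (h : t ∈ 𝒢.label e) :
    t ≤ 𝒢.lifetime :=
  le_csSup 𝒢.bddAbove_times ⟨e, h⟩

end TemporalGraph

theorem ETCInstance.exists_mem_timedEdges {I : ETCInstance} {u v : Fin I.n} {t : ℕ} (h : u < v) :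
    (∃ b ∈ I.timedEdges, b.1 = u ∧ b.2.1 = v ∧ ∃ t' ∈ b.2.2, t' = t) ↔
      t ∈ I.temporalGraph.label s(u, v) := by
  simp only [timedEdges, List.mem_map, exists_exists_and_eq_and, exists_eq_right]
  constructor
  · rintro ⟨p, -, h1, h2, h3⟩
    rw [← Fin.ext h1, ← Fin.ext h2]
    simpa using h3
  · intro ht
    refine ⟨(u, v), mem_edgeList.2 ⟨h, ?_⟩, rfl, rfl, by simpa using ht⟩
    exact (SimpleGraph.mem_edgeSet _).1 ((I.temporalGraph.label_nonempty_iff _).1 ⟨t, ht⟩)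

open Classical in
/-- The time-edges described by a list of triples. -/
noncomputable def timeEdgesOfTriples (n : ℕ) (H : List (ℕ × ℕ × ℕ)) :
    Finset (Sym2 (Fin n) × ℕ) :=
  (H.filterMap fun e => if h : e.1 < n ∧ e.2.1 < n ∧ e.1 < e.2.1 then
    some (s(⟨e.1, h.1⟩, ⟨e.2.1, h.2.1⟩), e.2.2) else none).toFinset

theorem card_timeEdgesOfTriples_le (n : ℕ) (H : List (ℕ × ℕ × ℕ)) :
    (timeEdgesOfTriples n H).card ≤ H.length :=
  (List.toFinset_card_le _).trans (List.length_filterMap_le _ _)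

theorem mem_timeEdgesOfTriples {n : ℕ} {H : List (ℕ × ℕ × ℕ)} {u v : Fin n} {t : ℕ} (h : u < v) :
    (s(u, v), t) ∈ timeEdgesOfTriples n H ↔ ∃ e ∈ H, e.1 = u ∧ e.2.1 = v ∧ e.2.2 = t := by
  simp only [timeEdgesOfTriples, List.mem_toFinset, List.mem_filterMap]
  constructor
  · rintro ⟨e, he, heq⟩
    split_ifs at heq with hc
    simp only [Option.some.injEq, Prod.mk.injEq, Sym2.eq_iff] at heq
    obtain ⟨⟨rfl, rfl⟩ | ⟨rfl, rfl⟩, rfl⟩ := heq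
    · exact ⟨e, he, rfl, rfl, rfl⟩
    · exact absurd h (by simpa using hc.2.2.le)
  · rintro ⟨e, he, h1, h2, rfl⟩
    refine ⟨e, he, ?_⟩
    have hc : e.1 < n ∧ e.2.1 < n ∧ e.1 < e.2.1 := by
      rw [h1, h2]; exact ⟨u.2, v.2, h⟩
    rw [dif_pos hc]
    simp [h1, h2]

theorem not_isDiag_of_mem_timeEdgesOfTriples {n : ℕ} {H : List (ℕ × ℕ × ℕ)}
    {p : Sym2 (Fin n) × ℕ} (h : p ∈ timeEdgesOfTriples n H) :
    ¬p.1.IsDiag ∧ ∃ e ∈ H, e.2.2 = p.2 := by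
  simp only [timeEdgesOfTriples, List.mem_toFinset, List.mem_filterMap] at h
  obtain ⟨e, he, heq⟩ := h
  split_ifs at heq with hc
  cases heq
  refine ⟨?_, e, he, rfl⟩
  simpa using hc.2.2.ne

/-- `H` defines the edited temporal graph, outside `E` it agrees with the given one, and the entries
of `T`, restricted to actual vertices, are its templates. -/
theorem Certifies.isYes {I : ETCInstance} {H E : List (ℕ × ℕ × ℕ)} {T : List (ℕ × ℕ × List ℕ)}
    (h : Certifies I.n I.k I.Δ₁ I.Δ₂ I.timedEdges H E T) : I.IsYes := by
  classical
  have hS : ∀ p ∈ timeEdgesOfTriples I.n H, ¬p.1.IsDiag ∧ 0 < p.2 := by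
    intro p hp
    obtain ⟨h1, e, he, h2⟩ := not_isDiag_of_mem_timeEdgesOfTriples hp
    exact ⟨h1, h2 ▸ (h.valid e he).2.2⟩
  let ℋ := TemporalGraph.ofTimeEdges _ hS
  have mem : ∀ {u v : Fin I.n} {t : ℕ}, u < v →
      (t ∈ ℋ.label s(u, v) ↔ ∃ e ∈ H, e.1 = u ∧ e.2.1 = v ∧ e.2.2 = t) := by
    intro u v t huv
    rw [TemporalGraph.mem_label, TemporalGraph.timeEdges_ofTimeEdges, Finset.mem_coe,
      mem_timeEdgesOfTriples huv]
  have edits : ∀ p, p ∉ timeEdgesOfTriples I.n E →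
      (p ∈ ℋ.timeEdges ↔ p ∈ I.temporalGraph.timeEdges) := by
    have key : ∀ (u v : Fin I.n) (t : ℕ), u < v → (s(u, v), t) ∉ timeEdgesOfTriples I.n E →
        (t ∈ ℋ.label s(u, v) ↔ t ∈ I.temporalGraph.label s(u, v)) := by
      intro u v t huv hE
      rw [mem_timeEdgesOfTriples huv] at hE
      rw [mem huv, ← ETCInstance.exists_mem_timedEdges huv]
      constructor
      · rintro ⟨e, he, h1, h2, h3⟩
        have := h.mem_of_mem e he
        rw [h1, h2, h3] at this
        exact this.resolve_right hE
      · rintro ⟨b, hb, h1, h2, t', ht', rfl⟩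
        have := h.mem_or_mem b hb t' ht'
        rw [h1, h2] at this
        exact this.resolve_right hE
    rintro ⟨e, t⟩
    induction e with
    | _ u v =>
      intro hE
      rcases lt_trichotomy u v with huv | rfl | huv
      · exact key u v t huv hE
      · exact iff_of_false (fun hc => TemporalGraph.ne_of_mem_label (𝒢 := ℋ) hc rfl)
          (fun hc => TemporalGraph.ne_of_mem_label (𝒢 := I.temporalGraph) hc rfl)
      · rw [Sym2.eq_swap] at hE ⊢
        exact key v u t huv hE
  -- `E` may contain time-edges that do not change; only those on which the two graphs differ are
  -- edits.
  refine ⟨(timeEdgesOfTriples I.n E).filter fun p =>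
    ¬(p ∈ ℋ.timeEdges ↔ p ∈ I.temporalGraph.timeEdges), ?_, ℋ, ?_, ?_⟩
  · exact (Finset.card_filter_le _ _).trans ((card_timeEdgesOfTriples_le _ _).trans h.length_le)
  · ext p
    have := edits p
    simp only [Set.mem_symmDiff, Finset.coe_filter, Set.mem_ofPred_eq]
    tauto
  refine ⟨{C | ∃ D ∈ T, C.first = D.1 ∧ C.last = D.2.1 ∧ ∀ x, x ∈ C.verts ↔ (x : ℕ) ∈ D.2.2},
    ?_, ?_, ?_, ?_⟩
  · rintro C ⟨C', hC', hC1, hC2, hC3⟩ D ⟨D', hD', hD1, hD2, hD3⟩ hne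
    have := h.independent C' hC' D' hD'
    simp only [← hC1, ← hC2, ← hD1, ← hD2, exists_eq_right', exists_eq_right] at this
    -- In the first alternative the entries have the same ends and the same vertices, so they
    -- describe one template, against `hne`.
    rcases this with ⟨h1, h2, h3, h4⟩ | h1 | h1 | h1
    · refine absurd ?_ hne
      have h5 : C.verts = D.verts := by
        ext x
        rw [hC3, hD3]
        exact ⟨h3 x, h4 x⟩
      cases C; cases D
      cases h1; cases h2; cases h5
      rfl
    · left
      rw [Finset.disjoint_left]
      intro x hx hx'
      exact h1 x ((hC3 x).1 hx) x ((hD3 x).1 hx') rfl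
    · right
      rintro s ⟨hs1, hs2⟩ t ⟨ht1, ht2⟩
      rw [abs_sub_comm]
      exact le_trans (by omega) (le_abs_self _)
    · right
      rintro s ⟨hs1, hs2⟩ t ⟨ht1, ht2⟩
      exact le_trans (by omega) (le_abs_self _)
  · rintro C ⟨D, hD, h1, h2, -⟩
    obtain ⟨h3, h4, e, he, h5⟩ := h.times D hD
    rw [h1, h2]
    refine ⟨h3, h5.trans ?_⟩
    obtain ⟨h6, h7, h8⟩ := h.valid e he
    exact TemporalGraph.le_lifetime (𝒢 := ℋ) (e := s(⟨e.1, h6.trans h7⟩, ⟨e.2.1, h7⟩))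
      ((mem (by exact h6)).2 ⟨e, he, rfl, rfl, rfl⟩)
  · have key : ∀ (u v : Fin I.n) (t : ℕ), u < v → t ∈ ℋ.label s(u, v) → ∃ D ∈ T,
        (u : ℕ) ∈ D.2.2 ∧ (v : ℕ) ∈ D.2.2 ∧ D.1 ≤ t ∧ t ≤ D.2.1 := by
      intro u v t huv ht
      obtain ⟨e, he, h1, h2, h3⟩ := (mem huv).1 ht
      have := h.cover e he
      simpa [h1, h2, h3] using this
    have key' : ∀ (u v : Fin I.n) (t : ℕ), t ∈ ℋ.label s(u, v) → ∃ D ∈ T,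
        (u : ℕ) ∈ D.2.2 ∧ (v : ℕ) ∈ D.2.2 ∧ D.1 ≤ t ∧ t ≤ D.2.1 := by
      intro u v t ht
      rcases (TemporalGraph.ne_of_mem_label ht).lt_or_gt with huv | huv
      · exact key u v t huv ht
      · rw [Sym2.eq_swap] at ht
        obtain ⟨D, h1, h2, h3, h4⟩ := key v u t huv ht
        exact ⟨D, h1, h3, h2, h4⟩
    rintro ⟨e, t⟩ ht
    induction e with
    | _ u v =>
      obtain ⟨D, hD, hu, hv, h1, h2⟩ := key' u v t ht
      refine ⟨⟨Finset.univ.filter fun x => (x : ℕ) ∈ D.2.2, D.1, D.2.1, h1.trans h2⟩,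
        ⟨D, hD, rfl, rfl, by simp⟩, ?_, h1, h2⟩
      simp [hu, hv]
  · have key : ∀ D ∈ T, ∀ u v : Fin I.n, (u : ℕ) ∈ D.2.2 → (v : ℕ) ∈ D.2.2 → u < v →
        ℋ.IsDense I.Δ₁ s(u, v) D.1 D.2.1 := by
      rintro D hD u v hu hv huv τ ⟨h1, h2⟩
      obtain ⟨h3, h4⟩ := h.dense D hD u hu v hv huv
      -- A witness for the window at `τ` also serves the window at `τ + 1`, unless it is `τ` itself;
      -- then the next listed occurrence takes over.
      induction τ, h1 using Nat.le_induction with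
      | base =>
        obtain ⟨e, he, h5, h6, h7, h8⟩ := h3
        exact ⟨e.2.2, (mem huv).2 ⟨e, he, h5, h6, rfl⟩, h7, h8⟩
      | succ τ hτ ih =>
        obtain ⟨t, ht, h5, h6⟩ := ih (by omega)
        rcases h5.lt_or_eq with h5 | rfl
        · exact ⟨t, ht, h5, by omega⟩
        obtain ⟨e, he, h7, h8, rfl⟩ := (mem huv).1 ht
        obtain ⟨e', he', h9, h10, h11, h12⟩ := h4 e he h7 h8 (by omega) (by omega)
        exact ⟨e'.2.2, (mem huv).2 ⟨e', he', h9, h10, rfl⟩, h11, by omega⟩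
    rintro C ⟨D, hD, h1, h2, h3⟩ u hu v hv huv
    rw [h1, h2]
    rcases huv.lt_or_gt with huv | huv
    · exact key D hD u v ((h3 u).1 hu) ((h3 v).1 hv) huv
    · rw [Sym2.eq_swap]
      exact key D hD v u ((h3 v).1 hv) ((h3 u).1 hu) huv

/-! ## Yes-instances have short certificates -/

theorem infix_flatMap {α β : Type*} {a : α} {l : List α} (h : a ∈ l) (f : α → List β) :
    f a <:+: l.flatMap f := by
  obtain ⟨s, t, rfl⟩ := List.append_of_mem h
  exact ⟨s.flatMap f, t.flatMap f, by simp⟩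

/-- The time-edges of a temporal graph, as triples of numbers. -/
noncomputable def TemporalGraph.triples {n : ℕ} (𝒢 : TemporalGraph (Fin n)) : List (ℕ × ℕ × ℕ) :=
  (edgeList 𝒢.underlying).flatMap fun p =>
    ((𝒢.label s(p.1, p.2)).sort (· ≤ ·)).map fun t => ((p.1 : ℕ), (p.2 : ℕ), t)

theorem TemporalGraph.mem_triples {n : ℕ} {𝒢 : TemporalGraph (Fin n)} {e : ℕ × ℕ × ℕ} :
    e ∈ 𝒢.triples ↔ ∃ u v : Fin n, u < v ∧ e.2.2 ∈ 𝒢.label s(u, v) ∧ e.1 = u ∧ e.2.1 = v := by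
  obtain ⟨a, b, t⟩ := e
  simp only [triples, List.mem_flatMap, List.mem_map, Prod.mk.injEq, Finset.mem_sort,
    mem_edgeList]
  constructor
  · rintro ⟨⟨u, v⟩, ⟨huv, -⟩, t', ht, rfl, rfl, rfl⟩
    exact ⟨u, v, huv, ht, rfl, rfl⟩
  · rintro ⟨u, v, huv, ht, rfl, rfl⟩
    refine ⟨(u, v), ⟨huv, ?_⟩, t, ht, rfl, rfl, rfl⟩
    exact (SimpleGraph.mem_edgeSet _).1 ((𝒢.label_nonempty_iff _).1 ⟨t, ht⟩)

namespace ETCInstance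

variable (I : ETCInstance)

theorem n_le_length_encode : I.n ≤ I.encode.length := by
  simp only [encode, encodeUnary, List.length_append, List.length_replicate]
  omega

theorem Δ₁_lt : (I.Δ₁ : ℕ) < 2 ^ I.encode.length := by
  refine (Turing.PolyTime.lt_two_pow_length_encodeNat _).trans_le
    (Nat.pow_le_pow_right two_pos ?_)
  simp only [encode, encodeNumber, List.length_append, List.length_map]
  omega

/-- Each time of each edge contributes at least its comma to the encoding. -/
theorem length_triples_le : I.temporalGraph.triples.length ≤ I.encode.length := by
  have h1 : ∀ l : List ℕ, l.length ≤ (l.flatMap encodeNumber).length := by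
    intro l
    induction l with
    | nil => simp
    | cons m l ih => simp [encodeNumber] at ih ⊢; omega
  have h2 : ∀ l : List (Fin I.n × Fin I.n), (l.flatMap fun p =>
      ((I.temporalGraph.label s(p.1, p.2)).sort (· ≤ ·)).map fun t =>
        ((p.1 : ℕ), (p.2 : ℕ), t)).length ≤ ((l.map fun p => (p.1 : ℕ) :: (p.2 : ℕ) ::
      (I.temporalGraph.label s(p.1, p.2)).sort (· ≤ ·)).flatMap encodeBlock).length := by
    intro l
    induction l with
    | nil => simp
    | cons p l ih =>
      have := h1 ((I.temporalGraph.label s(p.1, p.2)).sort (· ≤ ·))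
      simp only [List.flatMap_cons, List.map_cons, List.length_append, encodeBlock,
        List.length_cons, List.length_map] at ih this ⊢
      omega
  refine (h2 _).trans ?_
  simp only [encode, List.length_append]
  omega

/-- The binary digits of the time are a contiguous part of the encoding. -/
theorem lt_of_mem_triples {e : ℕ × ℕ × ℕ} (h : e ∈ I.temporalGraph.triples) :
    e.2.2 < 2 ^ I.encode.length := by
  refine (Turing.PolyTime.lt_two_pow_length_encodeNat _).trans_le
    (Nat.pow_le_pow_right two_pos ?_)
  obtain ⟨u, v, huv, ht, -, -⟩ := TemporalGraph.mem_triples.1 h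
  have h1 : (Computability.encodeNat e.2.2).map Computability.Γ'.bit ++ [.comma] <:+: I.encode := by
    refine List.IsInfix.trans ?_ (List.suffix_append_of_suffix (List.suffix_append_of_suffix
      (List.suffix_append_of_suffix (List.suffix_append _ _)))).isInfix
    rw [List.flatMap_map]
    have h2 : (u, v) ∈ edgeList I.temporalGraph.underlying := mem_edgeList.2 ⟨huv,
      (SimpleGraph.mem_edgeSet _).1 ((I.temporalGraph.label_nonempty_iff _).1 ⟨_, ht⟩)⟩
    have h3 := infix_flatMap h2 fun p => encodeBlock ((p.1 : ℕ) :: (p.2 : ℕ) ::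
      (I.temporalGraph.label s(p.1, p.2)).sort (· ≤ ·))
    refine List.IsInfix.trans ?_ h3
    refine List.IsInfix.trans ?_ ((List.prefix_append _ _).isInfix.trans
      (List.suffix_cons _ _).isInfix)
    exact infix_flatMap (a := e.2.2) (by simp [ht]) encodeNumber
  simpa using (Nat.le_succ _).trans (by simpa using h1.length_le)

end ETCInstance

/-- After some moment that is not too late, a finite set of events has a gap of length `d`. -/
theorem exists_gap (Y : Finset (ℕ × ℕ × ℕ)) (a d : ℕ) :
    ∃ s, a ≤ s ∧ s ≤ a + Y.card * d ∧ ∀ e ∈ Y, e.2.2 ≤ s ∨ s + d < e.2.2 := by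
  by_contra! hc
  -- Otherwise each of `Y.card + 1` disjoint windows of length `d` contains an event.
  have h1 : ∀ j ∈ Finset.range (Y.card + 1), ∃ e ∈ Y, a + j * d < e.2.2 ∧ e.2.2 ≤ a + j * d + d := by
    intro j hj
    have : j ≤ Y.card := by simpa [Nat.lt_succ_iff] using hj
    exact hc _ (Nat.le_add_right _ _) (by gcongr)
  choose! f hf h2 h3 using h1
  have h4 := Finset.card_le_card_of_injOn f hf (fun i hi j hj hij => by
    have h5 := h2 i hi
    have h6 := h3 i hi
    have h7 := h2 j hj
    have h8 := h3 j hj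
    rw [hij] at h5 h6
    have h9 : i * d < (j + 1) * d := by rw [Nat.succ_mul]; omega
    have h10 : j * d < (i + 1) * d := by rw [Nat.succ_mul]; omega
    have h11 := Nat.lt_of_mul_lt_mul_right h9
    have h12 := Nat.lt_of_mul_lt_mul_right h10
    omega)
  simp at h4

/-- Because `Δ₂` is positive, the intervals cannot meet, so one lies before the other and the least
distance is that of the facing ends. In this form independence is checked from the ends alone. -/
theorem Template.Independent.add_le {V : Type*} {Δ₂ : ℕ} (h : 0 < Δ₂) {C D : Template V}
    (hCD : C.Independent Δ₂ D) :
    Disjoint C.verts D.verts ∨ C.last + Δ₂ ≤ D.first ∨ D.last + Δ₂ ≤ C.first := by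
  refine hCD.imp_right fun hCD => ?_
  have hC := C.first_le_last
  have hD := D.first_le_last
  have h1 : ∀ s, C.first ≤ s → s ≤ C.last → D.first ≤ s → s ≤ D.last → False := by
    intro s h1 h2 h3 h4
    have := hCD s ⟨h1, h2⟩ s ⟨h3, h4⟩
    simp at this
    omega
  rcases le_total C.first D.first with h2 | h2
  · left
    have h3 : C.last < D.first := by
      by_contra! h3
      exact h1 _ h2 h3 le_rfl hD
    have := hCD _ ⟨hC, le_rfl⟩ _ ⟨le_rfl, hD⟩
    rw [abs_of_neg (by omega)] at this
    omega
  · right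
    have h3 : D.last < C.first := by
      by_contra! h3
      exact h1 _ le_rfl hC h2 h3
    have := hCD _ ⟨le_rfl, hC⟩ _ ⟨hD, le_rfl⟩
    rw [abs_of_pos (by omega)] at this
    omega

/-- A bound on the lists of a certificate and on the numbers in them. -/
structure CertificateBound (m N : ℕ) (H E : List (ℕ × ℕ × ℕ)) (T : List (ℕ × ℕ × List ℕ)) :
    Prop where
  length_left : H.length ≤ m
  length_edits : E.length ≤ m
  length_templates : T.length ≤ m
  left_lt : ∀ e ∈ H, e.1 < N ∧ e.2.1 < N ∧ e.2.2 < N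
  edits_lt : ∀ e ∈ E, e.1 < N ∧ e.2.1 < N ∧ e.2.2 < N
  templates_lt : ∀ C ∈ T, C.1 < N ∧ C.2.1 < N ∧ C.2.2.length ≤ m ∧ ∀ x ∈ C.2.2, x < N

namespace ETCInstance

theorem mem_triples_iff {I : ETCInstance} {e : ℕ × ℕ × ℕ} : e ∈ I.temporalGraph.triples ↔
    ∃ b ∈ I.timedEdges, b.1 = e.1 ∧ b.2.1 = e.2.1 ∧ ∃ t ∈ b.2.2, t = e.2.2 := by
  rw [TemporalGraph.mem_triples]
  constructor
  · rintro ⟨u, v, huv, ht, h1, h2⟩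
    rw [h1, h2]
    exact (exists_mem_timedEdges huv).2 ht
  · rintro ⟨b, hb, h1, h2, h3⟩
    obtain ⟨p, hp, rfl⟩ := List.mem_map.1 hb
    have huv := (mem_edgeList.1 hp).1
    refine ⟨p.1, p.2, huv, ?_, h1.symm, h2.symm⟩
    exact (exists_mem_timedEdges huv).1 ⟨_, hb, rfl, rfl, h3⟩

theorem certifies_of_mem_iff {I : ETCInstance} {H E : List (ℕ × ℕ × ℕ)}
    (h : ∀ e, e ∉ E → (e ∈ H ↔ e ∈ I.temporalGraph.triples)) :
    (∀ e ∈ H, (∃ b ∈ I.timedEdges, b.1 = e.1 ∧ b.2.1 = e.2.1 ∧ ∃ t ∈ b.2.2, t = e.2.2) ∨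
      ∃ e' ∈ E, e'.1 = e.1 ∧ e'.2.1 = e.2.1 ∧ e'.2.2 = e.2.2) ∧
    ∀ b ∈ I.timedEdges, ∀ t ∈ b.2.2, (∃ e ∈ H, e.1 = b.1 ∧ e.2.1 = b.2.1 ∧ e.2.2 = t) ∨
      ∃ e ∈ E, e.1 = b.1 ∧ e.2.1 = b.2.1 ∧ e.2.2 = t := by
  refine ⟨fun e he => ?_, fun b hb t ht => ?_⟩
  · by_cases h' : e ∈ E
    · exact .inr ⟨e, h', rfl, rfl, rfl⟩
    · exact .inl (mem_triples_iff.1 ((h e h').1 he))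
  · by_cases h' : (b.1, b.2.1, t) ∈ E
    · exact .inr ⟨_, h', rfl, rfl, rfl⟩
    · exact .inl ⟨_, (h _ h').2 (mem_triples_iff.2 ⟨b, hb, rfl, rfl, t, ht, rfl⟩), rfl, rfl, rfl⟩

variable (I : ETCInstance)

/-- A solution is cut off at a gap of length `Δ₁` after all original times. The bounds hold although
neither the times nor the templates of the given solution are bounded in advance. -/
theorem exists_certificate (hI : I.IsYes) : ∃ H E T,
    Certifies I.n I.k I.Δ₁ I.Δ₂ I.timedEdges H E T ∧
    CertificateBound (3 * I.encode.length) (2 ^ (2 * I.encode.length + 2)) H E T := by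
  classical
  set ℓ := I.encode.length with hℓ
  set X := I.temporalGraph.triples.toFinset with hX
  have hXcard : X.card ≤ ℓ := (List.toFinset_card_le _).trans I.length_triples_le
  have hn : I.n ≤ ℓ := I.n_le_length_encode
  have hℓ' : ℓ < 2 ^ ℓ := Nat.lt_two_pow_self
  have hpow : 2 ^ (2 * ℓ + 2) = 4 * (2 ^ ℓ * 2 ^ ℓ) := by ring
  have hpow' : 2 ^ ℓ ≤ 2 ^ ℓ * 2 ^ ℓ := Nat.le_mul_self _
  have hXlt : ∀ e ∈ X, e.1 < I.n ∧ e.2.1 < I.n ∧ e.2.2 < 2 ^ ℓ := by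
    intro e he
    rw [hX, List.mem_toFinset] at he
    have h1 := I.lt_of_mem_triples he
    obtain ⟨u, v, -, -, h2, h3⟩ := TemporalGraph.mem_triples.1 he
    exact ⟨h2 ▸ u.2, h3 ▸ v.2, h1⟩
  -- With enough budget all time-edges are deleted, and no template is needed. Otherwise `I.k <
  -- X.card ≤ ℓ`, which bounds the budget although it is written in binary.
  by_cases hk : X.card ≤ I.k
  · have hEX : X.toList.length ≤ I.k := by simpa using hk
    obtain ⟨h1, h2⟩ := certifies_of_mem_iff (I := I) (H := []) (E := X.toList)
      (fun e he => by simpa [hX] using he)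
    refine ⟨[], X.toList, [], ⟨by simp, hEX, h1, h2, by simp, by simp, by simp, by simp⟩,
      ⟨by simp, ?_, by simp, by simp, fun e he => ?_, by simp⟩⟩
    · simp; omega
    · have := hXlt e (by simpa using he)
      omega
  obtain ⟨edits, hedits, ℋ, hℋ, 𝒞, h𝒞, htimes, hcover, hdense⟩ := hI
  set Y := ℋ.triples.toFinset with hY
  have memY : ∀ {e}, e ∈ Y ↔ ∃ u v : Fin I.n, u < v ∧ e.2.2 ∈ ℋ.label s(u, v) ∧ e.1 = u ∧
      e.2.1 = v := by
    intro e
    rw [hY, List.mem_toFinset, TemporalGraph.mem_triples]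
  -- A triple on which the two graphs differ comes from an edit, with the ends of the edge in
  -- increasing order.
  have hD : ∀ D : Finset (ℕ × ℕ × ℕ), (∀ e ∈ D, ¬(e ∈ X ↔ e ∈ Y)) → D.card ≤ I.k := by
    intro D hD
    refine le_trans ?_ ((Finset.card_image_le (s := edits)
      (f := fun p => ((p.1.inf : ℕ), (p.1.sup : ℕ), p.2))).trans hedits)
    refine Finset.card_le_card fun e he => Finset.mem_image.2 ?_
    have key : ∀ u v : Fin I.n, u < v → e.1 = u → e.2.1 = v → ∃ p ∈ edits,
        ((p.1.inf : ℕ), (p.1.sup : ℕ), p.2) = e := by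
      intro u v huv h1 h2
      refine ⟨(s(u, v), e.2.2), ?_, ?_⟩
      · have h3 := hD e he
        have h4 : ∀ 𝒢 : TemporalGraph (Fin I.n), e ∈ 𝒢.triples ↔ (s(u, v), e.2.2) ∈ 𝒢.timeEdges := by
          intro 𝒢
          rw [TemporalGraph.mem_triples]
          constructor
          · rintro ⟨u', v', -, ht, h5, h6⟩
            obtain rfl := Fin.ext (h1.symm.trans h5)
            obtain rfl := Fin.ext (h2.symm.trans h6)
            exact ht
          · exact fun ht => ⟨u, v, huv, ht, h1, h2⟩
        rw [hX, hY, List.mem_toFinset, List.mem_toFinset, h4, h4, hℋ, Set.mem_symmDiff,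
          Finset.mem_coe] at h3
        tauto
      · simp [Sym2.inf_mk, Sym2.sup_mk, min_eq_left huv.le, max_eq_right huv.le, ← h1, ← h2]
    by_cases h : e ∈ Y
    · obtain ⟨u, v, huv, -, h1, h2⟩ := memY.1 h
      exact key u v huv h1 h2
    · have h' : e ∈ X := by
        have := hD e he
        tauto
      obtain ⟨u, v, huv, -, h1, h2⟩ := TemporalGraph.mem_triples.1 (List.mem_toFinset.1 h')
      exact key u v huv h1 h2
  -- Original times are below `2 ^ ℓ`, so whatever lies after `s` was added by the edits.
  obtain ⟨s, hs1, hs2, hs3⟩ := exists_gap Y (2 ^ ℓ) I.Δ₁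
  set Z := Y.filter fun e => e.2.2 ≤ s with hZ
  set L := Z.sup fun e => e.2.2 with hL
  have hYcard : Y.card ≤ 2 * ℓ := by
    have h1 : (Y \ X).card ≤ I.k := hD _ fun e he => by
      rw [Finset.mem_sdiff] at he
      tauto
    have h2 := Finset.card_le_card_sdiff_add_card (s := Y) (t := X)
    omega
  have hZcard : Z.card ≤ 2 * ℓ := (Finset.card_filter_le _ _).trans hYcard
  -- Here `2ℓ < 2 * 2 ^ ℓ` or `ℓ` is replaced by its bound `2 ^ ℓ`, so `s` is at most `2 ^ ℓ + 2 * 4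
  -- ^ ℓ`.
  have hs : s < 2 ^ (2 * ℓ + 2) := by
    have h1 := I.Δ₁_lt
    rw [← hℓ] at h1
    have h2 : Y.card * I.Δ₁ ≤ 2 * (2 ^ ℓ * 2 ^ ℓ) := by
      rw [← mul_assoc]
      exact Nat.mul_le_mul (by omega) h1.le
    have h3 : 0 < 2 ^ ℓ * 2 ^ ℓ := by positivity
    omega
  have hdense' : ∀ C ∈ 𝒞, ∀ u ∈ C.verts, ∀ v ∈ C.verts, u < v → ∀ τ, C.first ≤ τ →
      τ ≤ max C.first (C.last + 1 - I.Δ₁) → ∃ e ∈ Y, e.1 = u ∧ e.2.1 = v ∧ τ ≤ e.2.2 ∧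
        e.2.2 < τ + I.Δ₁ := by
    intro C hC u hu v hv huv τ h1 h2
    obtain ⟨t, ht, h3, h4⟩ := hdense C hC u hu v hv huv.ne τ ⟨h1, h2⟩
    exact ⟨(u, v, t), memY.2 ⟨u, v, huv, ht, rfl, rfl⟩, rfl, rfl, h3, h4⟩
  have hc : ∀ e ∈ Z, ∃ C ∈ 𝒞, (∃ x ∈ C.verts, (x : ℕ) = e.1) ∧ (∃ x ∈ C.verts, (x : ℕ) = e.2.1) ∧
      C.first ≤ e.2.2 ∧ e.2.2 ≤ C.last := by
    intro e he
    obtain ⟨u, v, -, ht, h1, h2⟩ := memY.1 (Finset.mem_filter.1 he).1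
    obtain ⟨C, hC, h3, h4, h5⟩ := hcover (s(u, v), e.2.2) ht
    exact ⟨C, hC, ⟨u, h3 u (by simp), h1.symm⟩, ⟨v, h3 v (by simp), h2.symm⟩, h4, h5⟩
  have : Nonempty (Template (Fin I.n)) := ⟨⟨∅, 0, 0, le_rfl⟩⟩
  -- The collection may be infinite or contain templates without time-edges; only one template for
  -- each remaining time-edge is kept.
  choose! c hc𝒞 hcu hcv hcfirst hclast using hc
  have hZL : ∀ e ∈ Z, e.2.2 ≤ L := fun e he => Finset.le_sup (f := fun e => e.2.2) he
  have hLs : L ≤ s := Finset.sup_le fun e he => (Finset.mem_filter.1 he).2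
  have hZlt : ∀ e ∈ Z, e.1 < I.n ∧ e.2.1 < I.n ∧ e.2.2 ≤ s := by
    intro e he
    obtain ⟨u, v, -, -, h1, h2⟩ := memY.1 (Finset.mem_filter.1 he).1
    exact ⟨h1 ▸ u.2, h2 ▸ v.2, (Finset.mem_filter.1 he).2⟩
  set E := (X ∪ Z).filter fun e => ¬(e ∈ X ↔ e ∈ Z) with hE
  have hElen : E.toList.length ≤ I.k := by
    rw [Finset.length_toList]
    -- Cutting creates no new difference from `X`: a time-edge common to `X` and `Y` has time at
    -- most `s` and stays in `Z`.
    refine hD _ fun e he => ?_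
    obtain ⟨he, hne⟩ := Finset.mem_filter.1 he
    contrapose! hne
    rw [hne, hZ, Finset.mem_filter, iff_self_and]
    intro heY
    exact ((hXlt e (hne.2 heY)).2.2.le).trans hs1
  obtain ⟨h1, h2⟩ := certifies_of_mem_iff (I := I) (H := Z.toList) (E := E.toList) (fun e he => by
    have h1 : e ∈ I.temporalGraph.triples ↔ e ∈ X := by simp [hX]
    rw [Finset.mem_toList, h1]
    rw [Finset.mem_toList, hE, Finset.mem_filter, Finset.mem_union] at he
    tauto)
  -- Intervals are clipped at `L`, the largest remaining time, to stay within the new lifetime.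
  refine ⟨Z.toList, E.toList, Z.toList.map fun e => ((c e).first, min (c e).last L,
    (c e).verts.toList.map Fin.val), ⟨?_, hElen, h1, h2, ?_, ?_, ?_, ?_⟩,
    ⟨?_, ?_, ?_, ?_, ?_, ?_⟩⟩
  · intro e he
    rw [Finset.mem_toList] at he
    obtain ⟨u, v, huv, ht, h1, h2⟩ := memY.1 (Finset.mem_filter.1 he).1
    rw [h1, h2]
    exact ⟨huv, v.2, ℋ.label_pos _ _ ht⟩
  · intro e he
    rw [Finset.mem_toList] at he
    obtain ⟨x, hx, hx'⟩ := hcu e he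
    obtain ⟨y, hy, hy'⟩ := hcv e he
    refine ⟨_, List.mem_map.2 ⟨e, Finset.mem_toList.2 he, rfl⟩,
      ⟨x, by simpa [Fin.val_inj] using hx, hx'⟩, ⟨y, by simpa [Fin.val_inj] using hy, hy'⟩,
      hcfirst e he, le_min (hclast e he) (hZL e he)⟩
  · intro C hC
    obtain ⟨e, he, rfl⟩ := List.mem_map.1 hC
    rw [Finset.mem_toList] at he
    refine ⟨(htimes _ (hc𝒞 e he)).1,
      le_min (c e).first_le_last ((hcfirst e he).trans (hZL e he)), ?_⟩
    obtain ⟨f, hf, hf'⟩ := Finset.exists_mem_eq_sup Z ⟨e, he⟩ fun e => e.2.2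
    exact ⟨f, Finset.mem_toList.2 hf, (min_le_right _ _).trans hf'.le⟩
  · intro C hC D hD
    obtain ⟨e, he, rfl⟩ := List.mem_map.1 hC
    obtain ⟨f, hf, rfl⟩ := List.mem_map.1 hD
    rw [Finset.mem_toList] at he hf
    -- Several time-edges may have chosen the same template, which then is listed repeatedly.
    by_cases hef : c e = c f
    · left
      rw [hef]
      exact ⟨rfl, rfl, fun x hx => ⟨x, hx, rfl⟩, fun x hx => ⟨x, hx, rfl⟩⟩
    · right
      have h4 := min_le_left (c e).last L
      have h5 := min_le_left (c f).last L
      rcases (h𝒞 (hc𝒞 e he) (hc𝒞 f hf) hef).add_le I.Δ₂.pos with h3 | h3 | h3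
      · left
        intro x hx y hy hxy
        obtain ⟨u, hu, rfl⟩ := List.mem_map.1 hx
        obtain ⟨v, hv, rfl⟩ := List.mem_map.1 hy
        obtain rfl := Fin.ext hxy
        exact Finset.disjoint_left.1 h3 (by simpa using hu) (by simpa using hv)
      · right; left; dsimp only; omega
      · right; right; dsimp only; omega
  · intro C hC
    obtain ⟨e, he, rfl⟩ := List.mem_map.1 hC
    rw [Finset.mem_toList] at he
    intro x hx y hy hxy
    obtain ⟨u, hu, rfl⟩ := List.mem_map.1 hx
    obtain ⟨v, hv, rfl⟩ := List.mem_map.1 hy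
    have hd := hdense' _ (hc𝒞 e he) u (by simpa using hu) v (by simpa using hv) hxy
    have h3 : (c e).first ≤ s := ((hcfirst e he).trans (hZL e he)).trans hLs
    constructor
    · obtain ⟨f, hf, h4, h5, h6, h7⟩ := hd _ le_rfl (le_max_left _ _)
      refine ⟨f, Finset.mem_toList.2 (Finset.mem_filter.2 ⟨hf, ?_⟩), h4, h5, h6, h7⟩
      -- The first window starts by `s`, so its witness is before `s + Δ₁` and, because of the gap,
      -- not after `s`. Only this window needs the gap.
      have := hs3 f hf
      omega
    · intro f hf h4 h5 h6 h7
      have h8 := min_le_left (c e).last L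
      have h9 := min_le_right (c e).last L
      dsimp only at h6 h7
      -- This window ends by the clipped end, hence by `L ≤ s`, so its witness remains.
      obtain ⟨g, hg, h10, h11, h12, h13⟩ := hd _ h6 (le_max_of_le_right (by omega))
      refine ⟨g, Finset.mem_toList.2 (Finset.mem_filter.2 ⟨hg, ?_⟩), h10, h11, ?_, ?_⟩ <;> omega
  · rw [Finset.length_toList]; omega
  · have h3 : E.card ≤ (X ∪ Z).card := Finset.card_filter_le _ _
    have h4 := Finset.card_union_le X Z
    rw [Finset.length_toList]
    omega
  · rw [List.length_map, Finset.length_toList]; omega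
  · intro e he
    have := hZlt e (Finset.mem_toList.1 he)
    omega
  · intro e he
    rcases Finset.mem_union.1 (Finset.mem_filter.1 (Finset.mem_toList.1 he)).1 with he | he
    · have := hXlt e he
      omega
    · have := hZlt e he
      omega
  · intro C hC
    obtain ⟨e, he, rfl⟩ := List.mem_map.1 hC
    rw [Finset.mem_toList] at he
    have h3 := hcfirst e he
    have h4 := hZL e he
    refine ⟨by dsimp only; omega, by dsimp only; omega, ?_, ?_⟩
    · have := Finset.card_le_univ (c e).verts
      rw [Fintype.card_fin] at this
      simp
      omega
    · intro x hx
      obtain ⟨u, hu, rfl⟩ := List.mem_map.1 hx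
      omega

end ETCInstance

/-! ## Editing to Temporal Cliques is in `NP` -/

namespace Turing.PolyTime

open BTree

theorem BTree.size_ofList_le {l : List BTree} {m c : ℕ} (hl : l.length ≤ m)
    (h : ∀ x ∈ l, x.size ≤ c) : (ofList l).size ≤ m * (c + 1) + 1 := by
  rw [size_ofList]
  have h1 := List.sum_le_card_nsmul (l.map fun x => x.size + 1) (c + 1) (by
    intro x hx
    obtain ⟨y, hy, rfl⟩ := List.mem_map.1 hx
    exact Nat.succ_le_succ (h y hy))
  rw [List.length_map, smul_eq_mul] at h1
  have h2 : l.length * (c + 1) ≤ m * (c + 1) := Nat.mul_le_mul_right _ hl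
  omega

theorem length_certificate_le {m M : ℕ} {H E : List (ℕ × ℕ × ℕ)} {T : List (ℕ × ℕ × List ℕ)}
    (h : CertificateBound m (2 ^ M) H E T) : (certificate H E T).length ≤
      m * (12 * M + 6) + 1 + (m * (12 * M + 6) + 1 + (m * (8 * M + m * (4 * M + 2) + 6) + 1) + 1) + 1 := by
  have triples : ∀ l : List (ℕ × ℕ × ℕ), l.length ≤ m →
      (∀ e ∈ l, e.1 < 2 ^ M ∧ e.2.1 < 2 ^ M ∧ e.2.2 < 2 ^ M) →
      (ofTriples l).size ≤ m * (12 * M + 6) + 1 := by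
    intro l hl h
    refine size_ofList_le (c := 12 * M + 5) (by simpa using hl) fun x hx => ?_
    obtain ⟨e, he, rfl⟩ := List.mem_map.1 hx
    obtain ⟨h1, h2, h3⟩ := h e he
    have h4 := size_num_le h1
    have h5 := size_num_le h2
    have h6 := size_num_le h3
    simp only [size_node]
    omega
  have h1 := triples H h.length_left h.left_lt
  have h2 := triples E h.length_edits h.edits_lt
  have h3 : (ofBlocks T).size ≤ m * (8 * M + m * (4 * M + 2) + 6) + 1 := by
    refine size_ofList_le (c := 8 * M + m * (4 * M + 2) + 5) (by simpa using h.length_templates)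
      fun x hx => ?_
    obtain ⟨e, he, rfl⟩ := List.mem_map.1 hx
    obtain ⟨h1, h2, h3, h4⟩ := h.templates_lt e he
    have h5 := size_num_le h1
    have h6 := size_num_le h2
    have h7 : (ofList (e.2.2.map num)).size ≤ m * (4 * M + 2) + 1 :=
      size_ofList_le (c := 4 * M + 1) (by simpa using h3) fun x hx => by
        obtain ⟨y, hy, rfl⟩ := List.mem_map.1 hx
        exact size_num_le (h4 y hy)
    simp only [size_node]
    omega
  rw [certificate, length_bits, size_node, size_node]
  omega

end Turing.PolyTime

open Polynomial in
theorem inNP_editingToTemporalCliquesOn (𝒞 : GraphClass) :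
    (EditingToTemporalCliquesOn 𝒞).InNP := by
  obtain ⟨verify, h1, h2⟩ := Turing.PolyTime.exists_verifier 𝒞
  -- The bounds of `exists_certificate` on the lists and, below, on the number of binary digits.
  let m : ℕ[X] := 3 * X
  let M : ℕ[X] := 2 * X + 2
  refine ⟨m * (12 * M + 6) + 1 + (m * (12 * M + 6) + 1 +
    (m * (8 * M + m * (4 * M + 2) + 6) + 1) + 1) + 1, verify, h1, ?_⟩
  intro (I : {I : ETCInstance // I.temporalGraph.underlying ∈ 𝒞 I.n})
  constructor
  · intro hI
    obtain ⟨H, E, T, h3, h4⟩ := I.1.exists_certificate hI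
    refine ⟨_, (Turing.PolyTime.length_certificate_le h4).trans_eq ?_, (h2 I).2 H E T h3⟩
    simp only [m, M, eval_add, eval_mul, eval_X, eval_ofNat, eval_one]
    rfl
  · rintro ⟨w, -, hw⟩
    obtain ⟨H, E, T, h3⟩ := (h2 I).1 w hw
    exact h3.isYes

/-! ## Correctness of the reduction -/

namespace TemporalGraph

theorem timeEdges_ofStatic {V : Type*} (G : SimpleGraph V) :
    (ofStatic G).timeEdges = {p | p.1 ∈ G.edgeSet ∧ p.2 = 1} := by
  ext ⟨e, t⟩
  by_cases h : e ∈ G.edgeSet <;> simp [timeEdges, ofStatic, h]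

/-- Components are disjoint cliques, so they give independent dense templates. Isolated vertices get
none: without edges the lifetime is 0 and the interval [1,1] would not fit. -/
theorem isClusterTemporalGraph_ofStatic {V : Type*} [Finite V] {H : SimpleGraph V}
    (h : H.IsClusterGraph) : (ofStatic H).IsClusterTemporalGraph 1 1 := by
  classical
  have := Fintype.ofFinite V
  have mem : ∀ {u v : V} {t : ℕ}, t ∈ (ofStatic H).label s(u, v) ↔ H.Adj u v ∧ t = 1 := by
    intro u v t
    rw [mem_label, timeEdges_ofStatic]
    rfl
  refine ⟨{C | C.first = 1 ∧ C.last = 1 ∧ ∃ u v, H.Adj u v ∧ ∀ x, x ∈ C.verts ↔ H.Reachable u x},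
    ?_, ?_, ?_, ?_⟩
  · rintro C ⟨hC1, hC2, u, -, -, hC3⟩ D ⟨hD1, hD2, v, -, -, hD3⟩ hne
    left
    rw [Finset.disjoint_left]
    intro x hx hx'
    refine hne ?_
    rw [hC3] at hx
    rw [hD3] at hx'
    have h5 : C.verts = D.verts := by
      ext y
      rw [hC3, hD3]
      exact ⟨fun hy => hx'.trans (hx.symm.trans hy), fun hy => hx.trans (hx'.symm.trans hy)⟩
    have h1 := hC1.trans hD1.symm
    have h2 := hC2.trans hD2.symm
    cases C; cases D
    cases h1; cases h2; cases h5
    rfl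
  · rintro C ⟨hC1, hC2, u, v, huv, -⟩
    rw [hC1, hC2]
    exact ⟨le_rfl, le_lifetime (mem.2 ⟨huv, rfl⟩)⟩
  · rintro ⟨e, t⟩ ht
    induction e with
    | _ u v =>
      obtain ⟨huv, rfl⟩ := mem.1 ht
      refine ⟨⟨Finset.univ.filter fun x => H.Reachable u x, 1, 1, le_rfl⟩,
        ⟨rfl, rfl, u, v, huv, by simp⟩, ?_, le_rfl, le_rfl⟩
      simp [huv.reachable]
  · rintro C ⟨hC1, hC2, u, -, -, hC3⟩ x hx y hy hxy τ ⟨hτ1, hτ2⟩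
    rw [hC1] at hτ1 hτ2
    rw [hC2] at hτ2
    rw [hC3] at hx hy
    exact ⟨1, mem.2 ⟨h x y (hx.symm.trans hy) hxy, rfl⟩, by simpa using hτ2, by omega⟩

/-- The graph of the edges that appear at time `1`. -/
def firstSnapshot {V : Type*} (𝒢 : TemporalGraph V) : SimpleGraph V :=
  SimpleGraph.fromEdgeSet {e | 1 ∈ 𝒢.label e}

theorem firstSnapshot_adj {V : Type*} {𝒢 : TemporalGraph V} {u v : V} :
    𝒢.firstSnapshot.Adj u v ↔ 1 ∈ 𝒢.label s(u, v) := by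
  rw [firstSnapshot, SimpleGraph.fromEdgeSet_adj]
  exact ⟨fun h => h.1, fun h => ⟨h, ne_of_mem_label h⟩⟩

/-- Adjacency at time 1 is transitive on distinct vertices. Templates covering two edges with a
common vertex at time 1 share a vertex and a moment, so they are equal because 0 < 1; the window of
length 1 at time 1 then supplies the third edge. -/
theorem IsClusterTemporalGraph.isClusterGraph_firstSnapshot {V : Type*} {𝒢 : TemporalGraph V}
    (h : 𝒢.IsClusterTemporalGraph 1 1) : 𝒢.firstSnapshot.IsClusterGraph := by
  obtain ⟨𝒞, h1, h2, h3, h4⟩ := h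
  have trans : ∀ {u v w : V}, 𝒢.firstSnapshot.Adj u v → 𝒢.firstSnapshot.Adj v w → u ≠ w →
      𝒢.firstSnapshot.Adj u w := by
    intro u v w huv hvw huw
    obtain ⟨C, hC, hCv, hC1, hC2⟩ := h3 (s(u, v), 1) (firstSnapshot_adj.1 huv)
    obtain ⟨D, hD, hDv, hD1, hD2⟩ := h3 (s(v, w), 1) (firstSnapshot_adj.1 hvw)
    have hCD : C = D := by
      by_contra hne
      rcases h1 hC hD hne with h | h
      · exact Finset.disjoint_left.1 h (hCv v (by simp)) (hDv v (by simp))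
      · simpa using h 1 ⟨hC1, hC2⟩ 1 ⟨hD1, hD2⟩
    subst hCD
    obtain ⟨t, ht, ht1, ht2⟩ := h4 C hC u (hCv u (by simp)) w (hDv w (by simp)) huw 1
      ⟨hC1, (h2 C hC).1.trans (le_max_left _ _)⟩
    obtain rfl : t = 1 := by omega
    exact firstSnapshot_adj.2 ht
  intro u v huv hne
  rw [SimpleGraph.reachable_iff_reflTransGen] at huv
  induction huv with
  | refl => exact absurd rfl hne
  | @tail b c _ hbc ih =>
    by_cases hub : u = b
    · exact hub ▸ hbc
    · exact trans (ih hub) hbc hne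

end TemporalGraph

theorem isYes_iff_isYes_ofStatic {n : ℕ} (G : SimpleGraph (Fin n)) (k : ℕ+) :
    ClusterEditingInstance.IsYes ⟨n, G, k⟩ ↔
      ETCInstance.IsYes ⟨n, TemporalGraph.ofStatic G, k, 1, 1⟩ := by
  classical
  constructor
  · rintro ⟨edits, hcard, H, hH, hcl⟩
    refine ⟨edits.image fun e => (e, 1), Finset.card_image_le.trans hcard,
      TemporalGraph.ofStatic H, ?_, TemporalGraph.isClusterTemporalGraph_ofStatic hcl⟩
    ext ⟨e, t⟩
    dsimp only at hH
    rw [TemporalGraph.timeEdges_ofStatic, TemporalGraph.timeEdges_ofStatic, hH]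
    simp only [Set.mem_ofPred_eq, Set.mem_symmDiff, Finset.coe_image, Set.mem_image,
      Finset.mem_coe, Prod.mk.injEq]
    constructor
    · rintro ⟨h, rfl⟩
      simpa using h
    · rintro (⟨⟨h1, rfl⟩, h2⟩ | ⟨⟨e', h1, rfl, rfl⟩, h2⟩)
      · exact ⟨.inl ⟨h1, fun h => h2 ⟨e, h, rfl, rfl⟩⟩, rfl⟩
      · exact ⟨.inr ⟨h1, fun h => h2 ⟨h, rfl⟩⟩, rfl⟩
  · rintro ⟨edits, hcard, ℋ, hℋ, hcl⟩
    -- Edits at times other than 1 are discarded, which does not increase their number.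
    refine ⟨(edits.filter fun p => p.2 = 1).image Prod.fst,
      Finset.card_image_le.trans ((Finset.card_filter_le _ _).trans hcard), ℋ.firstSnapshot, ?_,
      hcl.isClusterGraph_firstSnapshot⟩
    ext e
    have h1 : e ∈ ℋ.firstSnapshot.edgeSet ↔ (e, 1) ∈ ℋ.timeEdges := by
      induction e with
      | _ u v => exact TemporalGraph.firstSnapshot_adj
    rw [h1, hℋ]
    dsimp only
    rw [TemporalGraph.timeEdges_ofStatic]
    simp [Set.mem_symmDiff]

theorem isPolyTimeReduction_singleLabelMap (𝒞 : GraphClass) :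
    DecisionProblem.IsPolyTimeReduction (ClusterEditingOn 𝒞) (EditingToTemporalCliquesOn 𝒞)
      (singleLabelMap 𝒞) :=
  ⟨singleLabelMap_computable 𝒞, fun I => isYes_iff_isYes_ofStatic I.1.graph I.1.k⟩

theorem DecisionProblem.IsPolyTimeReduction.trans {P Q R : DecisionProblem}
    {f : P.Instance → Q.Instance} {g : Q.Instance → R.Instance} (hf : IsPolyTimeReduction P Q f)
    (hg : IsPolyTimeReduction Q R g) : IsPolyTimeReduction P R fun x => g (f x) :=
  ⟨hf.1.elim fun h1 => hg.1.elim fun h2 => h1.comp_nonempty h2,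
    fun x => (hf.2 x).trans (hg.2 (f x))⟩

theorem mainTheorem7 (𝒞 : GraphClass) :
    DecisionProblem.IsPolyTimeReduction (ClusterEditingOn 𝒞) (EditingToTemporalCliquesOn 𝒞)
      (singleLabelMap 𝒞) ∧
    ((ClusterEditingOn 𝒞).NPComplete → (EditingToTemporalCliquesOn 𝒞).NPComplete) := by
  refine ⟨isPolyTimeReduction_singleLabelMap 𝒞, fun h =>
    ⟨inNP_editingToTemporalCliquesOn 𝒞, fun L hL => ?_⟩⟩
  obtain ⟨f, hf⟩ := h.2 L hL
  exact ⟨_, hf.trans (isPolyTimeReduction_singleLabelMap 𝒞)⟩
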